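/- Let $(Q,\sigma)$ be a smooth, connected (Hausdorff) Riemannian manifold of dimension $n$ which is flat (its Riemann curvature tensor vanishes identically) and geodesically complete. Let $P=T^*Q$ with projection $\pi$. For $V\in T_mP$, the velocity at $m$ of a curve $(q(t),p(t))$ in $P$, write $\dot q=T\pi V$ and $Dp/dt$ for the covariant derivative of the covector $p$ along $q$, so in coordinates $(Dp/dt)_j=\dot p_j-p_k\Gamma^k_{jl}\dot q^l$. Equip $P$ with the lifted Riemannian metric $$G_m(V,W)=\sigma(T\pi V,T\pi W)+\sigma\big(\sigma^\sharp \tfrac{Dp_V}{dt},\sigma^\sharp\tfrac{Dp_W}{dt}\big)$$ and with the (almost) complex structure $J$ that is multiplication by $i$ on the complex vector $\dot q+i\,\sigma^\sharp\frac{Dp}{dt}\in T_{\pi m}Q\otimes\mathbb C$. A function $\phi:P\to\mathbb C$ is holomorphic if it is differentiable and $d\phi(JV)=i\,d\phi(V)$ for all tangent vectors $V$. Let $m\in P$ and let $b_1,\dots,b_n$ be a basis of $T_{\pi m}Q$. It identifies $T_mP$ with $\mathbb C^n$ through the complex coordinates $z$ given by $\dot q+i\,\sigma^\sharp\frac{Dp}{dt}=\sum_j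 z^jb_j$. Put $|z|^2=G_m(z,z)=\sum_{j,k}\sigma(b_j,b_k)z^j\bar z^k$, and let $dz$ be Lebesgue measure on $\mathbb C^n$. (If the basis is orthonormal, then $|z|^2=\sum_j|z^j|^2$.) Then $(P,G)$ is geodesically complete, so that its exponential map $\exp_m:T_mP\to P$ is defined on all of $T_mP$. Assume that $\exp_m$ is surjective. Let $B_P$ be the complex vector space of all holomorphic $\phi:P\to\mathbb C$ with $\int_{\mathbb C^n}|\phi(\exp_m z)|^2e^{-|z|^2}dz<\infty$. Then $$\langle\phi,\psi\rangle=\int_{\mathbb C^n}\overline{\phi(\exp_m z)}\,\psi(\exp_m z)\,e^{-|z|^2}\,dz$$ is a positive definite Hermitian inner product on $B_P$, and $B_P$ is complete in the associated norm, i.e. a Hilbert space. Moreover $\phi\mapsto\phi\circ\exp_m$ is a linear isometry of $B_P$ onto a closed subspace of the Segal–Bargmann space $\mathcal HL^2(\mathbb C^n,e^{-|z|^2})$, the space of (classes of) entire functions in $L^2(\mathbb C^n,e^{-|z|^2}dz)$. -/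

import Mathlib

open Bundle Manifold MeasureTheory
open scoped ContDiff

set_option maxSynthPendingDepth 3

noncomputable section

namespace FlatPhase

section MetricGeometry

variable {F : Type*} [NormedAddCommGroup F] [NormedSpace ℝ F]
  {H : Type*} [TopologicalSpace H] (I : ModelWithCorners ℝ F H)
  {M : Type*} [TopologicalSpace M] [ChartedSpace H M] [IsManifold I 1 M]

/-- The matrix of the metric `g` in the chart around `x₀`, at the point of `M` with
coordinates `y`: the bilinear form `(∂_u, ∂_v) ↦ g(∂_u, ∂_v)` for coordinate vectors `u`, `v`. -/
def metricInChart (g : ∀ x : M, TangentSpace I x →L[ℝ] TangentSpace I x →L[ℝ] ℝ)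
    (x₀ : M) (y : F) : F →L[ℝ] F →L[ℝ] ℝ :=
  ContinuousLinearMap.bilinearComp (E := F) (F := F) (g ((extChartAt I x₀).symm y))
    (tangentCoordChange I x₀ ((extChartAt I x₀).symm y) ((extChartAt I x₀).symm y))
    (tangentCoordChange I x₀ ((extChartAt I x₀).symm y) ((extChartAt I x₀).symm y))

/-- Christoffel symbols of the first kind in the chart around `x₀`:
`Γ(u, v; w) = ½ (∂_u g(v, w) + ∂_v g(u, w) - ∂_w g(u, v))`. -/
def christoffelFirst (g : ∀ x : M, TangentSpace I x →L[ℝ] TangentSpace I x →L[ℝ] ℝ)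
    (x₀ : M) (y : F) : F →L[ℝ] F →L[ℝ] F →L[ℝ] ℝ :=
  let D : F →L[ℝ] F →L[ℝ] F →L[ℝ] ℝ := fderiv ℝ (metricInChart I g x₀) y
  let D' : F →L[ℝ] F →L[ℝ] F →L[ℝ] ℝ := D.flip
  let D'' : F →L[ℝ] F →L[ℝ] F →L[ℝ] ℝ :=
    (ContinuousLinearMap.flipₗᵢ ℝ F F ℝ).toContinuousLinearEquiv.toContinuousLinearMap ∘L D'
  (1 / 2 : ℝ) • (D + D' - D'')

/-- Christoffel symbols of the Levi-Civita connection in the chart around `x₀`,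
`Γ(u, v)^k = g^{kl} Γ(u, v; l)`. -/
def christoffel (g : ∀ x : M, TangentSpace I x →L[ℝ] TangentSpace I x →L[ℝ] ℝ)
    (x₀ : M) (y : F) : F →L[ℝ] F →L[ℝ] F :=
  ContinuousLinearMap.compL ℝ F (F →L[ℝ] ℝ) F
    (ContinuousLinearMap.inverse (metricInChart I g x₀ y)) ∘L christoffelFirst I g x₀ y

/-- The Riemann curvature tensor in the chart around `x₀`:
`R(u, v)w = ∂_u Γ(v, w) - ∂_v Γ(u, w) + Γ(u, Γ(v, w)) - Γ(v, Γ(u, w))`. -/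
def curvature (g : ∀ x : M, TangentSpace I x →L[ℝ] TangentSpace I x →L[ℝ] ℝ)
    (x₀ : M) (y : F) (u v w : F) : F :=
  fderiv ℝ (christoffel I g x₀) y u v w - fderiv ℝ (christoffel I g x₀) y v u w
    + christoffel I g x₀ y u (christoffel I g x₀ y v w)
    - christoffel I g x₀ y v (christoffel I g x₀ y u w)

/-- The metric is flat: its curvature tensor is identically zero. -/
def IsFlat (g : ∀ x : M, TangentSpace I x →L[ℝ] TangentSpace I x →L[ℝ] ℝ) : Prop :=
  ∀ x₀ : M, ∀ y ∈ (extChartAt I x₀).target, ∀ u v w : F, curvature I g x₀ y u v w = 0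

/-- `γ : ℝ → M` is a geodesic of `g`: a continuous curve that in local coordinates is twice
differentiable and satisfies `c'' + Γ(c', c') = 0`. -/
def IsGeodesic (g : ∀ x : M, TangentSpace I x →L[ℝ] TangentSpace I x →L[ℝ] ℝ)
    (γ : ℝ → M) : Prop :=
  Continuous γ ∧ ∀ (x₀ : M) (t : ℝ), γ t ∈ (chartAt H x₀).source →
    let c : ℝ → F := fun s => extChartAt I x₀ (γ s)
    DifferentiableAt ℝ c t ∧
      HasDerivAt (deriv c) (-(christoffel I g x₀ (c t) (deriv c t) (deriv c t))) t

/-- `γ` is a geodesic of `g`, defined for all times, with `γ(0) = x` and `γ'(0) = v`. (The tangent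
vector `v ∈ T_x M` is given by its components in the preferred chart around `x`.) -/
def IsGeodesicFrom (g : ∀ x : M, TangentSpace I x →L[ℝ] TangentSpace I x →L[ℝ] ℝ)
    (x : M) (v : TangentSpace I x) (γ : ℝ → M) : Prop :=
  IsGeodesic I g γ ∧ γ 0 = x ∧ HasDerivAt (F := F) (fun s => extChartAt I x (γ s)) v 0

/-- Every geodesic of `g` extends to all times. -/
def GeodesicallyComplete
    (g : ∀ x : M, TangentSpace I x →L[ℝ] TangentSpace I x →L[ℝ] ℝ) : Prop :=
  ∀ (x : M) (v : TangentSpace I x), ∃ γ : ℝ → M, IsGeodesicFrom I g x v γ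

open Classical in
/-- The exponential map `exp_x : T_x M → M`, `exp_x v = γ(1)` for the geodesic `γ` with `γ(0) = x`
and `γ'(0) = v` (with the value `x` if there is no such geodesic on all of `ℝ`; this case does not
occur for a geodesically complete metric). -/
def expMap (g : ∀ x : M, TangentSpace I x →L[ℝ] TangentSpace I x →L[ℝ] ℝ)
    (x : M) (v : TangentSpace I x) : M :=
  if h : ∃ γ : ℝ → M, IsGeodesicFrom I g x v γ then h.choose 1 else x

end MetricGeometry

/-- The model space `ℝⁿ`. -/
abbrev Eu (n : ℕ) : Type := EuclideanSpace ℝ (Fin n)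

section Cotangent

variable (n : ℕ) (Q : Type*) [TopologicalSpace Q] [ChartedSpace (Eu n) Q]

/-- Smooth Riemannian metrics on the smooth `n`-manifold `Q`. -/
abbrev SmoothMetric [IsManifold (𝓡 n) ∞ Q] : Type _ :=
  ContMDiffRiemannianMetric (𝓡 n) ∞ (Eu n) (fun q : Q => TangentSpace (𝓡 n) q)

/-- The cotangent bundle `P = T*Q`, with the topology and smooth structure of Mathlib's bundle of
continuous linear maps `T_q Q → ℝ`. Its preferred chart around a point over `q` consists of the
coordinates `(q^i, p_i)` induced by the preferred chart of `Q` around `q`. -/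
abbrev Cotangent [IsManifold (𝓡 n) ∞ Q] : Type _ :=
  TotalSpace (Eu n →L[ℝ] ℝ)
    (fun q : Q => TangentSpace (𝓡 n) q →L[ℝ] Trivial Q ℝ q)

end Cotangent

/-- The model with corners of `T*Q`; a tangent vector of `T*Q` is a pair `(q̇, ṗ)`. -/
abbrev cotModel (n : ℕ) := (𝓡 n).prod 𝓘(ℝ, Eu n →L[ℝ] ℝ)

section PhaseSpace

variable {n : ℕ} {Q : Type*} [TopologicalSpace Q] [ChartedSpace (Eu n) Q]
  [IsManifold (𝓡 n) ∞ Q] (σ : SmoothMetric n Q)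

/-- The isomorphism `σ^♭ : T_q Q → T*_q Q`, in the components of the preferred chart at `q`. -/
def musicalFlat (q : Q) : Eu n →L[ℝ] Eu n →L[ℝ] ℝ := σ.inner q

/-- The isomorphism `σ^♯ : T*_q Q → T_q Q`, inverse to `σ^♭`. -/
def musicalSharp (q : Q) : (Eu n →L[ℝ] ℝ) →L[ℝ] Eu n := ContinuousLinearMap.inverse (musicalFlat σ q)

/-- At `m = (q, p) ∈ T*Q`, the map `q̇ ↦ p_k Γ^k_{ml} q̇^l`. -/
def momentumChristoffel (m : Cotangent n Q) : Eu n →L[ℝ] Eu n →L[ℝ] ℝ :=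
  ContinuousLinearMap.compL ℝ (Eu n) (Eu n) ℝ m.2 ∘L
    christoffel (𝓡 n) σ.inner m.1 (extChartAt (𝓡 n) m.1 m.1)

/-- The covariant derivative `Dp/dt` of the covector along a curve in `T*Q` through `m` with
velocity `(q̇, ṗ)`: in components `(Dp/dt)_m = ṗ_m - p_k Γ^k_{ml} q̇^l`. -/
def covariantVelocity (m : Cotangent n Q) :
    TangentSpace (cotModel n) m →L[ℝ] (Eu n →L[ℝ] ℝ) :=
  ContinuousLinearMap.snd ℝ (Eu n) (Eu n →L[ℝ] ℝ) -
    momentumChristoffel σ m ∘L ContinuousLinearMap.fst ℝ (Eu n) (Eu n →L[ℝ] ℝ)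

/-- The lifted metric on `T*Q`:
`G_m(V, W) = σ(Tπ V, Tπ W) + σ(σ^♯ Dp₁/dt, σ^♯ Dp₂/dt)`. -/
def liftedMetric (m : Cotangent n Q) :
    TangentSpace (cotModel n) m →L[ℝ] TangentSpace (cotModel n) m →L[ℝ] ℝ :=
  (musicalFlat σ m.1).bilinearComp (ContinuousLinearMap.fst ℝ (Eu n) (Eu n →L[ℝ] ℝ))
      (ContinuousLinearMap.fst ℝ (Eu n) (Eu n →L[ℝ] ℝ)) +
    (musicalFlat σ m.1).bilinearComp (musicalSharp σ m.1 ∘L covariantVelocity σ m)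
      (musicalSharp σ m.1 ∘L covariantVelocity σ m)

/-- The tangent vector `V ∈ T_m T*Q` with `Tπ V = a` and `σ^♯ Dp/dt = c`; thus the
complex vector `q̇ + i σ^♯ Dp/dt` of `V` is `a + i c`. -/
def ofHorizVert (m : Cotangent n Q) (a c : Eu n) :
    TangentSpace (cotModel n) m :=
  ((a, musicalFlat σ m.1 c + momentumChristoffel σ m a) : Eu n × (Eu n →L[ℝ] ℝ))

/-- The almost complex structure `J` of `T*Q`: multiplication by `i` of the complex vector
`q̇ + i σ^♯ Dp/dt`. -/
def almostComplex (m : Cotangent n Q) (V : TangentSpace (cotModel n) m) :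
    TangentSpace (cotModel n) m :=
  ofHorizVert σ m (-(musicalSharp σ m.1 (covariantVelocity σ m V))) (V : Eu n × (Eu n →L[ℝ] ℝ)).1

/-- The differential `dφ_m : T_m T*Q → ℂ` of a function `φ : T*Q → ℂ`. -/
def differential (φ : Cotangent n Q → ℂ) (m : Cotangent n Q) :
    TangentSpace (cotModel n) m →L[ℝ] ℂ :=
  mfderiv (cotModel n) 𝓘(ℝ, ℂ) φ m

/-- `φ : T*Q → ℂ` is holomorphic: it is differentiable and `dφ(J V) = i dφ(V)` for all tangent
vectors `V`. -/
def IsHolomorphic (φ : Cotangent n Q → ℂ) : Prop :=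
  MDifferentiable (cotModel n) 𝓘(ℝ, ℂ) φ ∧
    ∀ (m : Cotangent n Q) (V : TangentSpace (cotModel n) m),
      differential φ m (almostComplex σ m V) = Complex.I * differential φ m V

/-- The exponential map of `(T*Q, G)` at `m`. -/
def phaseExp (m : Cotangent n Q) : TangentSpace (cotModel n) m → Cotangent n Q :=
  expMap (cotModel n) (liftedMetric σ) m

/-- The identification `ℂⁿ → T_m T*Q` given by a basis `b` of `T_{π m} Q`: the vector `V`
with complex coordinates `z`, i.e. `q̇ + i σ^♯ Dp/dt = ∑ z^i b_i`. -/
def ofComplexCoords (m : Cotangent n Q) (b : Module.Basis (Fin n) ℝ (TangentSpace (𝓡 n) m.1))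
    (z : Fin n → ℂ) : TangentSpace (cotModel n) m :=
  ofHorizVert σ m (∑ i, (z i).re • b i : TangentSpace (𝓡 n) m.1)
    (∑ i, (z i).im • b i : TangentSpace (𝓡 n) m.1)

/-- The matrix `σ_{ij}` of the metric in the basis `b` of `T_q Q`. -/
def gram (q : Q) (b : Module.Basis (Fin n) ℝ (TangentSpace (𝓡 n) q)) :
    Matrix (Fin n) (Fin n) ℝ :=
  Matrix.of fun i j => σ.inner q (b i) (b j)

end PhaseSpace

section SegalBargmann

variable {n : ℕ}

/-- `|z|² = σ_{ij} z^i z̄^j` (a real number for symmetric `σ_{ij}`). -/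
def absSq (S : Matrix (Fin n) (Fin n) ℝ) (z : Fin n → ℂ) : ℝ :=
  (∑ i, ∑ j, (S i j : ℂ) * z i * (starRingEnd ℂ) (z j)).re

/-- The measure `e^{-|z|²} dz` on `ℂⁿ`, with `dz` Lebesgue measure. -/
def gaussian (S : Matrix (Fin n) (Fin n) ℝ) : Measure (Fin n → ℂ) :=
  volume.withDensity fun z => ENNReal.ofReal (Real.exp (-absSq S z))

/-- The Segal–Bargmann space `HL²(ℂⁿ, e^{-|z|²})`: the classes in `L²(ℂⁿ, e^{-|z|²})` that are
represented by an entire function. For the identity matrix `S` this is the usual one. -/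
def SegalBargmann (S : Matrix (Fin n) (Fin n) ℝ) : Submodule ℂ (Lp ℂ 2 (gaussian S)) where
  carrier := {f | ∃ h : (Fin n → ℂ) → ℂ, Differentiable ℂ h ∧ f =ᵐ[gaussian S] h}
  zero_mem' := ⟨fun _ => 0, by fun_prop, Lp.coeFn_zero _ _ _⟩
  add_mem' := by
    rintro f g ⟨h, hh, hf⟩ ⟨k, hk, hg⟩
    exact ⟨h + k, hh.add hk, (Lp.coeFn_add f g).trans (hf.add hg)⟩
  smul_mem' := by
    rintro c f ⟨h, hh, hf⟩
    exact ⟨c • h, hh.const_smul c, (Lp.coeFn_smul c f).trans (hf.const_smul c)⟩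

end SegalBargmann

section Bargmann

variable {n : ℕ} {Q : Type*} [TopologicalSpace Q] [ChartedSpace (Eu n) Q]
  [IsManifold (𝓡 n) ∞ Q] (σ : SmoothMetric n Q)

/-- The pull-back `z ↦ φ(exp_m z)` of a function on `T*Q`, in the complex coordinates of
`T_m T*Q` given by `b`. -/
def pullback (m : Cotangent n Q) (b : Module.Basis (Fin n) ℝ (TangentSpace (𝓡 n) m.1))
    (φ : Cotangent n Q → ℂ) (z : Fin n → ℂ) : ℂ :=
  φ (phaseExp σ m (ofComplexCoords σ m b z))

/-- The linear space of square integrable holomorphic functions on `T*Q`: holomorphic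
functions `φ` with `∫ |φ(exp_m z)|² e^{-|z|²} dz < ∞`. -/
def squareIntegrableHolomorphic (m : Cotangent n Q)
    (b : Module.Basis (Fin n) ℝ (TangentSpace (𝓡 n) m.1)) : Submodule ℂ (Cotangent n Q → ℂ) where
  carrier := {φ | IsHolomorphic σ φ ∧ MemLp (pullback σ m b φ) 2 (gaussian (gram σ m.1 b))}
  zero_mem' := by
    refine ⟨⟨mdifferentiable_const, fun m V => ?_⟩, MemLp.zero⟩
    have : differential (0 : Cotangent n Q → ℂ) m = 0 := mfderiv_const
    simp [this]
  add_mem' := by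
    rintro φ ψ ⟨⟨h1, h2⟩, h3⟩ ⟨⟨k1, k2⟩, k3⟩
    refine ⟨⟨h1.add k1, fun m V => ?_⟩, h3.add k3⟩
    have e : differential (φ + ψ) m = differential φ m + differential ψ m :=
      mfderiv_add (h1 m) (k1 m)
    rw [e, add_apply, add_apply, h2, k2, mul_add]
  smul_mem' := by
    rintro c φ ⟨⟨h1, h2⟩, h3⟩
    have e (m : Cotangent n Q) : HasMFDerivAt (cotModel n) 𝓘(ℝ, ℂ) (c • φ) m
        ((c • ContinuousLinearMap.id ℝ ℂ) ∘L differential φ m) :=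
      HasMFDerivAt.comp m (I' := 𝓘(ℝ, ℂ)) (g := fun w : ℂ => c • w)
        ((c • ContinuousLinearMap.id ℝ ℂ).hasMFDerivAt) (h1 m).hasMFDerivAt
    refine ⟨⟨fun m => (e m).mdifferentiableAt, fun m V => ?_⟩, h3.const_smul c⟩
    have e' : differential (c • φ) m = (c • ContinuousLinearMap.id ℝ ℂ) ∘L differential φ m :=
      (e m).mfderiv
    rw [e', ContinuousLinearMap.comp_apply, ContinuousLinearMap.comp_apply, h2]
    simp [mul_left_comm]

/-- The space `B_P` of square integrable holomorphic functions on `P = T*Q`, as a complex vector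
space without topology. -/
def BargmannSpace (m : Cotangent n Q) (b : Module.Basis (Fin n) ℝ (TangentSpace (𝓡 n) m.1)) :
    Type _ :=
  squareIntegrableHolomorphic σ m b

instance (m : Cotangent n Q) (b : Module.Basis (Fin n) ℝ (TangentSpace (𝓡 n) m.1)) :
    AddCommGroup (BargmannSpace σ m b) :=
  inferInstanceAs (AddCommGroup (squareIntegrableHolomorphic σ m b))

instance (m : Cotangent n Q) (b : Module.Basis (Fin n) ℝ (TangentSpace (𝓡 n) m.1)) :
    Module ℂ (BargmannSpace σ m b) :=
  inferInstanceAs (Module ℂ (squareIntegrableHolomorphic σ m b))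

instance (m : Cotangent n Q) (b : Module.Basis (Fin n) ℝ (TangentSpace (𝓡 n) m.1)) :
    CoeFun (BargmannSpace σ m b) (fun _ => Cotangent n Q → ℂ) :=
  ⟨fun φ => φ.1⟩

end Bargmann

end FlatPhase

end

/-!
A flat metric is locally Euclidean: where the curvature vanishes, the equation of a parallel coframe
is integrable, hence solvable (`exists_hasFDerivAt_of_integrable`), and a parallel coframe is
closed, so it consists of the differentials of flat coordinates (`exists_flat_coordinates`,
`IsFlat.locallyFlat`). In flat coordinates geodesics are straight lines, and by continuation along
geodesics the exponential map `E : ℝⁿ → Q` of a complete flat manifold is a local isometry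
everywhere (`flatAt_modelExp`).

A local isometry `E` lifts to `T*E : (x, w) ↦ (E x, w ∘ (dE_x)⁻¹)`, from `ℝⁿ × (ℝⁿ)*` to `T*Q`. In a
chart `κ` of `Q` the Christoffel symbols are `-(κ ∘ E)''`, so the covariant derivative `Dp/dt` of
the image of a curve `(x(t), w(t))` is just `ẇ ∘ (dE_x)⁻¹` (`chartVel_cotLift`). Hence `T*E` is a
local isometry from a Euclidean space to `T*Q` with the lifted metric (`flatAt_cotLift`), and its
derivative commutes with the complex structures (`chartVel_cotLift_pullForm`). Lines in
`ℝⁿ × (ℝⁿ)*` are therefore mapped to geodesics, which gives completeness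
(`geodesicallyComplete_liftedMetric`) and identifies `exp_m` with `T*E` up to a translation and a
linear isomorphism (`phaseExp_ofHorizVert`). As `exp_m` is a holomorphic local diffeomorphism, the
pull-back of a holomorphic function is entire, and conversely, if `exp_m` is surjective, a function
with entire pull-back is holomorphic (`isHolomorphic_of_differentiable_pullback`).

Thus `φ ↦ φ ∘ exp_m` is an injective linear map of `B_P` into `L²(ℂⁿ, e^{-|z|²})` with values in the
Segal–Bargmann space, and all that remains is that its range is closed. By the mean value property,
point evaluations of entire functions are bounded by the `L²`-norm, locally uniformly
(`exists_enorm_le_eLpNorm`). An `L²`-limit of entire functions `φ_k ∘ exp_m` is therefore an entire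
function which is also their pointwise limit, so it is constant on the fibres of `exp_m` and is
itself of the form `φ ∘ exp_m` (`isClosed_range_pullbackLp`).
-/

noncomputable section

namespace FlatPhase

/-! ### Linear total differential equations -/

section Frobenius

open Filter Topology Set
open scoped unitInterval BoundedContinuousFunction

variable {F V W : Type*} [NormedAddCommGroup F] [NormedSpace ℝ F]
  [NormedAddCommGroup V] [NormedSpace ℝ V] [NormedAddCommGroup W] [NormedSpace ℝ W]

/-- A map into the space of continuous functions on a compact space is differentiable as soon as its
point values are, with jointly continuous derivatives. -/
theorem hasFDerivAt_boundedContinuousFunction {S : Type*} [TopologicalSpace S] [CompactSpace S]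
    {a : F → (S →ᵇ W)} {a' : F → S → F →L[ℝ] W} {L : F →L[ℝ] (S →ᵇ W)} {u₀ : F}
    (hd : ∀ᶠ u in 𝓝 u₀, ∀ s, HasFDerivAt (fun u => a u s) (a' u s) u)
    (hc : ∀ s, ContinuousAt (fun q : F × S => a' q.1 q.2) (u₀, s))
    (hL : ∀ h s, L h s = a' u₀ s h) : HasFDerivAt a L u₀ := by
  rw [hasFDerivAt_iff_isLittleO, Asymptotics.isLittleO_iff]
  intro ε hε
  have key : ∀ᶠ u in 𝓝 u₀, ∀ s ∈ (univ : Set S), ‖a' u s - a' u₀ s‖ < ε := by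
    refine IsCompact.eventually_forall_of_forall_eventually isCompact_univ fun s _ => ?_
    have h2 : ContinuousAt (fun q : F × S => a' u₀ q.2) (u₀, s) := by
      have : ContinuousAt (fun q : F × S => (u₀, q.2)) (u₀, s) := by fun_prop
      exact ContinuousAt.comp (f := fun q : F × S => (u₀, q.2))
        (g := fun q : F × S => a' q.1 q.2) (hc s) this
    have h3 := ((hc s).sub h2).norm
    have : ∀ᶠ q : F × S in 𝓝 (u₀, s), ‖a' q.1 q.2 - a' u₀ q.2‖ < ε :=
      h3.eventually_lt continuousAt_const (by simpa using hε)
    exact this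
  obtain ⟨δ, hδ, hball⟩ := Metric.eventually_nhds_iff_ball.1 (hd.and key)
  filter_upwards [Metric.ball_mem_nhds u₀ hδ] with u hu
  rw [BoundedContinuousFunction.norm_le (by positivity)]
  intro s
  have := (convex_ball u₀ δ).norm_image_sub_le_of_norm_hasFDerivWithin_le' (C := ε)
    (f := fun u => a u s) (φ := a' u₀ s)
    (fun y hy => ((hball y hy).1 s).hasFDerivWithinAt)
    (fun y hy => ((hball y hy).2 s (mem_univ s)).le) (Metric.mem_ball_self hδ) hu
  simpa [hL] using this

/-- Integration from `0`, as an operator on continuous functions on the unit interval. -/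
def volterra : (I →ᵇ V) →L[ℝ] (I →ᵇ V) :=
  LinearMap.mkContinuous
    { toFun := fun f =>
        BoundedContinuousFunction.mkOfCompact
        { toFun := fun t => ∫ s in (0 : ℝ)..t, f (projIcc 0 1 zero_le_one s)
          continuous_toFun := by
            have hf : Continuous fun s : ℝ => f (projIcc 0 1 zero_le_one s) :=
              f.continuous.comp continuous_projIcc
            exact (intervalIntegral.continuous_primitive
              (fun a b => hf.intervalIntegrable a b) 0).comp continuous_subtype_val }
      map_add' := by
        intro f g
        ext t
        have hf : Continuous fun s : ℝ => f (projIcc 0 1 zero_le_one s) :=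
          f.continuous.comp continuous_projIcc
        have hg : Continuous fun s : ℝ => g (projIcc 0 1 zero_le_one s) :=
          g.continuous.comp continuous_projIcc
        exact intervalIntegral.integral_add (hf.intervalIntegrable _ _) (hg.intervalIntegrable _ _)
      map_smul' := by
        intro c f
        ext t
        exact intervalIntegral.integral_smul c _ } 1 (by
    intro f
    rw [BoundedContinuousFunction.norm_le (by positivity)]
    intro t
    have := intervalIntegral.norm_integral_le_of_norm_le_const (a := 0) (b := t) (C := ‖f‖)
      (f := fun s => f (projIcc 0 1 zero_le_one s)) (fun s _ => f.norm_coe_le_norm _)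
    refine this.trans ?_
    rw [sub_zero, abs_of_nonneg t.2.1, one_mul]
    exact mul_le_of_le_one_right (norm_nonneg _) t.2.2)

theorem volterra_apply (f : I →ᵇ V) (t : I) :
    volterra f t = ∫ s in (0 : ℝ)..t, f (projIcc 0 1 zero_le_one s) := rfl

theorem norm_volterra_le : ‖(volterra : (I →ᵇ V) →L[ℝ] (I →ᵇ V))‖ ≤ 1 :=
  LinearMap.mkContinuous_norm_le _ zero_le_one _

/-- The fundamental theorem of calculus: `volterra f` is the primitive of `f` vanishing at `0`. -/
theorem volterra_eq_of_hasDerivAt [CompleteSpace V] {f : I →ᵇ V} {g : I → V}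
    (hg : Continuous g) (hg0 : g 0 = 0)
    (h : ∀ t : ℝ, (ht : t ∈ Ioo (0 : ℝ) 1) →
      HasDerivAt (fun s : ℝ => g (projIcc 0 1 zero_le_one s)) (f ⟨t, Ioo_subset_Icc_self ht⟩) t)
    (t : I) : volterra f t = g t := by
  have hf : Continuous fun s : ℝ => f (projIcc 0 1 zero_le_one s) :=
    f.continuous.comp continuous_projIcc
  rw [volterra_apply, intervalIntegral.integral_eq_sub_of_hasDerivAt_of_le t.2.1
    (f := fun s : ℝ => g (projIcc 0 1 zero_le_one s))]
  · simp [hg0]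
  · exact (hg.comp continuous_projIcc).continuousOn
  · intro s hs
    have hs' : s ∈ Ioo (0 : ℝ) 1 := ⟨hs.1, hs.2.trans_le t.2.2⟩
    rw [projIcc_of_mem _ (Ioo_subset_Icc_self hs')]
    exact h s hs'
  · exact hf.intervalIntegrable _ _

theorem hasDerivAt_volterra [CompleteSpace V] (f : I →ᵇ V) {t : ℝ} (ht : t ∈ Ioo (0 : ℝ) 1) :
    HasDerivAt (fun s : ℝ => volterra f (projIcc 0 1 zero_le_one s))
      (f ⟨t, Ioo_subset_Icc_self ht⟩) t := by
  have hf : Continuous fun s : ℝ => f (projIcc 0 1 zero_le_one s) :=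
    f.continuous.comp continuous_projIcc
  have h := intervalIntegral.integral_hasDerivAt_right (hf.intervalIntegrable 0 t)
    (hf.stronglyMeasurableAtFilter _ _) hf.continuousAt
  rw [projIcc_of_mem _ (Ioo_subset_Icc_self ht)] at h
  refine h.congr_of_eventuallyEq ?_
  filter_upwards [isOpen_Ioo.mem_nhds ht] with s hs
  rw [volterra_apply, projIcc_of_mem _ (Ioo_subset_Icc_self hs)]

/-- Pointwise application of operator valued to vector valued continuous functions. -/
def pointwiseApply : (I →ᵇ (V →L[ℝ] V)) →L[ℝ] (I →ᵇ V) →L[ℝ] (I →ᵇ V) :=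
  LinearMap.mkContinuous₂
    (LinearMap.mk₂ ℝ (fun (a : I →ᵇ (V →L[ℝ] V)) (f : I →ᵇ V) =>
      BoundedContinuousFunction.mkOfCompact
        (⟨fun t => a t (f t), a.continuous.clm_apply f.continuous⟩ : C(I, V)))
      (fun _ _ _ => by ext; simp) (fun _ _ _ => by ext; simp)
      (fun _ _ _ => by ext; simp) (fun _ _ _ => by ext; simp)) 1 (by
    intro a f
    rw [BoundedContinuousFunction.norm_le (by positivity), one_mul]
    intro t
    exact ((a t).le_opNorm (f t)).trans
      (mul_le_mul (a.norm_coe_le_norm t) (f.norm_coe_le_norm t) (norm_nonneg _) (norm_nonneg _)))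

theorem pointwiseApply_apply (a : I →ᵇ (V →L[ℝ] V)) (f : I →ᵇ V) (t : I) :
    pointwiseApply a f t = a t (f t) := rfl

theorem norm_pointwiseApply_le (a : I →ᵇ (V →L[ℝ] V)) : ‖pointwiseApply a‖ ≤ ‖a‖ := by
  refine ((pointwiseApply (V := V)).le_opNorm a).trans ?_
  have : ‖(pointwiseApply : (I →ᵇ (V →L[ℝ] V)) →L[ℝ] (I →ᵇ V) →L[ℝ] (I →ᵇ V))‖ ≤ 1 :=
    LinearMap.mkContinuous₂_norm_le _ zero_le_one _
  exact mul_le_of_le_one_left (norm_nonneg _) this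

/-- A continuous function with values in linear maps is a linear map into continuous functions. -/
theorem exists_clm_of_boundedContinuousFunction {S : Type*} [TopologicalSpace S] [CompactSpace S]
    (c : S →ᵇ (F →L[ℝ] W)) : ∃ L : F →L[ℝ] (S →ᵇ W), ∀ h s, L h s = c s h := by
  refine ⟨LinearMap.mkContinuous
    { toFun := fun h => BoundedContinuousFunction.mkOfCompact
        ⟨fun s => c s h, c.continuous.clm_apply continuous_const⟩
      map_add' := fun _ _ => by ext; simp
      map_smul' := fun _ _ => by ext; simp } ‖c‖ (fun h => ?_), fun h s => rfl⟩
  rw [BoundedContinuousFunction.norm_le (by positivity)]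
  exact fun s => ((c s).le_opNorm h).trans
    (mul_le_mul_of_nonneg_right (c.norm_coe_le_norm s) (norm_nonneg _))

/-- The integral operator `f ↦ ∫₀ᵗ a f` of the linear equation `f' = a f`. -/
def volterraMul : (I →ᵇ (V →L[ℝ] V)) →L[ℝ] ((I →ᵇ V) →L[ℝ] (I →ᵇ V)) :=
  ContinuousLinearMap.compL ℝ (I →ᵇ V) (I →ᵇ V) (I →ᵇ V) volterra ∘L pointwiseApply

theorem volterraMul_apply (b : I →ᵇ (V →L[ℝ] V)) (f : I →ᵇ V) :
    volterraMul b f = volterra (pointwiseApply b f) := rfl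

theorem norm_volterraMul_le (b : I →ᵇ (V →L[ℝ] V)) : ‖volterraMul b‖ ≤ ‖b‖ := by
  refine ContinuousLinearMap.opNorm_le_bound _ (norm_nonneg b) fun f => ?_
  rw [volterraMul_apply]
  refine ((volterra (V := V)).le_of_opNorm_le norm_volterra_le _).trans ?_
  rw [one_mul]
  exact ((pointwiseApply b).le_of_opNorm_le (norm_pointwiseApply_le b) f)

theorem hasFDerivAt_inverse_apply [CompleteSpace V] {A : F → V →L[ℝ] V}
    {A' : F →L[ℝ] V →L[ℝ] V} {u : F} (hA : HasFDerivAt A A' u) (hu : IsUnit (A u)) (c : V) :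
    HasFDerivAt (fun u => Ring.inverse (A u) c) (fderiv ℝ (fun u => Ring.inverse (A u) c) u) u ∧
    ∀ h, fderiv ℝ (fun u => Ring.inverse (A u) c) u h
      = -Ring.inverse (A u) (A' h (Ring.inverse (A u) c)) := by
  obtain ⟨x, hx⟩ := hu
  have h2 := hasFDerivAt_ringInverse (𝕜 := ℝ) x
  rw [hx] at h2
  have h4 := (h2.comp u hA).clm_apply (hasFDerivAt_const c u)
  refine ⟨h4.differentiableAt.hasFDerivAt, fun h => ?_⟩
  have hxinv : (↑x⁻¹ : V →L[ℝ] V) = Ring.inverse (A u) := by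
    rw [← hx, Ring.inverse_unit]
  have h5 := congrArg (fun T => T h) h4.fderiv
  refine h5.trans ?_
  simp [hxinv]

/-- The Frobenius theorem for a linear total differential equation `dθ_y(h) = η_y(h) θ(y)`: it has
a local solution with any initial value if `η` satisfies the integrability condition `hint`.

Along the ray `s ↦ y₀ + s u` a solution satisfies the linear equation `Z' = η(u) Z`, which is solved
by inverting `1 - K_u` for the Volterra operator `K_u` with the coefficient `η(u)`. Inversion is
differentiable, so the solution depends differentiably on `u`; its derivative in the direction `h`
is found by uniqueness, since integrability makes `t ↦ η(t h) Z(t)` a solution of the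
differentiated integral equation. -/
theorem exists_hasFDerivAt_of_integrable [CompleteSpace V] {η : F → F →L[ℝ] V →L[ℝ] V} {U : Set F}
    (hU : IsOpen U) (hη : ContDiffOn ℝ 1 η U)
    (hint : ∀ y ∈ U, ∀ h u Z, fderiv ℝ η y h u Z + η y u (η y h Z)
      = fderiv ℝ η y u h Z + η y h (η y u Z)) {y₀ : F} (hy₀ : y₀ ∈ U) (Z₀ : V) :
    ∃ θ : F → V, θ y₀ = Z₀ ∧ ∀ᶠ y in 𝓝 y₀, HasFDerivAt θ ((η y).flip (θ y)) y := by
  obtain ⟨r, hr, hrU⟩ := Metric.isOpen_iff.1 hU y₀ hy₀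
  have hmem : ∀ u ∈ Metric.ball (0 : F) r, ∀ s : I, y₀ + (s : ℝ) • u ∈ U := by
    intro u hu s
    apply hrU
    rw [mem_ball_iff_norm, add_sub_cancel_left, norm_smul, Real.norm_of_nonneg s.2.1]
    exact (mul_le_of_le_one_left (norm_nonneg _) s.2.2).trans_lt (mem_ball_zero_iff.1 hu)
  have hηc : ContinuousOn η U := hη.continuousOn
  have hη'c : ContinuousOn (fderiv ℝ η) U := hη.continuousOn_fderiv_of_isOpen hU le_rfl
  have hηd : ∀ y ∈ U, HasFDerivAt η (fderiv ℝ η y) y := fun y hy =>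
    ((hη.differentiableOn one_ne_zero).differentiableAt (hU.mem_nhds hy)).hasFDerivAt
  -- the coefficients along the ray in direction `u`, and their derivative in `u`; `mkD` gives the
  -- junk value `0` for `u` outside the ball, where the ray may leave `U`
  have hcont : ∀ u ∈ Metric.ball (0 : F) r, Continuous fun s : I => η (y₀ + (s : ℝ) • u) u :=
    fun u hu => (hηc.comp_continuous (by fun_prop) (hmem u hu)).clm_apply continuous_const
  let a : F → (I →ᵇ (V →L[ℝ] V)) := fun u => BoundedContinuousFunction.mkOfCompact
    (ContinuousMap.mkD (fun s => η (y₀ + (s : ℝ) • u) u) 0)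
  have ha : ∀ u ∈ Metric.ball (0 : F) r, ∀ s, a u s = η (y₀ + (s : ℝ) • u) u := fun u hu s => by
    simp only [a, ContinuousMap.mkD_of_continuous (hcont u hu)]; rfl
  let a' : F → I → F →L[ℝ] V →L[ℝ] V := fun u s =>
    (s : ℝ) • ((fderiv ℝ η (y₀ + (s : ℝ) • u)).flip u) + η (y₀ + (s : ℝ) • u)
  have ha'c : ∀ u ∈ Metric.ball (0 : F) r, ∀ s : I,
      ContinuousAt (fun q : F × I => a' q.1 q.2) (u, s) := by
    intro u hu s
    have h1 : ContinuousAt (fun q : F × I => y₀ + (q.2 : ℝ) • q.1) (u, s) := by fun_prop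
    have h2 : ContinuousAt (fun q : F × I => η (y₀ + (q.2 : ℝ) • q.1)) (u, s) :=
      ContinuousAt.comp (f := fun q : F × I => y₀ + (q.2 : ℝ) • q.1) (g := η)
        (hηc.continuousAt (hU.mem_nhds (hmem u hu s))) h1
    have h3 : ContinuousAt (fun q : F × I => fderiv ℝ η (y₀ + (q.2 : ℝ) • q.1)) (u, s) :=
      ContinuousAt.comp (f := fun q : F × I => y₀ + (q.2 : ℝ) • q.1) (g := fderiv ℝ η)
        (hη'c.continuousAt (hU.mem_nhds (hmem u hu s))) h1
    have h4 : ContinuousAt (fun q : F × I => (fderiv ℝ η (y₀ + (q.2 : ℝ) • q.1)).flip) (u, s) :=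
      (ContinuousLinearMap.flipₗᵢ ℝ F F (V →L[ℝ] V)).continuous.continuousAt.comp h3
    have h5 : ContinuousAt (fun q : F × I => (q.2 : ℝ)) (u, s) := by fun_prop
    exact (h5.smul (h4.clm_apply continuousAt_fst)).add h2
  have had : ∀ u ∈ Metric.ball (0 : F) r, ∀ s, HasFDerivAt (fun u => a u s) (a' u s) u := by
    intro u hu s
    have h1 : HasFDerivAt (fun u : F => y₀ + (s : ℝ) • u)
        ((s : ℝ) • ContinuousLinearMap.id ℝ F) u :=
      ((hasFDerivAt_id u).const_smul (s : ℝ)).const_add y₀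
    have h2 : HasFDerivAt (fun u : F => η (y₀ + (s : ℝ) • u))
        (fderiv ℝ η (y₀ + (s : ℝ) • u) ∘L ((s : ℝ) • ContinuousLinearMap.id ℝ F)) u :=
      HasFDerivAt.comp u (f := fun u : F => y₀ + (s : ℝ) • u) (hηd _ (hmem u hu s)) h1
    have h3 := h2.clm_apply (hasFDerivAt_id u)
    have h4 : HasFDerivAt (fun u : F => η (y₀ + (s : ℝ) • u) u) (a' u s) u := by
      refine h3.congr_fderiv ?_
      ext h Z
      simp [a', add_comm]
    refine h4.congr_of_eventuallyEq ?_
    filter_upwards [Metric.isOpen_ball.mem_nhds hu] with v hv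
    exact ha v hv s
  have ha'L : ∀ u ∈ Metric.ball (0 : F) r,
      ∃ L : F →L[ℝ] (I →ᵇ (V →L[ℝ] V)), ∀ h s, L h s = a' u s h := fun u hu =>
    exists_clm_of_boundedContinuousFunction (.mkOfCompact ⟨a' u,
      continuous_iff_continuousAt.2 fun s => ContinuousAt.comp (f := fun s : I => (u, s))
        (g := fun q : F × I => a' q.1 q.2)
        (ha'c u hu s) (by fun_prop)⟩)
  choose! L hL using ha'L
  have haL : ∀ u ∈ Metric.ball (0 : F) r, HasFDerivAt a (L u) u := fun u hu =>
    hasFDerivAt_boundedContinuousFunction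
      (Filter.eventually_of_mem (Metric.isOpen_ball.mem_nhds hu) fun v hv s => had v hv s)
      (ha'c u hu) (hL u hu)
  -- the Volterra operator of the linear equation along the ray, and the solution
  let c₀ : (I →ᵇ V) := BoundedContinuousFunction.const I Z₀
  let Z : F → (I →ᵇ V) := fun u => Ring.inverse (1 - volterraMul (a u)) c₀
  have ha0 : a 0 = 0 := by
    ext1 s
    rw [ha 0 (Metric.mem_ball_self hr)]
    simp
  have hsmall : ∀ᶠ u in 𝓝 (0 : F), ‖a u‖ < 1 := by
    have h1 : ContinuousAt (fun u => ‖a u‖) 0 :=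
      (haL 0 (Metric.mem_ball_self hr)).continuousAt.norm
    exact h1.eventually_lt continuousAt_const (by simp [ha0])
  have hunit : ∀ u, ‖a u‖ < 1 → IsUnit (1 - volterraMul (a u)) := fun u hu =>
    isUnit_one_sub_of_norm_lt_one ((norm_volterraMul_le _).trans_lt hu)
  have hZeq : ∀ u, ‖a u‖ < 1 → Z u = c₀ + volterra (pointwiseApply (a u) (Z u)) := by
    intro u hu
    have h1 : (1 - volterraMul (a u)) (Z u) = c₀ := by
      have := Ring.mul_inverse_cancel _ (hunit u hu)
      exact congrArg (fun A : (I →ᵇ V) →L[ℝ] (I →ᵇ V) => A c₀) this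
    have h2 : Z u - volterraMul (a u) (Z u) = c₀ := h1
    rw [← volterraMul_apply, ← h2, sub_add_cancel]
  have huniq : ∀ u, ‖a u‖ < 1 → ∀ f g : (I →ᵇ V), f - volterra (pointwiseApply (a u) f) = g →
      f = Ring.inverse (1 - volterraMul (a u)) g := by
    intro u hu f g hfg
    have h1 : (1 - volterraMul (a u)) f = g := hfg
    have := Ring.inverse_mul_cancel _ (hunit u hu)
    rw [← h1]
    exact (congrArg (fun A : (I →ᵇ V) →L[ℝ] (I →ᵇ V) => A f) this).symm
  have hZ' : ∀ u ∈ Metric.ball (0 : F) r, ‖a u‖ < 1 →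
      ∀ h (t : I), HasFDerivAt Z (fderiv ℝ Z u) u ∧
      fderiv ℝ Z u h t = η (y₀ + (t : ℝ) • u) ((t : ℝ) • h) (Z u t) := by
    intro u hu hu1 h t
    have h1 : HasFDerivAt (fun u => 1 - volterraMul (a u)) (-(volterraMul ∘L L u)) u :=
      ((volterraMul (V := V)).hasFDerivAt.comp u (haL u hu)).const_sub (1 : (I →ᵇ V) →L[ℝ] (I →ᵇ V))
    obtain ⟨h4, h4'⟩ := hasFDerivAt_inverse_apply h1 (hunit u hu1) c₀
    refine ⟨h4, ?_⟩
    have h5 : fderiv ℝ Z u h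
        = Ring.inverse (1 - volterraMul (a u)) (volterraMul (L u h) (Z u)) := by
      refine (h4' h).trans ?_
      simp [Z]
    -- the candidate for the derivative satisfies the same integral equation
    let Wt : (I →ᵇ V) := .mkOfCompact ⟨fun t => η (y₀ + (t : ℝ) • u) ((t : ℝ) • h) (Z u t),
      ((hηc.comp_continuous (by fun_prop) (hmem u hu)).clm_apply (by fun_prop)).clm_apply
        (Z u).continuous⟩
    have h6 : fderiv ℝ Z u h = Wt := by
      rw [h5]
      refine (huniq u hu1 Wt _ ?_).symm
      rw [volterraMul_apply, sub_eq_iff_eq_add, ← map_add]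
      symm
      ext t
      refine volterra_eq_of_hasDerivAt Wt.continuous (by simp [Wt]) (fun t ht => ?_) t
      have hyt : y₀ + t • u ∈ U := hmem u hu ⟨t, Ioo_subset_Icc_self ht⟩
      have e1 : HasDerivAt (fun s : ℝ => y₀ + s • u) u t := by
        simpa using ((hasDerivAt_id t).smul_const u).const_add y₀
      have e2 : HasDerivAt (fun s : ℝ => η (y₀ + s • u)) (fderiv ℝ η (y₀ + t • u) u) t :=
        HasFDerivAt.comp_hasDerivAt t (f := fun s : ℝ => y₀ + s • u) (hηd _ hyt) e1
      have e3 : HasDerivAt (fun s : ℝ => s • h) h t := by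
        simpa using (hasDerivAt_id t).smul_const h
      have e4 := hasDerivAt_volterra (pointwiseApply (a u) (Z u)) ht
      have e5 : HasDerivAt (fun s : ℝ => Z u (projIcc 0 1 zero_le_one s))
          (a u ⟨t, Ioo_subset_Icc_self ht⟩ (Z u ⟨t, Ioo_subset_Icc_self ht⟩)) t := by
        refine (e4.const_add Z₀).congr_of_eventuallyEq (Eventually.of_forall fun s => ?_)
        have := congrArg (fun f : (I →ᵇ V) => f (projIcc 0 1 zero_le_one s)) (hZeq u hu1)
        exact this
      have e6 := (e2.clm_apply e3).clm_apply e5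
      have e7 : (fun s : ℝ => Wt (projIcc 0 1 zero_le_one s)) =ᶠ[𝓝 t]
          fun s => η (y₀ + s • u) (s • h) (Z u (projIcc 0 1 zero_le_one s)) := by
        filter_upwards [isOpen_Ioo.mem_nhds ht] with s hs
        simp only [Wt, BoundedContinuousFunction.mkOfCompact_apply, ContinuousMap.coe_mk,
          projIcc_of_mem _ (Ioo_subset_Icc_self hs)]
      refine (e6.congr_of_eventuallyEq e7).congr_deriv ?_
      have hi := hint _ hyt h u (Z u ⟨t, Ioo_subset_Icc_self ht⟩)
      have hi' := congrArg (fun v => t • v) hi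
      have pI : projIcc 0 1 zero_le_one t = (⟨t, Ioo_subset_Icc_self ht⟩ : I) :=
        projIcc_of_mem _ (Ioo_subset_Icc_self ht)
      simp only [smul_add] at hi'
      simp only [BoundedContinuousFunction.add_apply, BoundedContinuousFunction.mkOfCompact_apply,
        pointwiseApply_apply, ha u hu, hL u hu, a', Wt, ContinuousMap.coe_mk, pI, map_smul,
        add_apply, smul_apply, ContinuousLinearMap.flip_apply]
      linear_combination (norm := module) -hi'
    rw [h6]
    rfl
  refine ⟨fun y => Z (y - y₀) 1, ?_, ?_⟩
  · have h1 := hZeq 0 (by simp [ha0])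
    have h2 := congrArg (fun f : (I →ᵇ V) => f 1) h1
    simp only [sub_self]
    rw [h2, ha0]
    simp [c₀]
  · have h1 : Tendsto (fun y => y - y₀) (𝓝 y₀) (𝓝 0) := by
      have : Continuous fun y : F => y - y₀ := by fun_prop
      simpa using this.tendsto y₀
    filter_upwards [h1.eventually hsmall, h1.eventually (Metric.ball_mem_nhds 0 hr)] with y hy hyr
    have h2 : HasFDerivAt (fun y : F => y - y₀) (ContinuousLinearMap.id ℝ F) y :=
      (hasFDerivAt_id y).sub_const y₀
    have h3 := (hZ' _ hyr hy 0 0).1.comp y h2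
    let ev : (I →ᵇ V) →L[ℝ] V := BoundedContinuousFunction.evalCLM ℝ (1 : I)
    have h4 : HasFDerivAt (fun y => Z (y - y₀) 1) _ y := ev.hasFDerivAt.comp y h3
    refine h4.congr_fderiv ?_
    ext h
    have h5 := (hZ' _ hyr hy h 1).2
    have h6 : y₀ + (y - y₀) = y := by abel
    simpa [ev, h6] using h5

end Frobenius

/-! ### Flat coordinates of a flat torsion free connection -/

section FlatCoordinates

open Filter Topology Set

variable {F V : Type*} [NormedAddCommGroup F] [NormedSpace ℝ F]
  [NormedAddCommGroup V] [NormedSpace ℝ V]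

/-- Solutions of a linear total differential equation with smooth coefficients are smooth, by
bootstrapping. -/
theorem contDiffOn_of_hasFDerivAt_flip {η : F → F →L[ℝ] V →L[ℝ] V} {θ : F → V} {O : Set F}
    (hO : IsOpen O) (hη : ContDiffOn ℝ ∞ η O)
    (hθ : ∀ y ∈ O, HasFDerivAt θ ((η y).flip (θ y)) y) : ContDiffOn ℝ ∞ θ O := by
  rw [contDiffOn_infty]
  intro k
  induction k with
  | zero =>
    exact contDiffOn_zero.2 fun y hy => (hθ y hy).continuousAt.continuousWithinAt
  | succ k ih =>
    have h : ContDiffOn ℝ k (fun y => (η y).flip (θ y)) O :=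
      ((ContinuousLinearMap.flipₗᵢ ℝ F V V).contDiff.comp_contDiffOn
        (hη.of_le (by exact_mod_cast le_top))).clm_apply ih
    have := (contDiffOn_succ_iff_fderiv_of_isOpen (𝕜 := ℝ) (f := θ) (n := k) hO).2
      ⟨fun y hy => (hθ y hy).differentiableAt.differentiableWithinAt, by simp,
        h.congr fun y hy => (hθ y hy).fderiv⟩
    exact_mod_cast this

/-- A flat torsion free connection `Γ` compatible with `B` has local coordinates `f` in which `B` is
constant: the derivative `θ` of `f` is a parallel coframe, obtained from the Frobenius theorem and
integrated by the Poincaré lemma. -/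
theorem exists_flat_coordinates [CompleteSpace F] {B : F → F →L[ℝ] F →L[ℝ] ℝ}
    {Γ : F → F →L[ℝ] F →L[ℝ] F} {U : Set F} (hU : IsOpen U) (hB : DifferentiableOn ℝ B U)
    (hΓ : ContDiffOn ℝ ∞ Γ U) (hsymm : ∀ y ∈ U, ∀ u v, Γ y u v = Γ y v u)
    (hcompat : ∀ y ∈ U, ∀ h u v, fderiv ℝ B y h u v = B y (Γ y h u) v + B y u (Γ y h v))
    (hcurv : ∀ y ∈ U, ∀ u v w, fderiv ℝ Γ y u v w - fderiv ℝ Γ y v u w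
      + Γ y u (Γ y v w) - Γ y v (Γ y u w) = 0) {y₀ : F} (hy₀ : y₀ ∈ U) :
    ∃ (O : Set F) (f : F → F) (θ : F → F →L[ℝ] F), IsOpen O ∧ y₀ ∈ O ∧ O ⊆ U ∧
      ContDiffOn ℝ ∞ f O ∧ ∀ y ∈ O, HasFDerivAt f (θ y) y ∧ IsUnit (θ y) ∧
        ∀ u v, B y u v = B y₀ (θ y u) (θ y v) := by
  -- a parallel coframe `θ`: the equation is `∂_h θ = θ ∘ Γ(h, ·)`
  let R : (F →L[ℝ] F) →L[ℝ] (F →L[ℝ] F) →L[ℝ] (F →L[ℝ] F) :=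
    (ContinuousLinearMap.compL ℝ F F F).flip
  have hR : ∀ (A : F →L[ℝ] F) (Θ : F →L[ℝ] F) w, R A Θ w = Θ (A w) := fun _ _ _ => rfl
  let RL : (F →L[ℝ] F →L[ℝ] F) →L[ℝ] (F →L[ℝ] (F →L[ℝ] F) →L[ℝ] (F →L[ℝ] F)) :=
    ContinuousLinearMap.compL ℝ F (F →L[ℝ] F) ((F →L[ℝ] F) →L[ℝ] (F →L[ℝ] F)) R
  let η : F → F →L[ℝ] (F →L[ℝ] F) →L[ℝ] (F →L[ℝ] F) := fun y => RL (Γ y)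
  have hη : ∀ y h Θ w, η y h Θ w = Θ (Γ y h w) := fun _ _ _ _ => rfl
  have hηs : ContDiffOn ℝ ∞ η U := RL.contDiff.comp_contDiffOn hΓ
  have hΓd : ∀ y ∈ U, HasFDerivAt Γ (fderiv ℝ Γ y) y := fun y hy =>
    ((hΓ.differentiableOn (by simp)).differentiableAt (hU.mem_nhds hy)).hasFDerivAt
  have hηd : ∀ y ∈ U, fderiv ℝ η y = RL ∘L fderiv ℝ Γ y := fun y hy =>
    (RL.hasFDerivAt.comp y (hΓd y hy)).fderiv
  have hint : ∀ y ∈ U, ∀ h u Z, fderiv ℝ η y h u Z + η y u (η y h Z)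
      = fderiv ℝ η y u h Z + η y h (η y u Z) := by
    intro y hy h u Z
    ext w
    rw [hηd y hy]
    change Z (fderiv ℝ Γ y h u w) + Z (Γ y h (Γ y u w)) = Z (fderiv ℝ Γ y u h w)
      + Z (Γ y u (Γ y h w))
    have := congrArg Z (hcurv y hy h u w)
    simp only [map_add, map_sub, map_zero] at this
    linear_combination (norm := module) this
  obtain ⟨θ, hθ0, hθ⟩ := exists_hasFDerivAt_of_integrable hU (hηs.of_le (by simp)) hint hy₀
    (ContinuousLinearMap.id ℝ F)
  have hθc : ContinuousAt θ y₀ := hθ.self_of_nhds.continuousAt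
  have hunit : ∀ᶠ y in 𝓝 y₀, IsUnit (θ y) := by
    have : IsUnit (θ y₀) := by rw [hθ0]; exact isUnit_one
    exact hθc.eventually (Units.isOpen.mem_nhds this)
  obtain ⟨r, hr, hball⟩ := Metric.eventually_nhds_iff_ball.1
    ((hθ.and hunit).and (hU.eventually_mem hy₀))
  have hO : IsOpen (Metric.ball y₀ r) := Metric.isOpen_ball
  have hθs : ContDiffOn ℝ ∞ θ (Metric.ball y₀ r) :=
    contDiffOn_of_hasFDerivAt_flip hO (hηs.mono fun y hy => (hball y hy).2)
      fun y hy => (hball y hy).1.1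
  have hθd : ∀ y ∈ Metric.ball y₀ r, ∀ h w, fderiv ℝ θ y h w = θ y (Γ y h w) := by
    intro y hy h w
    rw [(hball y hy).1.1.fderiv]
    rfl
  -- the coframe is closed because the connection is torsion free
  obtain ⟨f, hf⟩ := (convex_ball y₀ r).exists_forall_hasFDerivAt_of_fderiv_symmetric hO
    (hθs.differentiableOn (by simp)) (fun y hy u v => by
      rw [hθd y hy, hθd y hy, hsymm y (hball y hy).2])
  refine ⟨Metric.ball y₀ r, f, θ, hO, Metric.mem_ball_self hr, fun y hy => (hball y hy).2, ?_,
    fun y hy => ⟨hf y hy, (hball y hy).1.2, ?_⟩⟩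
  · have := (contDiffOn_succ_iff_fderiv_of_isOpen (𝕜 := ℝ) (f := f) (n := ∞) hO).2
      ⟨fun y hy => (hf y hy).differentiableAt.differentiableWithinAt, by simp,
        hθs.congr fun y hy => (hf y hy).fderiv⟩
    exact this.of_le (by simp)
  · -- the metric has constant coefficients in the parallel frame dual to `θ`
    let φ : F → F →L[ℝ] F := fun y => Ring.inverse (θ y)
    have hφd : ∀ y ∈ Metric.ball y₀ r, ∃ φ' : F →L[ℝ] (F →L[ℝ] F), HasFDerivAt φ φ' y ∧
        ∀ h u, φ' h u = -Γ y h (φ y u) := by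
      intro y hy
      obtain ⟨x, hx⟩ := (hball y hy).1.2
      have h2 := hasFDerivAt_ringInverse (𝕜 := ℝ) x
      rw [hx] at h2
      refine ⟨_, h2.comp y (hball y hy).1.1, fun h u => ?_⟩
      have hxinv : (↑x⁻¹ : F →L[ℝ] F) = φ y := by
        simp only [φ]
        rw [← hx, Ring.inverse_unit]
      have hc : ∀ w, φ y (θ y w) = w := fun w => by
        have := Ring.inverse_mul_cancel _ (hball y hy).1.2
        exact congrArg (fun A : F →L[ℝ] F => A w) this
      have : -(φ y (θ y (Γ y h (φ y u)))) = -Γ y h (φ y u) := by rw [hc]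
      rw [← this]
      simp [hxinv, η, RL, R]
    have hconst : ∀ u v, ∀ y ∈ Metric.ball y₀ r, B y (φ y u) (φ y v) = B y₀ u v := by
      intro u v y hy
      have hder : ∀ y ∈ Metric.ball y₀ r,
          HasFDerivAt (fun y => B y (φ y u) (φ y v)) (0 : F →L[ℝ] ℝ) y := by
        intro y hy
        obtain ⟨φ', h1, h2⟩ := hφd y hy
        have hB' : HasFDerivAt B (fderiv ℝ B y) y :=
          (hB.differentiableAt (hU.mem_nhds (hball y hy).2)).hasFDerivAt
        refine ((hB'.clm_apply (h1.clm_apply (hasFDerivAt_const u y))).clm_apply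
          (h1.clm_apply (hasFDerivAt_const v y))).congr_fderiv ?_
        ext h
        simp [h2, hcompat y (hball y hy).2]
      have := (convex_ball y₀ r).is_const_of_fderivWithin_eq_zero (𝕜 := ℝ)
        (fun y hy => (hder y hy).differentiableAt.differentiableWithinAt)
        (fun y hy => by rw [fderivWithin_of_isOpen hO hy, (hder y hy).fderiv])
        hy (Metric.mem_ball_self hr)
      refine this.trans ?_
      have h1 : φ y₀ = 1 := by
        simp only [φ]
        rw [hθ0]
        exact Ring.inverse_one _
      rw [h1]
      rfl
    intro u v
    have hc : ∀ w, φ y (θ y w) = w := fun w => by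
      have := Ring.inverse_mul_cancel _ (hball y hy).1.2
      exact congrArg (fun A : F →L[ℝ] F => A w) this
    rw [← hconst _ _ y hy, hc, hc]

end FlatCoordinates

/-! ### Metrics that are constant in some coordinates -/

section ConstantMetric

open Filter Topology Set

variable {F : Type*} [NormedAddCommGroup F] [NormedSpace ℝ F]

theorem isInvertible_of_injective [FiniteDimensional ℝ F] {A : F →L[ℝ] F}
    (h : Function.Injective A) : A.IsInvertible :=
  ⟨(LinearEquiv.ofInjectiveEndo A.toLinearMap h).toContinuousLinearEquiv, by ext; rfl⟩

theorem isInvertible_of_pos [FiniteDimensional ℝ F] {B : F →L[ℝ] F →L[ℝ] ℝ}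
    (h : ∀ v, v ≠ 0 → 0 < B v v) : B.IsInvertible := by
  have hinj : Function.Injective B := by
    rw [injective_iff_map_eq_zero]
    intro v hv
    by_contra hne
    have := h v hne
    simp [hv] at this
  have hdim : Module.finrank ℝ F = Module.finrank ℝ (F →L[ℝ] ℝ) := by
    rw [← (LinearMap.toContinuousLinearMap (𝕜 := ℝ) (E := F) (F' := ℝ)).finrank_eq,
      Subspace.dual_finrank_eq]
  exact ⟨(LinearMap.linearEquivOfInjective B.toLinearMap hinj hdim).toContinuousLinearEquiv,
    by ext; rfl⟩

theorem inverse_apply_apply {E E' : Type*} [NormedAddCommGroup E]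
    [NormedSpace ℝ E] [NormedAddCommGroup E'] [NormedSpace ℝ E'] {A : E →L[ℝ] E'}
    (h : A.IsInvertible) (v : E) : A.inverse (A v) = v := by
  obtain ⟨e, rfl⟩ := h
  simp

theorem apply_inverse_apply {E E' : Type*} [NormedAddCommGroup E]
    [NormedSpace ℝ E] [NormedAddCommGroup E'] [NormedSpace ℝ E'] {A : E →L[ℝ] E'}
    (h : A.IsInvertible) (v : E') : A (A.inverse v) = v := by
  obtain ⟨e, rfl⟩ := h
  simp

/-- The inverse function theorem. -/
theorem exists_local_inverse [CompleteSpace F] {κ : F → F} {x : F} (hκ : ContDiffAt ℝ ∞ κ x)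
    (hinv : (fderiv ℝ κ x).IsInvertible) :
    ∃ χ : F → F, ContDiffAt ℝ ∞ χ (κ x) ∧ χ (κ x) = x ∧ (∀ᶠ y in 𝓝 x, χ (κ y) = y) ∧
      ∀ᶠ z in 𝓝 (κ x), κ (χ z) = z := by
  obtain ⟨e, he⟩ := hinv
  have h1 : HasFDerivAt κ (e : F →L[ℝ] F) x := by
    rw [he]; exact (hκ.differentiableAt (by simp)).hasFDerivAt
  have h2 : HasStrictFDerivAt κ (e : F →L[ℝ] F) x := hκ.hasStrictFDerivAt' h1 (by simp)
  refine ⟨h2.localInverse κ e x, hκ.to_localInverse h1 (by simp), h2.localInverse_apply_image,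
    h2.eventually_left_inverse, h2.eventually_right_inverse⟩

/-- The derivative of the coefficients `B` of a metric which pulls back to the constant form `G₀`
under `κ`. The coefficients are differentiable because `B` is the pull-back of `G₀` under the local
inverse of `κ`; the formula comes from differentiating the hypothesis `hG`. -/
theorem fderiv_metric_of_constant [CompleteSpace F] {B : F → F →L[ℝ] F →L[ℝ] ℝ}
    {G₀ : F →L[ℝ] F →L[ℝ] ℝ} {κ : F → F} {x : F} (hκ : ContDiffAt ℝ ∞ κ x)
    (hinv : (fderiv ℝ κ x).IsInvertible)
    (hG : ∀ᶠ y in 𝓝 x, ∀ u v, B (κ y) (fderiv ℝ κ y u) (fderiv ℝ κ y v) = G₀ u v) :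
    ∀ h u v, fderiv ℝ B (κ x) (fderiv ℝ κ x h) (fderiv ℝ κ x u) (fderiv ℝ κ x v)
      = -(B (κ x) (fderiv ℝ (fderiv ℝ κ) x h u) (fderiv ℝ κ x v))
        - B (κ x) (fderiv ℝ κ x u) (fderiv ℝ (fderiv ℝ κ) x h v) := by
  obtain ⟨χ, hχ, hχx, hl, hr⟩ := exists_local_inverse hκ hinv
  have hκd : ∀ᶠ y in 𝓝 x, ContDiffAt ℝ 1 κ y :=
    (hκ.of_le (m := 1) (by simp)).eventually (by simp)
  have hχt : Tendsto χ (𝓝 (κ x)) (𝓝 x) := by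
    have := hχ.continuousAt.tendsto
    rwa [hχx] at this
  have hBe : ∀ᶠ z in 𝓝 (κ x), B z = G₀.bilinearComp (fderiv ℝ χ z) (fderiv ℝ χ z) := by
    have hχd : ∀ᶠ z in 𝓝 (κ x), ContDiffAt ℝ 1 χ z :=
      (hχ.of_le (m := 1) (by simp)).eventually (by simp)
    filter_upwards [hχt.eventually hG, hχt.eventually hκd, hr.eventually_nhds, hχd]
      with z h1 h2 h3 h4
    have h5 : HasFDerivAt (κ ∘ χ) (fderiv ℝ κ (χ z) ∘L fderiv ℝ χ z) z :=
      (h2.differentiableAt (by simp)).hasFDerivAt.comp z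
        (h4.differentiableAt (by simp)).hasFDerivAt
    have h6 : HasFDerivAt (κ ∘ χ) (ContinuousLinearMap.id ℝ F) z :=
      (hasFDerivAt_id z).congr_of_eventuallyEq h3
    have h7 := h5.unique h6
    have h8 : ∀ w, fderiv ℝ κ (χ z) (fderiv ℝ χ z w) = w := fun w =>
      congrArg (fun A : F →L[ℝ] F => A w) h7
    ext u v
    have := h1 (fderiv ℝ χ z u) (fderiv ℝ χ z v)
    rw [h8, h8, h3.self_of_nhds] at this
    simpa using this
  have hBd : DifferentiableAt ℝ B (κ x) := by
    have h1 : ContDiffAt ℝ 1 (fderiv ℝ χ) (κ x) :=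
      (hχ.of_le (m := 2) ENat.LEInfty.out).fderiv_right (by norm_num)
    have h2 : DifferentiableAt ℝ (fderiv ℝ χ) (κ x) := h1.differentiableAt (by simp)
    have h3 : DifferentiableAt ℝ
        (fun z => G₀.bilinearComp (fderiv ℝ χ z) (fderiv ℝ χ z)) (κ x) := by
      have h4 : DifferentiableAt ℝ (fun z => G₀ ∘L fderiv ℝ χ z) (κ x) :=
        (differentiableAt_const G₀).clm_comp h2
      have h5 : DifferentiableAt ℝ (fun z => (G₀ ∘L fderiv ℝ χ z).flip ∘L fderiv ℝ χ z) (κ x) :=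
        ((ContinuousLinearMap.flipₗᵢ ℝ F F ℝ).toContinuousLinearEquiv.differentiableAt.comp
          (κ x) h4).clm_comp h2
      exact (ContinuousLinearMap.flipₗᵢ ℝ F F ℝ).toContinuousLinearEquiv.differentiableAt.comp
          (κ x) h5
    exact h3.congr_of_eventuallyEq hBe
  intro h u v
  have hκ1 : HasFDerivAt κ (fderiv ℝ κ x) x := (hκ.differentiableAt (by simp)).hasFDerivAt
  have hκ2 : HasFDerivAt (fderiv ℝ κ) (fderiv ℝ (fderiv ℝ κ) x) x := by
    have h1 : ContDiffAt ℝ 1 (fderiv ℝ κ) x :=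
      (hκ.of_le (m := 2) ENat.LEInfty.out).fderiv_right (by norm_num)
    exact (h1.differentiableAt (by simp)).hasFDerivAt
  have h1 := ((hBd.hasFDerivAt.comp x hκ1).clm_apply
    (hκ2.clm_apply (hasFDerivAt_const u x))).clm_apply (hκ2.clm_apply (hasFDerivAt_const v x))
  have h2 : HasFDerivAt (fun y => B (κ y) (fderiv ℝ κ y u) (fderiv ℝ κ y v))
      (0 : F →L[ℝ] ℝ) x :=
    (hasFDerivAt_const (G₀ u v) x).congr_of_eventuallyEq (hG.mono fun y hy => hy u v)
  have h3 := congrArg (fun A : F →L[ℝ] ℝ => A h) (h1.unique h2)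
  simp at h3
  linear_combination h3

end ConstantMetric

/-! ### Maps and bilinear forms in charts -/

section Chart

open Filter Topology Set

variable {F : Type*} [NormedAddCommGroup F] [NormedSpace ℝ F]
  {F' : Type*} [NormedAddCommGroup F'] [NormedSpace ℝ F']
  {H : Type*} [TopologicalSpace H] (I : ModelWithCorners ℝ F H)
  {M : Type*} [TopologicalSpace M] [ChartedSpace H M]

/-- The derivative at `y` of a map `ψ` from a vector space to `M`, with values in the components of
the preferred chart around `ψ y`. -/
def chartVel (ψ : F' → M) (y : F') : F' →L[ℝ] F :=
  fderiv ℝ (fun z => extChartAt I (ψ y) (ψ z)) y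

/-- The bilinear form `g_p`, in the components of the preferred chart around `p`. -/
def formAt (g : ∀ x : M, TangentSpace I x →L[ℝ] TangentSpace I x →L[ℝ] ℝ) (p : M) :
    F →L[ℝ] F →L[ℝ] ℝ := g p

/-- `g` is symmetric and positive definite. No regularity is required. -/
structure IsMetric (g : ∀ x : M, TangentSpace I x →L[ℝ] TangentSpace I x →L[ℝ] ℝ) : Prop where
  symm : ∀ p u v, formAt I g p u v = formAt I g p v u
  pos : ∀ p v, v ≠ 0 → 0 < formAt I g p v v

variable {I}

theorem extChartAt_symm_extChartAt {x₀ p : M} (hp : p ∈ (chartAt H x₀).source) :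
    (extChartAt I x₀).symm (extChartAt I x₀ p) = p :=
  (extChartAt I x₀).left_inv (by rwa [extChartAt_source])

variable [IsManifold I ∞ M]

theorem metricInChart_extChartAt (g : ∀ x : M, TangentSpace I x →L[ℝ] TangentSpace I x →L[ℝ] ℝ)
    {x₀ p : M} (hp : p ∈ (chartAt H x₀).source) (u v : F) :
    metricInChart I g x₀ (extChartAt I x₀ p) u v
      = formAt I g p (tangentCoordChange I x₀ p p u) (tangentCoordChange I x₀ p p v) := by
  have : metricInChart I g x₀ (extChartAt I x₀ p) u v
      = formAt I g ((extChartAt I x₀).symm (extChartAt I x₀ p))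
        (tangentCoordChange I x₀ ((extChartAt I x₀).symm (extChartAt I x₀ p))
          ((extChartAt I x₀).symm (extChartAt I x₀ p)) u)
        (tangentCoordChange I x₀ ((extChartAt I x₀).symm (extChartAt I x₀ p))
          ((extChartAt I x₀).symm (extChartAt I x₀ p)) v) := rfl
  rw [this, extChartAt_symm_extChartAt hp]

theorem contDiffAt_extChartAt_comp {ψ : F' → M} {y : F'} {x₀ : M}
    (hψ : ContMDiffAt 𝓘(ℝ, F') I ∞ ψ y) (hy : ψ y ∈ (chartAt H x₀).source) :
    ContDiffAt ℝ ∞ (fun z => extChartAt I x₀ (ψ z)) y :=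
  ((contMDiffAt_extChartAt' hy).comp y hψ).contDiffAt

/-- Derivatives of `ψ` in two charts differ by the coordinate change of tangent vectors. -/
theorem fderiv_chart_change [I.Boundaryless] {ψ : F' → M} {y : F'} {x₀ x₁ : M}
    (hψ : ContMDiffAt 𝓘(ℝ, F') I ∞ ψ y) (hy : ψ y ∈ (chartAt H x₀).source)
    (hy₁ : ψ y ∈ (chartAt H x₁).source) (u : F') :
    tangentCoordChange I x₀ x₁ (ψ y) (fderiv ℝ (fun z => extChartAt I x₀ (ψ z)) y u)
      = fderiv ℝ (fun z => extChartAt I x₁ (ψ z)) y u := by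
  have h1 := hasFDerivWithinAt_tangentCoordChange (I := I) (x := x₀) (y := x₁) (z := ψ y)
    ⟨by rwa [extChartAt_source], by rwa [extChartAt_source]⟩
  rw [I.range_eq_univ, hasFDerivWithinAt_univ] at h1
  have h2 := ((contDiffAt_extChartAt_comp hψ hy).differentiableAt (by simp)).hasFDerivAt
  have h3 := HasFDerivAt.comp y (f := fun z => extChartAt I x₀ (ψ z)) h1 h2
  have h4 : (fun z => extChartAt I x₁ (ψ z)) =ᶠ[𝓝 y]
      (extChartAt I x₁ ∘ (extChartAt I x₀).symm) ∘ fun z => extChartAt I x₀ (ψ z) := by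
    filter_upwards [hψ.continuousAt.eventually ((chartAt H x₀).open_source.mem_nhds hy)] with z hz
    simp only [Function.comp_apply]
    rw [extChartAt_symm_extChartAt hz]
  rw [(h3.congr_of_eventuallyEq h4).fderiv]
  rfl

theorem metricInChart_fderiv [I.Boundaryless]
    (g : ∀ x : M, TangentSpace I x →L[ℝ] TangentSpace I x →L[ℝ] ℝ)
    {ψ : F' → M} {y : F'} {x₀ : M}
    (hψ : ContMDiffAt 𝓘(ℝ, F') I ∞ ψ y) (hy : ψ y ∈ (chartAt H x₀).source) (u v : F') :
    metricInChart I g x₀ (extChartAt I x₀ (ψ y))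
      (fderiv ℝ (fun z => extChartAt I x₀ (ψ z)) y u)
      (fderiv ℝ (fun z => extChartAt I x₀ (ψ z)) y v)
      = formAt I g (ψ y) (chartVel I ψ y u) (chartVel I ψ y v) := by
  rw [metricInChart_extChartAt g hy, fderiv_chart_change hψ hy (mem_chart_source H _),
    fderiv_chart_change hψ hy (mem_chart_source H _)]
  rfl

theorem metricInChart_symm {g : ∀ x : M, TangentSpace I x →L[ℝ] TangentSpace I x →L[ℝ] ℝ}
    (hg : IsMetric I g) (x₀ : M) (y u v : F) :
    metricInChart I g x₀ y u v = metricInChart I g x₀ y v u :=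
  hg.symm ((extChartAt I x₀).symm y) _ _

/-- Coefficients of a positive definite form are positive definite: the coordinate change of tangent
vectors is injective. -/
theorem metricInChart_pos {g : ∀ x : M, TangentSpace I x →L[ℝ] TangentSpace I x →L[ℝ] ℝ}
    (hg : IsMetric I g) {x₀ p : M} (hp : p ∈ (chartAt H x₀).source) {v : F} (hv : v ≠ 0) :
    0 < metricInChart I g x₀ (extChartAt I x₀ p) v v := by
  rw [metricInChart_extChartAt g hp]
  refine hg.pos p _ fun h => hv ?_
  have hp' : p ∈ (extChartAt I x₀).source := by rwa [extChartAt_source]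
  have h1 := tangentCoordChange_comp (I := I) (w := x₀) (x := p) (y := x₀) (z := p) (v := v)
    ⟨⟨hp', mem_extChartAt_source p⟩, hp'⟩
  rw [h, map_zero, tangentCoordChange_self hp'] at h1
  exact h1.symm

end Chart

/-! ### Inverses of flat coordinate systems -/

section FlatMaps

open Filter Topology Set

variable {F : Type*} [NormedAddCommGroup F] [NormedSpace ℝ F]
  {H : Type*} [TopologicalSpace H] {I : ModelWithCorners ℝ F H}
  {M : Type*} [TopologicalSpace M] [ChartedSpace H M]
  {g : ∀ x : M, TangentSpace I x →L[ℝ] TangentSpace I x →L[ℝ] ℝ}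

/-- The map `ψ` from the model vector space to `M` is, near `x`, a smooth immersion pulling `g` back
to a constant bilinear form: near `x`, it is the inverse of a system of flat coordinates. -/
structure FlatAt (g : ∀ x : M, TangentSpace I x →L[ℝ] TangentSpace I x →L[ℝ] ℝ)
    (ψ : F → M) (x : F) : Prop where
  smooth : ∀ᶠ y in 𝓝 x, ContMDiffAt 𝓘(ℝ, F) I ∞ ψ y
  constant : ∀ᶠ y in 𝓝 x, ∀ u v, formAt I g (ψ y) (chartVel I ψ y u) (chartVel I ψ y v)
    = formAt I g (ψ x) (chartVel I ψ x u) (chartVel I ψ x v)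
  injective : Function.Injective (chartVel I ψ x)

/-- `γ` solves the geodesic equation of `g` at the time `t`. -/
def GeodAt (g : ∀ x : M, TangentSpace I x →L[ℝ] TangentSpace I x →L[ℝ] ℝ) [IsManifold I 1 M]
    (γ : ℝ → M) (t : ℝ) : Prop :=
  ContinuousAt γ t ∧ ∀ x₀ : M, γ t ∈ (chartAt H x₀).source →
    DifferentiableAt ℝ (fun s => extChartAt I x₀ (γ s)) t ∧
      HasDerivAt (deriv fun s => extChartAt I x₀ (γ s))
        (-(christoffel I g x₀ (extChartAt I x₀ (γ t))
          (deriv (fun s => extChartAt I x₀ (γ s)) t)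
          (deriv (fun s => extChartAt I x₀ (γ s)) t))) t

namespace FlatAt

variable {ψ : F → M} {x : F} {x₀ : M}

theorem continuousAt (h : FlatAt g ψ x) : ContinuousAt ψ x := h.smooth.self_of_nhds.continuousAt

/-- Near `x`, the derivative of `ψ` stays injective because the pulled back form is constant and
positive definite. -/
theorem eventually (hg : IsMetric I g) (h : FlatAt g ψ x) : ∀ᶠ y in 𝓝 x, FlatAt g ψ y := by
  filter_upwards [h.smooth.eventually_nhds, h.constant.eventually_nhds] with y h1 h2
  refine ⟨h1, ?_, ?_⟩
  · filter_upwards [h2] with z hz u v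
    rw [hz, h2.self_of_nhds]
  · rw [injective_iff_map_eq_zero]
    intro u hu
    by_contra hne
    have h3 := h2.self_of_nhds u u
    rw [hu, map_zero] at h3
    have h4 : chartVel I ψ x u ≠ 0 := fun h0 => hne (h.injective (by rw [h0, map_zero]))
    exact (hg.pos _ _ h4).ne h3

theorem congr {ψ' : F → M} (h : FlatAt g ψ x) (he : ψ' =ᶠ[𝓝 x] ψ) : FlatAt g ψ' x := by
  have hv : ∀ᶠ y in 𝓝 x, ψ' y = ψ y ∧ chartVel I ψ' y = chartVel I ψ y := by
    filter_upwards [he.eventuallyEq_nhds] with y hy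
    refine ⟨hy.self_of_nhds, ?_⟩
    unfold chartVel
    rw [hy.self_of_nhds]
    exact (hy.fun_comp _).fderiv_eq
  refine ⟨?_, ?_, ?_⟩
  · filter_upwards [h.smooth, he.eventuallyEq_nhds] with y h1 h2
    exact h1.congr_of_eventuallyEq h2
  · filter_upwards [h.constant, hv] with y h1 h2 u v
    rw [h2.1, h2.2, hv.self_of_nhds.1, hv.self_of_nhds.2, h1]
  · rw [hv.self_of_nhds.2]
    exact h.injective

end FlatAt

variable [IsManifold I ∞ M]

theorem isGeodesic_iff {γ : ℝ → M} : IsGeodesic I g γ ↔ ∀ t, GeodAt g γ t :=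
  ⟨fun h t => ⟨h.1.continuousAt, fun x₀ hx => h.2 x₀ t hx⟩,
    fun h => ⟨continuous_iff_continuousAt.2 fun t => (h t).1, fun x₀ t hx => (h t).2 x₀ hx⟩⟩

theorem GeodAt.congr {γ γ' : ℝ → M} {t : ℝ} (h : GeodAt g γ t) (he : γ' =ᶠ[𝓝 t] γ) :
    GeodAt g γ' t := by
  refine ⟨h.1.congr he.symm, fun x₀ hx => ?_⟩
  have he' : (fun s => extChartAt I x₀ (γ' s)) =ᶠ[𝓝 t] fun s => extChartAt I x₀ (γ s) :=
    he.fun_comp _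
  rw [he.self_of_nhds] at hx ⊢
  rw [he'.deriv_eq]
  exact ⟨(h.2 x₀ hx).1.congr_of_eventuallyEq he', (h.2 x₀ hx).2.congr_of_eventuallyEq he'.deriv⟩

/-- Geodesics stay geodesics under the reparametrization `s ↦ a s`. -/
theorem GeodAt.comp_mul {γ : ℝ → M} {a t : ℝ} (h : GeodAt g γ (a * t)) :
    GeodAt g (fun s => γ (a * s)) t := by
  refine ⟨ContinuousAt.comp (f := fun s => a * s) h.1 (by fun_prop), fun x₀ hx => ?_⟩
  obtain ⟨h1, h2⟩ := h.2 x₀ hx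
  have e : (deriv fun s => extChartAt I x₀ (γ (a * s)))
      = fun s => a • deriv (fun s => extChartAt I x₀ (γ s)) (a * s) :=
    funext fun s => deriv_comp_mul_left a (fun s => extChartAt I x₀ (γ s)) s
  have e1 : HasDerivAt (fun s : ℝ => a * s) a t := by
    simpa using (hasDerivAt_id t).const_mul a
  refine ⟨DifferentiableAt.comp t (f := fun s => a * s) h1 e1.differentiableAt, ?_⟩
  rw [e]
  refine ((HasDerivAt.scomp t (h := fun s => a * s) h2 e1).const_smul a).congr_deriv ?_
  simp

namespace FlatAt

variable {ψ : F → M} {x : F} {x₀ : M}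

theorem comp_affine {x' : F} {L : F →L[ℝ] F} (hL : Function.Injective L) {p : F}
    (h : FlatAt g ψ (p + L x')) : FlatAt g (fun y => ψ (p + L y)) x' := by
  have hc : Tendsto (fun y => p + L y) (𝓝 x') (𝓝 (p + L x')) := by
    have : Continuous fun y => p + L y := by fun_prop
    exact this.tendsto x'
  have hv : ∀ y, ContMDiffAt 𝓘(ℝ, F) I ∞ ψ (p + L y) →
      chartVel I (fun y => ψ (p + L y)) y = chartVel I ψ (p + L y) ∘L L := by
    intro y hy
    have h1 := ((contDiffAt_extChartAt_comp hy
      (mem_chart_source H _)).differentiableAt (by simp)).hasFDerivAt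
    have h2 : HasFDerivAt (fun y => p + L y) L y := L.hasFDerivAt.const_add p
    exact (HasFDerivAt.comp y (f := fun y => p + L y) h1 h2).fderiv
  refine ⟨?_, ?_, ?_⟩
  · filter_upwards [hc.eventually h.smooth] with y hy
    have h2 : ContMDiffAt 𝓘(ℝ, F) 𝓘(ℝ, F) ∞ (fun y => p + L y) y :=
      ContDiffAt.contMDiffAt (by fun_prop)
    exact ContMDiffAt.comp y (f := fun y => p + L y) hy h2
  · filter_upwards [hc.eventually h.smooth, hc.eventually h.constant] with y h1 h2 u v
    rw [hv y h1, hv x' h.smooth.self_of_nhds]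
    exact h2 _ _
  · rw [hv x' h.smooth.self_of_nhds]
    exact h.injective.comp hL

variable [I.Boundaryless]

theorem constant_chart (h : FlatAt g ψ x) (hx : ψ x ∈ (chartAt H x₀).source) :
    ∀ᶠ y in 𝓝 x, ∀ u v, metricInChart I g x₀ (extChartAt I x₀ (ψ y))
      (fderiv ℝ (fun z => extChartAt I x₀ (ψ z)) y u)
      (fderiv ℝ (fun z => extChartAt I x₀ (ψ z)) y v)
      = (formAt I g (ψ x)).bilinearComp (chartVel I ψ x) (chartVel I ψ x) u v := by
  filter_upwards [h.smooth, h.constant, h.continuousAt.eventually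
    ((chartAt H x₀).open_source.mem_nhds hx)] with y h1 h2 h3 u v
  rw [metricInChart_fderiv g h1 h3, h2]
  rfl

theorem injective_chart (h : FlatAt g ψ x) (hx : ψ x ∈ (chartAt H x₀).source) :
    Function.Injective (fderiv ℝ (fun z => extChartAt I x₀ (ψ z)) x) := by
  rw [injective_iff_map_eq_zero]
  intro u hu
  have := fderiv_chart_change h.smooth.self_of_nhds hx (mem_chart_source H (ψ x)) u
  rw [hu, map_zero] at this
  exact h.injective (by rw [map_zero]; exact this.symm)

variable [FiniteDimensional ℝ F]

/-- In flat coordinates the Christoffel symbols vanish; thus in a chart they satisfy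
`Γ(κ' u, κ' v) = -κ''(u, v)`, where `κ` is the expression of `ψ` in the chart. -/
theorem christoffel_eq (hg : IsMetric I g) (h : FlatAt g ψ x) (hx : ψ x ∈ (chartAt H x₀).source)
    (u v : F) : christoffel I g x₀ (extChartAt I x₀ (ψ x))
      (fderiv ℝ (fun z => extChartAt I x₀ (ψ z)) x u)
      (fderiv ℝ (fun z => extChartAt I x₀ (ψ z)) x v)
      = -(fderiv ℝ (fderiv ℝ fun z => extChartAt I x₀ (ψ z)) x u v) := by
  have : CompleteSpace F := FiniteDimensional.complete ℝ F
  have hκ := contDiffAt_extChartAt_comp h.smooth.self_of_nhds hx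
  have hinv := isInvertible_of_injective (h.injective_chart hx)
  have hsurj : ∀ w, ∃ w', fderiv ℝ (fun z => extChartAt I x₀ (ψ z)) x w' = w := fun w =>
    ⟨_, apply_inverse_apply hinv w⟩
  have key := fderiv_metric_of_constant hκ hinv (h.constant_chart hx)
  have hs : IsSymmSndFDerivAt ℝ (fun z => extChartAt I x₀ (ψ z)) x :=
    hκ.isSymmSndFDerivAt (by simpa using ENat.LEInfty.out)
  have hBs := metricInChart_symm hg x₀ (extChartAt I x₀ (ψ x))
  have hBinv : (metricInChart I g x₀ (extChartAt I x₀ (ψ x))).IsInvertible :=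
    isInvertible_of_pos fun v hv => metricInChart_pos hg hx hv
  have h1 : ∀ u v w, christoffelFirst I g x₀ (extChartAt I x₀ (ψ x)) u v w
      = (1 / 2 : ℝ) * (fderiv ℝ (metricInChart I g x₀) (extChartAt I x₀ (ψ x)) u v w
        + fderiv ℝ (metricInChart I g x₀) (extChartAt I x₀ (ψ x)) v u w
        - fderiv ℝ (metricInChart I g x₀) (extChartAt I x₀ (ψ x)) w u v) := fun _ _ _ => rfl
  have h2 : christoffelFirst I g x₀ (extChartAt I x₀ (ψ x))
      (fderiv ℝ (fun z => extChartAt I x₀ (ψ z)) x u)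
      (fderiv ℝ (fun z => extChartAt I x₀ (ψ z)) x v)
      = metricInChart I g x₀ (extChartAt I x₀ (ψ x))
        (-(fderiv ℝ (fderiv ℝ fun z => extChartAt I x₀ (ψ z)) x u v)) := by
    ext w
    obtain ⟨w, rfl⟩ := hsurj w
    rw [h1, key, key, key, hs v u, hs w u, hs w v, map_neg, neg_apply,
      hBs (fderiv ℝ (fun z => extChartAt I x₀ (ψ z)) x v),
      hBs (fderiv ℝ (fun z => extChartAt I x₀ (ψ z)) x u)]
    ring
  change (metricInChart I g x₀ (extChartAt I x₀ (ψ x))).inverse (christoffelFirst I g x₀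
    (extChartAt I x₀ (ψ x)) _ _) = _
  rw [h2, inverse_apply_apply hBinv]

end FlatAt

end FlatMaps

/-! ### Geodesics of locally flat metrics -/

section FlatGeodesics

open Filter Topology Set

variable {F : Type*} [NormedAddCommGroup F] [NormedSpace ℝ F]

/-- A curve with vanishing second derivative is affine. -/
theorem exists_eventuallyEq_affine {x x₁ : ℝ → F} {t : ℝ}
    (h : ∀ᶠ s in 𝓝 t, HasDerivAt x (x₁ s) s) (h₁ : ∀ᶠ s in 𝓝 t, HasDerivAt x₁ 0 s) :
    x =ᶠ[𝓝 t] fun s => x t + (s - t) • x₁ t := by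
  obtain ⟨ε, hε, hball⟩ := Metric.eventually_nhds_iff_ball.1 (h.and h₁)
  have hO : IsOpen (Metric.ball t ε) := Metric.isOpen_ball
  have const : ∀ f : ℝ → F, (∀ s ∈ Metric.ball t ε, HasDerivAt f 0 s) →
      ∀ s ∈ Metric.ball t ε, f s = f t := by
    intro f hf s hs
    refine (convex_ball t ε).is_const_of_fderivWithin_eq_zero (𝕜 := ℝ)
      (fun y hy => (hf y hy).differentiableAt.differentiableWithinAt) (fun y hy => ?_)
      hs (Metric.mem_ball_self hε)
    rw [fderivWithin_of_isOpen hO hy, (hf y hy).hasFDerivAt.fderiv]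
    simp
  have c1 := const x₁ fun s hs => (hball s hs).2
  have c2 := const (fun s => x s - (s - t) • x₁ t) fun s hs => by
    have h2 : HasDerivAt (fun s => (s - t) • x₁ t) (x₁ t) s := by
      simpa using ((hasDerivAt_id s).sub_const t).smul_const (x₁ t)
    refine ((hball s hs).1.sub h2).congr_deriv ?_
    rw [c1 s hs, sub_self]
  filter_upwards [hO.mem_nhds (Metric.mem_ball_self hε)] with s hs
  have := c2 s hs
  simp only [sub_self, zero_smul, sub_zero] at this
  rw [← this, sub_add_cancel]

variable {H : Type*} [TopologicalSpace H] {I : ModelWithCorners ℝ F H}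
  {M : Type*} [TopologicalSpace M] [ChartedSpace H M] [IsManifold I ∞ M]
  {g : ∀ x : M, TangentSpace I x →L[ℝ] TangentSpace I x →L[ℝ] ℝ}

namespace FlatAt

variable {ψ : F → M} {z : F}

theorem hasDerivAt_chart_line {p a : F} {t : ℝ} {x₀ : M} (h : FlatAt g ψ (p + t • a))
    (hx : ψ (p + t • a) ∈ (chartAt H x₀).source) :
    HasDerivAt (fun s : ℝ => extChartAt I x₀ (ψ (p + s • a)))
      (fderiv ℝ (fun z => extChartAt I x₀ (ψ z)) (p + t • a) a) t := by
  have h1 : HasDerivAt (fun s : ℝ => p + s • a) a t := by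
    simpa using ((hasDerivAt_id t).smul_const a).const_add p
  exact HasFDerivAt.comp_hasDerivAt t (f := fun s : ℝ => p + s • a)
    ((contDiffAt_extChartAt_comp h.smooth.self_of_nhds hx).differentiableAt
      (by simp)).hasFDerivAt h1

variable [I.Boundaryless] [FiniteDimensional ℝ F]

/-- Lines in flat coordinates are geodesics. -/
theorem geodAt_line (hg : IsMetric I g) {p a : F} {t : ℝ} (h : FlatAt g ψ (p + t • a)) :
    GeodAt g (fun s => ψ (p + s • a)) t := by
  have hcont : ContinuousAt (fun s : ℝ => p + s • a) t := by fun_prop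
  refine ⟨ContinuousAt.comp (f := fun s : ℝ => p + s • a) h.continuousAt hcont, fun x₀ hx => ?_⟩
  have h1 : HasDerivAt (fun s : ℝ => p + s • a) a t := by
    simpa using ((hasDerivAt_id t).smul_const a).const_add p
  have h2 := h.hasDerivAt_chart_line hx
  refine ⟨h2.differentiableAt, ?_⟩
  have h3 : (deriv fun s : ℝ => extChartAt I x₀ (ψ (p + s • a))) =ᶠ[𝓝 t]
      fun s => fderiv ℝ (fun z => extChartAt I x₀ (ψ z)) (p + s • a) a := by
    filter_upwards [hcont.eventually (h.eventually hg), hcont.eventually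
      (h.continuousAt.eventually ((chartAt H x₀).open_source.mem_nhds hx))] with s h4 h5
    exact (h4.hasDerivAt_chart_line h5).deriv
  rw [h2.deriv, h.christoffel_eq hg hx, neg_neg]
  have h4 : DifferentiableAt ℝ (fderiv ℝ fun z => extChartAt I x₀ (ψ z)) (p + t • a) :=
    (((contDiffAt_extChartAt_comp h.smooth.self_of_nhds hx).of_le
      (m := 2) ENat.LEInfty.out).fderiv_right (m := 1) (by norm_num)).differentiableAt (by simp)
  have h5 : HasDerivAt (fun s : ℝ => fderiv ℝ (fun z => extChartAt I x₀ (ψ z)) (p + s • a)) _ t :=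
    HasFDerivAt.comp_hasDerivAt t (f := fun s : ℝ => p + s • a) h4.hasFDerivAt h1
  refine ((h5.clm_apply (hasDerivAt_const t a)).congr_of_eventuallyEq h3).congr_deriv ?_
  simp

theorem exists_chart_inverse (h : FlatAt g ψ z) {x₀ : M} (hx : ψ z ∈ (chartAt H x₀).source) :
    ∃ χ : F → F, ContDiffAt ℝ ∞ χ (extChartAt I x₀ (ψ z)) ∧ χ (extChartAt I x₀ (ψ z)) = z ∧
      (∀ᶠ y in 𝓝 z, χ (extChartAt I x₀ (ψ y)) = y) ∧
      ∀ᶠ y in 𝓝 (extChartAt I x₀ (ψ z)), extChartAt I x₀ (ψ (χ y)) = y := by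
  have : CompleteSpace F := FiniteDimensional.complete ℝ F
  exact exists_local_inverse (contDiffAt_extChartAt_comp h.smooth.self_of_nhds hx)
    (isInvertible_of_injective (h.injective_chart hx))

theorem exists_injOn (h : FlatAt g ψ z) : ∃ U ∈ 𝓝 z, InjOn ψ U := by
  obtain ⟨χ, -, -, h1, -⟩ := h.exists_chart_inverse (mem_chart_source H (ψ z))
  exact ⟨_, h1, fun y hy y' hy' e => by
    rw [← show χ (extChartAt I (ψ z) (ψ y)) = y from hy,
      ← show χ (extChartAt I (ψ z) (ψ y')) = y' from hy', e]⟩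

/-- The direction of a line in flat coordinates is determined by the points of the line in `M` at
times accumulating at `t`. -/
theorem line_injective (h : FlatAt g ψ z) {a b : F} {t : ℝ}
    (hab : ∃ᶠ s in 𝓝[≠] t, ψ (z + (s - t) • a) = ψ (z + (s - t) • b)) : a = b := by
  obtain ⟨U, hU, hinj⟩ := h.exists_injOn
  have hc : ∀ c : F, ∀ᶠ s in 𝓝[≠] t, z + (s - t) • c ∈ U := fun c => by
    have : Tendsto (fun s : ℝ => z + (s - t) • c) (𝓝 t) (𝓝 z) := by
      have : Continuous fun s : ℝ => z + (s - t) • c := by fun_prop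
      simpa using this.tendsto t
    exact (this.eventually hU).filter_mono nhdsWithin_le_nhds
  obtain ⟨s, hs, hsa, hsb, hst⟩ :=
    (hab.and_eventually ((hc a).and ((hc b).and self_mem_nhdsWithin))).exists
  have := add_left_cancel (hinj hsa hsb hs)
  exact smul_right_injective F (sub_ne_zero.2 hst) this

/-- In flat coordinates geodesics are lines. -/
theorem exists_eventuallyEq_line (hg : IsMetric I g) (h : FlatAt g ψ z) {γ : ℝ → M} {t : ℝ}
    (hz : γ t = ψ z) (hγ : ∀ᶠ s in 𝓝 t, GeodAt g γ s) :
    ∃ a, γ =ᶠ[𝓝 t] fun s => ψ (z + (s - t) • a) := by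
  have hsrc : ψ z ∈ (chartAt H (ψ z)).source := mem_chart_source H _
  obtain ⟨χ, hχ, hχz, -, hr⟩ := h.exists_chart_inverse hsrc
  set x₀ := ψ z
  set κ : F → F := fun y => extChartAt I x₀ (ψ y) with hκ
  let c : ℝ → F := fun s => extChartAt I x₀ (γ s)
  have hγc : ContinuousAt γ t := hγ.self_of_nhds.1
  have hct : c t = κ z := by simp only [c, hz, hκ, x₀]
  have hcc : Tendsto c (𝓝 t) (𝓝 (κ z)) := by
    rw [← hct]
    exact ContinuousAt.comp (f := γ) (by rw [hz]; exact continuousAt_extChartAt x₀) hγc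
  let x : ℝ → F := fun s => χ (c s)
  have hxt : x t = z := by simp only [x, hct]; exact hχz
  have hxc : Tendsto x (𝓝 t) (𝓝 z) := by
    have := hχ.continuousAt.tendsto.comp hcc
    rwa [hχz] at this
  have hsrcγ : ∀ᶠ s in 𝓝 t, γ s ∈ (chartAt H x₀).source :=
    hγc.eventually ((chartAt H x₀).open_source.mem_nhds (by rw [hz]; exact hsrc))
  have hsrcψ : ∀ᶠ s in 𝓝 t, ψ (x s) ∈ (chartAt H x₀).source :=
    (h.continuousAt.tendsto.comp hxc).eventually ((chartAt H x₀).open_source.mem_nhds hsrc)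
  have hκx : ∀ᶠ s in 𝓝 t, κ (x s) = c s := hcc.eventually hr
  have hχd : ∀ᶠ s in 𝓝 t, ContDiffAt ℝ 2 χ (c s) :=
    hcc.eventually ((hχ.of_le (m := 2) ENat.LEInfty.out).eventually (by simp))
  have hψx : ∀ᶠ s in 𝓝 t, FlatAt g ψ (x s) := hxc.eventually (h.eventually hg)
  -- the curve in flat coordinates is twice differentiable
  let x₁ : ℝ → F := fun s => fderiv ℝ χ (c s) (deriv c s)
  have hx₁ : ∀ᶠ s in 𝓝 t, HasDerivAt x (x₁ s) s := by
    filter_upwards [hχd, hγ, hsrcγ] with s h1 h2 h3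
    exact HasFDerivAt.comp_hasDerivAt s (f := c) (h1.differentiableAt (by simp)).hasFDerivAt
      (h2.2 x₀ h3).1.hasDerivAt
  have hx₂ : ∀ᶠ s in 𝓝 t, DifferentiableAt ℝ x₁ s := by
    filter_upwards [hχd, hγ, hsrcγ] with s h1 h2 h3
    have h4 : DifferentiableAt ℝ (fderiv ℝ χ) (c s) :=
      (h1.fderiv_right (m := 1) (by norm_num)).differentiableAt (by simp)
    have h5 : DifferentiableAt ℝ (fun s => fderiv ℝ χ (c s)) s :=
      DifferentiableAt.comp s (f := c) h4 (h2.2 x₀ h3).1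
    exact h5.clm_apply (h2.2 x₀ h3).2.differentiableAt
  have hx₂0 : ∀ᶠ s in 𝓝 t, HasDerivAt x₁ 0 s := by
    have hcder : ∀ᶠ s in 𝓝 t, deriv c s = fderiv ℝ κ (x s) (x₁ s) := by
      filter_upwards [hx₁, hψx, hsrcψ, hκx.eventually_nhds] with s h1 h2 h3 h4
      have h5 := HasFDerivAt.comp_hasDerivAt s (f := x)
        ((contDiffAt_extChartAt_comp h2.smooth.self_of_nhds h3).differentiableAt
          (by simp)).hasFDerivAt h1
      have h6 : c =ᶠ[𝓝 s] κ ∘ x := h4.mono fun _ e => e.symm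
      rw [h6.deriv_eq]
      exact h5.deriv
    filter_upwards [hx₁, hx₂, hψx, hsrcψ, hcder.eventually_nhds, hκx, hγ, hsrcγ]
      with s h1 h2 h3 h4 h5 h6 h7 h8
    have e1 : DifferentiableAt ℝ (fderiv ℝ κ) (x s) :=
      (((contDiffAt_extChartAt_comp h3.smooth.self_of_nhds h4).of_le
        (m := 2) ENat.LEInfty.out).fderiv_right (m := 1) (by norm_num)).differentiableAt (by simp)
    have e2 := (HasFDerivAt.comp_hasDerivAt s (f := x) e1.hasFDerivAt h1).clm_apply h2.hasDerivAt
    have e3 : HasDerivAt (deriv c) _ s := e2.congr_of_eventuallyEq h5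
    have e4 := e3.unique (h7.2 x₀ h8).2
    have e5 := h3.christoffel_eq hg h4 (x₁ s) (x₁ s)
    have e6 : extChartAt I x₀ (γ s) = extChartAt I x₀ (ψ (x s)) := h6.symm
    have e7 : deriv (fun s => extChartAt I x₀ (γ s)) s
      = fderiv ℝ (fun z => extChartAt I x₀ (ψ z)) (x s) (x₁ s) := h5.self_of_nhds
    -- the Christoffel symbols are `-κ''`, so the geodesic equation reads `κ'(x) x'' = 0`
    rw [e6, e7, e5, neg_neg] at e4
    have e8 : fderiv ℝ κ (x s) (deriv x₁ s) = 0 := by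
      have e10 : fderiv ℝ (fderiv ℝ κ) (x s) (x₁ s) (x₁ s) + fderiv ℝ κ (x s) (deriv x₁ s)
          = fderiv ℝ (fderiv ℝ κ) (x s) (x₁ s) (x₁ s) := e4
      exact add_eq_left.1 e10
    have e9 : deriv x₁ s = 0 := h3.injective_chart h4 (by rw [map_zero]; exact e8)
    rw [← e9]
    exact h2.hasDerivAt
  refine ⟨x₁ t, ?_⟩
  filter_upwards [exists_eventuallyEq_affine hx₁ hx₂0, hκx, hsrcγ, hsrcψ] with s h1 h2 h3 h4
  rw [hxt] at h1
  rw [← h1, ← extChartAt_symm_extChartAt (I := I) h3, ← extChartAt_symm_extChartAt (I := I) h4]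
  exact congrArg _ h2.symm

end FlatAt

variable [I.Boundaryless] [FiniteDimensional ℝ F]

variable (g) in
/-- Every point of `M` lies in a domain of flat coordinates. -/
def LocallyFlat : Prop := ∀ p : M, ∃ (ψ : F → M) (z : F), FlatAt g ψ z ∧ ψ z = p

/-- Geodesics of a locally flat metric that agree near one time agree on their common domain. -/
theorem eqOn_of_geodAt [T2Space M] (hg : IsMetric I g) (hflat : LocallyFlat g) {γ₁ γ₂ : ℝ → M}
    {S : Set ℝ} (hS : IsOpen S) (hS' : IsPreconnected S) (h₁ : ∀ t ∈ S, GeodAt g γ₁ t)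
    (h₂ : ∀ t ∈ S, GeodAt g γ₂ t) {t₀ : ℝ} (ht₀ : t₀ ∈ S) (he : γ₁ =ᶠ[𝓝 t₀] γ₂) :
    EqOn γ₁ γ₂ S := by
  -- the set of times near which the geodesics agree is open, and relatively closed in `S`: near a
  -- limit point both are lines in flat coordinates, with the same direction
  have hu : IsOpen {t | γ₁ =ᶠ[𝓝 t] γ₂} :=
    isOpen_iff_mem_nhds.2 fun t ht => ht.eventuallyEq_nhds
  have hsub : S ⊆ {t | γ₁ =ᶠ[𝓝 t] γ₂} := by
    refine hS'.subset_of_closure_inter_subset hu ⟨t₀, ht₀, he⟩ fun t ht => ?_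
    by_contra hne
    have hfreq : ∃ᶠ s in 𝓝[≠] t, γ₁ s = γ₂ s := by
      have h1 : ∃ᶠ s in 𝓝 t, γ₁ =ᶠ[𝓝 s] γ₂ := mem_closure_iff_frequently.1 ht.1
      rw [frequently_nhdsWithin_iff]
      exact h1.mono fun s hs =>
        ⟨hs.self_of_nhds, fun e => hne (by rw [← show s = t from e]; exact hs)⟩
    have heq : γ₁ t = γ₂ t :=
      tendsto_nhds_unique_of_frequently_eq ((h₁ t ht.2).1.tendsto.mono_left nhdsWithin_le_nhds)
        ((h₂ t ht.2).1.tendsto.mono_left nhdsWithin_le_nhds) hfreq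
    obtain ⟨ψ, z, hψ, hz⟩ := hflat (γ₁ t)
    have hev := hS.eventually_mem ht.2
    obtain ⟨a, ha⟩ := hψ.exists_eventuallyEq_line hg hz.symm (hev.mono h₁)
    obtain ⟨b, hb⟩ := hψ.exists_eventuallyEq_line hg (heq.symm.trans hz.symm) (hev.mono h₂)
    have hab : a = b := by
      refine hψ.line_injective (t := t) ?_
      refine (hfreq.and_eventually ((ha.and hb).filter_mono nhdsWithin_le_nhds)).mono ?_
      rintro s ⟨h1, h2, h3⟩
      exact h2.symm.trans (h1.trans h3)
    subst hab
    exact hne (ha.trans hb.symm)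
  exact fun t ht => (hsub ht).self_of_nhds

/-- Geodesics of a locally flat metric with the same initial data agree for small times. -/
theorem eventuallyEq_of_geodAt (hg : IsMetric I g) (hflat : LocallyFlat g) {γ₁ γ₂ : ℝ → M} {t : ℝ}
    (h₁ : ∀ᶠ s in 𝓝 t, GeodAt g γ₁ s) (h₂ : ∀ᶠ s in 𝓝 t, GeodAt g γ₂ s) (h : γ₁ t = γ₂ t)
    (hd : deriv (fun s => extChartAt I (γ₁ t) (γ₁ s)) t
      = deriv (fun s => extChartAt I (γ₁ t) (γ₂ s)) t) : γ₁ =ᶠ[𝓝 t] γ₂ := by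
  obtain ⟨ψ, z, hψ, hz⟩ := hflat (γ₁ t)
  obtain ⟨a, ha⟩ := hψ.exists_eventuallyEq_line hg hz.symm h₁
  obtain ⟨b, hb⟩ := hψ.exists_eventuallyEq_line hg (h.symm.trans hz.symm) h₂
  have hder : ∀ a : F, deriv (fun s => extChartAt I (γ₁ t) (ψ (z + (s - t) • a))) t
      = fderiv ℝ (fun y => extChartAt I (γ₁ t) (ψ y)) z a := by
    intro a
    have e : ∀ s : ℝ, z + (s - t) • a = (z - t • a) + s • a := fun s => by module
    have e' : z = (z - t • a) + t • a := by abel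
    have hψ' := hψ
    have hz' := hz
    rw [e'] at hψ' hz'
    have := hψ'.hasDerivAt_chart_line (x₀ := γ₁ t) (by rw [hz']; exact mem_chart_source H _)
    simp_rw [e]
    rw [this.deriv, ← e']
  have h3 : fderiv ℝ (fun y => extChartAt I (γ₁ t) (ψ y)) z a
      = fderiv ℝ (fun y => extChartAt I (γ₁ t) (ψ y)) z b := by
    rw [← hder a, ← hder b]
    exact (ha.fun_comp (extChartAt I (γ₁ t))).deriv_eq.symm.trans
      (hd.trans (hb.fun_comp (extChartAt I (γ₁ t))).deriv_eq)
  have hab : a = b := hψ.injective_chart (by rw [hz]; exact mem_chart_source H _) h3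
  subst hab
  exact ha.trans hb.symm

end FlatGeodesics

/-! ### The exponential map of a complete locally flat metric -/

section Developing

open Filter Topology Set

variable {F : Type*} [NormedAddCommGroup F] [NormedSpace ℝ F] [FiniteDimensional ℝ F]
  {H : Type*} [TopologicalSpace H] {I : ModelWithCorners ℝ F H} [I.Boundaryless]
  {M : Type*} [TopologicalSpace M] [ChartedSpace H M] [IsManifold I ∞ M] [T2Space M]
  {g : ∀ x : M, TangentSpace I x →L[ℝ] TangentSpace I x →L[ℝ] ℝ}

/-- A geodesic which coincides near one time with a line in flat coordinates does so as long as the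
line stays in their convex domain `U`. -/
theorem eq_line_of_geodAt (hg : IsMetric I g) (hflat : LocallyFlat g) {ψ : F → M} {U : Set F}
    (hU : IsOpen U) (hconv : Convex ℝ U) (hψ : ∀ y ∈ U, FlatAt g ψ y) {γ : ℝ → M} {p a : F}
    (hγ : ∀ t : ℝ, p + t • a ∈ U → GeodAt g γ t) {t₀ : ℝ} (h₀ : p + t₀ • a ∈ U)
    (h : γ =ᶠ[𝓝 t₀] fun t => ψ (p + t • a)) {t : ℝ} (ht : p + t • a ∈ U) :
    γ t = ψ (p + t • a) := by
  have hc : Continuous fun t : ℝ => p + t • a := by fun_prop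
  have hS : Convex ℝ {t : ℝ | p + t • a ∈ U} := by
    intro s hs t ht α β hα hβ hαβ
    have := hconv hs ht hα hβ hαβ
    have e : p + (α • s + β • t) • a = α • (p + s • a) + β • (p + t • a) := by
      calc p + (α • s + β • t) • a = (α + β) • p + (α • s + β • t) • a := by rw [hαβ, one_smul]
        _ = _ := by simp only [smul_eq_mul]; module
    change p + (α • s + β • t) • a ∈ U
    rwa [e]
  exact eqOn_of_geodAt hg hflat (hU.preimage hc) hS.isPreconnected hγ
    (fun s hs => (hψ _ hs).geodAt_line hg) h₀ h ht

/-- Two flat coordinate systems differ by an affine map. -/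
theorem FlatAt.exists_affine (hg : IsMetric I g) (hflat : LocallyFlat g) {ψ₁ ψ₂ : F → M}
    {z₁ z₂ : F} (h₁ : FlatAt g ψ₁ z₁) (h₂ : FlatAt g ψ₂ z₂) (h : ψ₁ z₁ = ψ₂ z₂) :
    ∃ L : F →L[ℝ] F, Function.Injective L ∧ ψ₁ =ᶠ[𝓝 z₁] fun w => ψ₂ (z₂ + L (w - z₁)) := by
  have hs₁ : ψ₁ z₁ ∈ (chartAt H (ψ₁ z₁)).source := mem_chart_source H _
  have hs₂ : ψ₂ z₂ ∈ (chartAt H (ψ₁ z₁)).source := by rw [← h]; exact hs₁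
  have i₂ := isInvertible_of_injective (h₂.injective_chart hs₂)
  set κ₁ := fderiv ℝ (fun z => extChartAt I (ψ₁ z₁) (ψ₁ z)) z₁ with hκ₁
  set κ₂ := fderiv ℝ (fun z => extChartAt I (ψ₁ z₁) (ψ₂ z)) z₂ with hκ₂
  let L : F →L[ℝ] F := κ₂.inverse ∘L κ₁
  have hL : ∀ v, κ₂ (L v) = κ₁ v := fun v => apply_inverse_apply i₂ _
  refine ⟨L, fun u v huv => h₁.injective_chart hs₁ ?_, ?_⟩
  · have := congrArg κ₂ huv
    rwa [hL, hL] at this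
  have hc : Tendsto (fun w => z₂ + L (w - z₁)) (𝓝 z₁) (𝓝 z₂) := by
    have : Continuous fun w => z₂ + L (w - z₁) := by fun_prop
    simpa using this.tendsto z₁
  obtain ⟨δ, hδ, hball⟩ := Metric.eventually_nhds_iff_ball.1
    ((h₁.eventually hg).and (hc.eventually (h₂.eventually hg)))
  filter_upwards [Metric.ball_mem_nhds z₁ hδ] with w hw
  have hG₂ : ∀ t : ℝ, z₁ + t • (w - z₁) ∈ Metric.ball z₁ δ →
      GeodAt g (fun t : ℝ => ψ₂ (z₂ + t • L (w - z₁))) t := fun t ht => by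
    have := (hball _ ht).2
    rw [add_sub_cancel_left, map_smul] at this
    exact this.geodAt_line hg
  have hz : z₁ + (0 : ℝ) • (w - z₁) ∈ Metric.ball z₁ δ := by
    rw [zero_smul, add_zero]
    exact Metric.mem_ball_self hδ
  have hev : ∀ᶠ t : ℝ in 𝓝 0, z₁ + t • (w - z₁) ∈ Metric.ball z₁ δ :=
    (by fun_prop : Continuous fun t : ℝ => z₁ + t • (w - z₁)).continuousAt.eventually
      (Metric.isOpen_ball.mem_nhds hz)
  have e1 : z₂ + (0 : ℝ) • L (w - z₁) = z₂ := by rw [zero_smul, add_zero]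
  have e2 : z₁ + (0 : ℝ) • (w - z₁) = z₁ := by rw [zero_smul, add_zero]
  have hnear : (fun t : ℝ => ψ₂ (z₂ + t • L (w - z₁))) =ᶠ[𝓝 0]
      fun t => ψ₁ (z₁ + t • (w - z₁)) := by
    have h₁' := h₁
    have h₂' := h₂
    rw [← e2] at h₁'
    rw [← e1] at h₂'
    have d₁ := h₁'.hasDerivAt_chart_line (x₀ := ψ₁ z₁) (by rw [e2]; exact hs₁)
    have d₂ := h₂'.hasDerivAt_chart_line (x₀ := ψ₁ z₁) (by rw [e1]; exact hs₂)
    rw [e2, ← hκ₁] at d₁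
    rw [e1, ← hκ₂, hL] at d₂
    refine eventuallyEq_of_geodAt hg hflat (hev.mono hG₂)
      (hev.mono fun t ht => (hball _ ht).1.geodAt_line hg) ?_ ?_
    · simp only [e1, e2, h]
    · simp only [e1, ← h]
      rw [d₁.deriv, d₂.deriv]
  have := eq_line_of_geodAt hg hflat Metric.isOpen_ball (convex_ball z₁ δ)
    (fun y hy => (hball y hy).1) hG₂ hz hnear (t := 1) (by simpa using hw)
  simpa using this.symm

theorem IsGeodesicFrom.unique (hg : IsMetric I g) (hflat : LocallyFlat g) {x : M} {v : F}
    {γ₁ γ₂ : ℝ → M} (h₁ : IsGeodesicFrom I g x v γ₁) (h₂ : IsGeodesicFrom I g x v γ₂) :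
    γ₁ = γ₂ := by
  have g₁ := isGeodesic_iff.1 h₁.1
  have g₂ := isGeodesic_iff.1 h₂.1
  have h : γ₁ =ᶠ[𝓝 0] γ₂ := by
    refine eventuallyEq_of_geodAt hg hflat (.of_forall g₁) (.of_forall g₂)
      (h₁.2.1.trans h₂.2.1.symm) ?_
    rw [h₁.2.1]
    exact h₁.2.2.deriv.trans h₂.2.2.deriv.symm
  exact funext fun t => eqOn_of_geodAt hg hflat isOpen_univ isPreconnected_univ
    (fun t _ => g₁ t) (fun t _ => g₂ t) (mem_univ 0) h (mem_univ t)

theorem expMap_eq (hg : IsMetric I g) (hflat : LocallyFlat g) {x : M} {v : F} {γ : ℝ → M}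
    (h : IsGeodesicFrom I g x v γ) : expMap I g x v = γ 1 := by
  have hex : ∃ γ : ℝ → M, IsGeodesicFrom I g x v γ := ⟨γ, h⟩
  have e : expMap I g x v = hex.choose 1 := dif_pos hex
  rw [e]
  exact congrFun (IsGeodesicFrom.unique hg hflat hex.choose_spec h) 1

/-- The exponential map at `x` as a map on the model space, which carries the norm that the tangent
space lacks. -/
def modelExp (g : ∀ x : M, TangentSpace I x →L[ℝ] TangentSpace I x →L[ℝ] ℝ) (x : M) : F → M :=
  expMap I g x

theorem modelExp_eq (hg : IsMetric I g) (hflat : LocallyFlat g) {x : M} {v : F} {γ : ℝ → M}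
    (h : IsGeodesicFrom I g x v γ) : modelExp g x v = γ 1 := expMap_eq hg hflat h

theorem modelExp_smul (hg : IsMetric I g) (hflat : LocallyFlat g) {x : M} {v : F} {γ : ℝ → M}
    (h : IsGeodesicFrom I g x v γ) (t : ℝ) : modelExp g x (t • v) = γ t := by
  have : IsGeodesicFrom I g x (t • v : F) fun s => γ (t * s) := by
    refine ⟨isGeodesic_iff.2 fun s => (isGeodesic_iff.1 h.1 _).comp_mul, by simp [h.2.1], ?_⟩
    have e1 : HasDerivAt (fun s : ℝ => t * s) t 0 := by
      simpa using (hasDerivAt_id (0 : ℝ)).const_mul t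
    have e2 : HasDerivAt (fun s => extChartAt I x (γ s)) v (t * 0) := by
      rw [mul_zero]; exact h.2.2
    exact HasDerivAt.scomp 0 (h := fun s : ℝ => t * s) e2 e1
  rw [modelExp_eq hg hflat this, mul_one]

/-- In flat coordinates the exponential map is affine near `0`. -/
theorem modelExp_eventuallyEq (hg : IsMetric I g) (hflat : LocallyFlat g)
    (hcomp : GeodesicallyComplete I g) {ψ : F → M} {z : F} (h : FlatAt g ψ z) :
    modelExp g (ψ z) =ᶠ[𝓝 0] fun v : F =>
      ψ (z + (fderiv ℝ (fun y => extChartAt I (ψ z) (ψ y)) z).inverse v) := by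
  have hs : ψ z ∈ (chartAt H (ψ z)).source := mem_chart_source H _
  have hinv := isInvertible_of_injective (h.injective_chart hs)
  set κ := fderiv ℝ (fun y => extChartAt I (ψ z) (ψ y)) z with hκ
  obtain ⟨δ, hδ, hball⟩ := Metric.eventually_nhds_iff_ball.1 (h.eventually hg)
  have hc : Tendsto (fun v => z + κ.inverse v) (𝓝 0) (𝓝 z) := by
    have : Continuous fun v => z + κ.inverse v := by fun_prop
    simpa using this.tendsto 0
  filter_upwards [hc.eventually (Metric.ball_mem_nhds z hδ)] with v hv
  obtain ⟨γ, hγ⟩ := hcomp (ψ z) v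
  have hγ' := isGeodesic_iff.1 hγ.1
  rw [modelExp_eq hg hflat hγ]
  have e0 : z + (0 : ℝ) • κ.inverse v = z := by rw [zero_smul, add_zero]
  have hz : z + (0 : ℝ) • κ.inverse v ∈ Metric.ball z δ := by
    rw [e0]; exact Metric.mem_ball_self hδ
  have hev : ∀ᶠ t : ℝ in 𝓝 0, z + t • κ.inverse v ∈ Metric.ball z δ :=
    (by fun_prop : Continuous fun t : ℝ => z + t • κ.inverse v).continuousAt.eventually
      (Metric.isOpen_ball.mem_nhds hz)
  have hnear : γ =ᶠ[𝓝 0] fun t => ψ (z + t • κ.inverse v) := by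
    refine eventuallyEq_of_geodAt hg hflat (.of_forall hγ')
      (hev.mono fun t ht => (hball _ ht).geodAt_line hg) ?_ ?_
    · rw [hγ.2.1, e0]
    · rw [hγ.2.1]
      have h' := h
      rw [← e0] at h'
      have d := h'.hasDerivAt_chart_line (x₀ := ψ z) (by rw [e0]; exact hs)
      rw [e0, ← hκ, apply_inverse_apply hinv] at d
      exact hγ.2.2.deriv.trans d.deriv.symm
  have := eq_line_of_geodAt hg hflat Metric.isOpen_ball (convex_ball z δ) hball
    (fun t _ => hγ' t) hz hnear (t := 1) (by simpa using hv)
  simpa using this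

/-- Near `0` the exponential map is a local isometry, with the identity as its derivative at `0`. -/
theorem flatAt_modelExp_zero (hg : IsMetric I g) (hflat : LocallyFlat g)
    (hcomp : GeodesicallyComplete I g) (x : M) :
    FlatAt g (modelExp g x) 0 ∧ modelExp g x 0 = x ∧
      chartVel I (modelExp g x) 0 = ContinuousLinearMap.id ℝ F := by
  obtain ⟨ψ, z, h, rfl⟩ := hflat x
  have hs : ψ z ∈ (chartAt H (ψ z)).source := mem_chart_source H _
  have hinv := isInvertible_of_injective (h.injective_chart hs)
  have he := modelExp_eventuallyEq hg hflat hcomp h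
  set κ := fderiv ℝ (fun y => extChartAt I (ψ z) (ψ y)) z with hκ
  have e0 : z + κ.inverse 0 = z := by rw [map_zero, add_zero]
  have h0 : modelExp g (ψ z) 0 = ψ z := by
    have : modelExp g (ψ z) 0 = ψ (z + κ.inverse 0) := he.self_of_nhds
    rw [this, e0]
  have hinj : Function.Injective κ.inverse := fun u v huv => by
    have := congrArg κ huv
    rwa [apply_inverse_apply hinv, apply_inverse_apply hinv] at this
  refine ⟨FlatAt.congr (FlatAt.comp_affine hinj (by rw [e0]; exact h)) he, h0, ?_⟩
  have he' : (fun v : F => extChartAt I (ψ z) (modelExp g (ψ z) v)) =ᶠ[𝓝 0]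
      fun v => extChartAt I (ψ z) (ψ (z + κ.inverse v)) := he.fun_comp _
  have hd : HasFDerivAt (fun v : F => extChartAt I (ψ z) (ψ (z + κ.inverse v)))
      (κ ∘L κ.inverse) 0 := by
    have h1 : HasFDerivAt (fun v => z + κ.inverse v) κ.inverse 0 :=
      κ.inverse.hasFDerivAt.const_add z
    have h2 : HasFDerivAt (fun y => extChartAt I (ψ z) (ψ y)) κ (z + κ.inverse 0) := by
      rw [e0]
      exact ((contDiffAt_extChartAt_comp h.smooth.self_of_nhds hs).differentiableAt
        (by simp)).hasFDerivAt
    exact HasFDerivAt.comp 0 (f := fun v => z + κ.inverse v) h2 h1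
  have h3 : chartVel I (modelExp g (ψ z)) 0
      = fderiv ℝ (fun v : F => extChartAt I (ψ z) (modelExp g (ψ z) v)) 0 := by
    unfold chartVel
    rw [h0]
  rw [h3, he'.fderiv_eq, hd.fderiv]
  ext v
  exact apply_inverse_apply hinv v

/-- The exponential map of a complete locally flat metric is a local isometry everywhere. The
times `t` for which it is one near `t v` form an open and closed set: near a limit point `t₀ v`, it
is determined by its values near `t v` for one `t` close to `t₀`, by continuation along the
geodesics `t ↦ exp (t u)` with `u` close to `v`. -/
theorem flatAt_modelExp (hg : IsMetric I g) (hflat : LocallyFlat g)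
    (hcomp : GeodesicallyComplete I g) (x : M) (v : F) :
    FlatAt g (modelExp g x) v := by
  set E : F → M := modelExp g x with hE
  choose γ hγ using fun u : F => hcomp x u
  have hγ' : ∀ u t, GeodAt g (γ u) t := fun u => isGeodesic_iff.1 (hγ u).1
  have hEγ : ∀ u t, E (t • u) = γ u t := fun u t => modelExp_smul hg hflat (hγ u) t
  have hlin : Continuous fun t : ℝ => t • v := by fun_prop
  have hopen : IsOpen {t : ℝ | FlatAt g E (t • v)} :=
    isOpen_iff_mem_nhds.2 fun t ht => hlin.continuousAt.eventually (ht.eventually hg)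
  have hsub : (univ : Set ℝ) ⊆ {t : ℝ | FlatAt g E (t • v)} := by
    refine isPreconnected_univ.subset_of_closure_inter_subset hopen
      ⟨0, mem_univ _, ?_⟩ fun t₀ ht₀ => ?_
    · change FlatAt g E ((0 : ℝ) • v)
      rw [zero_smul]
      exact (flatAt_modelExp_zero hg hflat hcomp x).1
    by_cases hzero : t₀ = 0
    · change FlatAt g E (t₀ • v)
      rw [hzero, zero_smul]
      exact (flatAt_modelExp_zero hg hflat hcomp x).1
    obtain ⟨ψ, z, hψ, hz⟩ := hflat (γ v t₀)
    obtain ⟨δ, hδ, hball⟩ := Metric.eventually_nhds_iff_ball.1 (hψ.eventually hg)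
    obtain ⟨a, ha⟩ := hψ.exists_eventuallyEq_line hg hz.symm (.of_forall (hγ' v))
    -- a time `s` close to `t₀` at which `E` is known to be flat
    have hsball : ∀ᶠ s in 𝓝 t₀, z + (s - t₀) • a ∈ Metric.ball z δ := by
      have : Continuous fun s : ℝ => z + (s - t₀) • a := by fun_prop
      exact this.continuousAt.eventually (Metric.isOpen_ball.mem_nhds (by
        simpa using hδ))
    obtain ⟨s, hs, has, hsb⟩ := ((mem_closure_iff_frequently.1 ht₀.1).and_eventually
      (ha.eventuallyEq_nhds.and hsball)).exists
    set z₂ := z + (s - t₀) • a with hz₂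
    have hEs : E (s • v) = ψ z₂ := (hEγ v s).trans has.self_of_nhds
    obtain ⟨L, hLinj, hL⟩ := FlatAt.exists_affine hg hflat hs (hball z₂ hsb) hEs
    have hLv : L v = a := by
      have h1 : (fun t => ψ (z₂ + (t - s) • L v)) =ᶠ[𝓝 s] fun t => ψ (z₂ + (t - s) • a) := by
        filter_upwards [hlin.continuousAt.eventually hL, has] with t h1 h2
        have e1 : z₂ + (t - s) • L v = z₂ + L (t • v - s • v) := by
          rw [← sub_smul, map_smul]
        have e2 : z₂ + (t - s) • a = z + (t - t₀) • a := by rw [hz₂]; module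
        rw [e1, e2]
        exact h1.symm.trans ((hEγ v t).trans h2)
      exact (hball z₂ hsb).line_injective (t := s) (h1.filter_mono nhdsWithin_le_nhds).frequently
    -- continuation along the geodesics in the directions `u` close to `v`
    have hpt : ∀ u t, (z₂ - L (s • v)) + t • L u = z₂ + L (t • u - s • v) := fun u t => by
      rw [map_sub, map_smul L t u]; abel
    have hu : ∀ᶠ u in 𝓝 v, E (t₀ • u) = ψ ((z₂ - L (s • v)) + L (t₀ • u)) := by
      have c1 : Tendsto (fun u => s • u) (𝓝 v) (𝓝 (s • v)) :=
        (by fun_prop : Continuous fun u : F => s • u).tendsto v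
      have c2 : ∀ᶠ u in 𝓝 v, (z₂ - L (s • v)) + s • L u ∈ Metric.ball z δ := by
        have : Continuous fun u : F => (z₂ - L (s • v)) + s • L u := by fun_prop
        refine this.continuousAt.eventually (Metric.isOpen_ball.mem_nhds ?_)
        change (z₂ - L (s • v)) + s • L v ∈ Metric.ball z δ
        rw [hpt]
        simpa using hsb
      have c3 : ∀ᶠ u in 𝓝 v, (z₂ - L (s • v)) + t₀ • L u ∈ Metric.ball z δ := by
        have : Continuous fun u : F => (z₂ - L (s • v)) + t₀ • L u := by fun_prop
        refine this.continuousAt.eventually (Metric.isOpen_ball.mem_nhds ?_)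
        have : (z₂ - L (s • v)) + t₀ • L v = z := by
          rw [map_smul, hLv, hz₂]; module
        change (z₂ - L (s • v)) + t₀ • L v ∈ Metric.ball z δ
        rw [this]
        exact Metric.mem_ball_self hδ
      filter_upwards [c1.eventually hL.eventually_nhds, c2, c3] with u h1 h2 h3
      rw [hEγ, map_smul L t₀]
      refine eq_line_of_geodAt hg hflat Metric.isOpen_ball (convex_ball z δ) hball
        (fun t _ => hγ' u t) h2 ?_ h3
      have c4 : Tendsto (fun t : ℝ => t • u) (𝓝 s) (𝓝 (s • u)) :=
        (by fun_prop : Continuous fun t : ℝ => t • u).tendsto s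
      filter_upwards [c4.eventually h1] with t ht
      rw [hpt, ← hEγ]
      exact ht
    have hw : E =ᶠ[𝓝 (t₀ • v)] fun w => ψ ((z₂ - L (s • v)) + L w) := by
      have c : Tendsto (fun w => t₀⁻¹ • w) (𝓝 (t₀ • v)) (𝓝 v) := by
        have := (by fun_prop : Continuous fun w : F => t₀⁻¹ • w).tendsto (t₀ • v)
        rwa [inv_smul_smul₀ hzero] at this
      filter_upwards [c.eventually hu] with w hw
      rwa [smul_inv_smul₀ hzero] at hw
    have hend : (z₂ - L (s • v)) + L (t₀ • v) = z := by
      rw [map_smul, map_smul, hLv, hz₂]; module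
    exact (FlatAt.comp_affine hLinj (by rw [hend]; exact hψ)).congr hw
  have : FlatAt g E ((1 : ℝ) • v) := hsub (mem_univ (1 : ℝ))
  rwa [one_smul] at this

end Developing

/-! ### Vanishing curvature implies local flatness -/

section LocallyFlat

open Filter Topology Set

variable {F : Type*} [NormedAddCommGroup F] [NormedSpace ℝ F] [FiniteDimensional ℝ F]
  {H : Type*} [TopologicalSpace H] {I : ModelWithCorners ℝ F H} [I.Boundaryless]
  {M : Type*} [TopologicalSpace M] [ChartedSpace H M] [IsManifold I ∞ M]
  {g : ∀ x : M, TangentSpace I x →L[ℝ] TangentSpace I x →L[ℝ] ℝ}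

/-- If `f` are coordinates near `p`, given in the preferred chart, in which the metric has constant
coefficients, then their inverse is a flat map into `M` through `p`. -/
theorem flatAt_of_coordinates {p : M} {f : F → F} {θ : F → F →L[ℝ] F} {O : Set F} (hO : IsOpen O)
    (hOt : O ⊆ (extChartAt I p).target) (hf : ContDiffOn ℝ ∞ f O)
    (hθ : ∀ y ∈ O, HasFDerivAt f (θ y) y ∧ IsUnit (θ y) ∧ ∀ u v, metricInChart I g p y u v
      = metricInChart I g p (extChartAt I p p) (θ y u) (θ y v)) (hp : extChartAt I p p ∈ O) :
    ∃ (ψ : F → M) (z : F), FlatAt g ψ z ∧ ψ z = p := by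
  have : CompleteSpace F := FiniteDimensional.complete ℝ F
  set y₀ := extChartAt I p p with hy₀
  have hfy : ∀ y ∈ O, ContDiffAt ℝ ∞ f y := fun y hy => hf.contDiffAt (hO.mem_nhds hy)
  have hequiv : ∀ y ∈ O, ∃ e : F ≃L[ℝ] F, (e : F →L[ℝ] F) = θ y := fun y hy => by
    obtain ⟨u, hu⟩ := (hθ y hy).2.1
    exact ⟨ContinuousLinearEquiv.unitsEquiv ℝ F u, by ext v; rw [← hu]; rfl⟩
  obtain ⟨e₀, he₀⟩ := hequiv y₀ hp
  have hd₀ : HasFDerivAt f (e₀ : F →L[ℝ] F) y₀ := by rw [he₀]; exact (hθ y₀ hp).1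
  let e := (hfy y₀ hp).toOpenPartialHomeomorph f hd₀ (by simp)
  have hes : y₀ ∈ e.source := (hfy y₀ hp).mem_toOpenPartialHomeomorph_source hd₀ (by simp)
  have het : f y₀ ∈ e.target := (hfy y₀ hp).image_mem_toOpenPartialHomeomorph_target hd₀ (by simp)
  have hef : ∀ y, e y = f y := fun y => rfl
  have hinv : e.symm (f y₀) = y₀ := e.left_inv hes
  have hnear : ∀ᶠ z in 𝓝 (f y₀), z ∈ e.target ∧ e.symm z ∈ O := by
    refine (e.open_target.eventually_mem het).and ?_
    exact (e.continuousAt_symm het).eventually (by rw [hinv]; exact hO.mem_nhds hp)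
  let ψ : F → M := fun z => (extChartAt I p).symm (e.symm z)
  have hsymm : ∀ z, z ∈ e.target → e.symm z ∈ O → ContDiffAt ℝ ∞ e.symm z := fun z hz hzO => by
    obtain ⟨e', he'⟩ := hequiv _ hzO
    exact e.contDiffAt_symm hz (f₀' := e') (by rw [he']; exact (hθ _ hzO).1) (hfy _ hzO)
  have hψs : ∀ z, z ∈ e.target → e.symm z ∈ O → ContMDiffAt 𝓘(ℝ, F) I ∞ ψ z := fun z hz hzO =>
    ((contMDiffOn_extChartAt_symm p).contMDiffAt
      ((isOpen_extChartAt_target p).mem_nhds (hOt hzO))).comp z (hsymm z hz hzO).contMDiffAt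
  have hψsrc : ∀ z, e.symm z ∈ O → ψ z ∈ (chartAt H p).source := fun z hz => by
    have := (extChartAt I p).map_target (hOt hz)
    rwa [extChartAt_source] at this
  have hchart : ∀ z, e.symm z ∈ O → extChartAt I p (ψ z) = e.symm z := fun z hz =>
    (extChartAt I p).right_inv (hOt hz)
  have hder : ∀ᶠ z in 𝓝 (f y₀), ∀ u,
      θ (e.symm z) (fderiv ℝ (fun z => extChartAt I p (ψ z)) z u) = u := by
    filter_upwards [hnear.eventually_nhds] with z hz u
    have h1 : (fun z => extChartAt I p (ψ z)) =ᶠ[𝓝 z] e.symm := hz.mono fun w hw => hchart w hw.2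
    have h2 := ((hsymm z hz.self_of_nhds.1 hz.self_of_nhds.2).differentiableAt
      (by simp)).hasFDerivAt
    have h3 := (hθ _ hz.self_of_nhds.2).1.comp z h2
    have h4 : f ∘ e.symm =ᶠ[𝓝 z] id := hz.mono fun w hw => e.right_inv hw.1
    have h5 := h3.unique ((hasFDerivAt_id z).congr_of_eventuallyEq h4)
    rw [h1.fderiv_eq]
    exact congrArg (fun A : F →L[ℝ] F => A u) h5
  have hform : ∀ᶠ z in 𝓝 (f y₀), ∀ u v, formAt I g (ψ z) (chartVel I ψ z u) (chartVel I ψ z v)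
      = metricInChart I g p y₀ u v := by
    filter_upwards [hnear, hder] with z hz hd u v
    rw [← metricInChart_fderiv g (hψs z hz.1 hz.2) (hψsrc z hz.2), hchart z hz.2,
      (hθ _ hz.2).2.2, hd, hd]
  refine ⟨ψ, f y₀, ⟨hnear.mono fun z hz => hψs z hz.1 hz.2, ?_, ?_⟩, ?_⟩
  · filter_upwards [hform] with z hz u v
    rw [hz, hform.self_of_nhds]
  · rw [injective_iff_map_eq_zero]
    intro u hu
    have hz := hnear.self_of_nhds
    have h1 := fderiv_chart_change (x₀ := ψ (f y₀)) (x₁ := p) (hψs _ hz.1 hz.2)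
      (mem_chart_source H _) (hψsrc _ hz.2) u
    have h2 : fderiv ℝ (fun z => extChartAt I (ψ (f y₀)) (ψ z)) (f y₀) u = 0 := hu
    rw [h2, map_zero] at h1
    rw [← hder.self_of_nhds u, ← h1, map_zero]
  · change (extChartAt I p).symm (e.symm (f y₀)) = p
    rw [hinv, hy₀, extChartAt_to_inv]

theorem contDiffOn_christoffel (hg : IsMetric I g) {x₀ : M}
    (hs : ContDiffOn ℝ ∞ (metricInChart I g x₀) (extChartAt I x₀).target) :
    ContDiffOn ℝ ∞ (christoffel I g x₀) (extChartAt I x₀).target := by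
  have : CompleteSpace F := FiniteDimensional.complete ℝ F
  have hO : IsOpen (extChartAt I x₀).target := isOpen_extChartAt_target x₀
  have h1 : ContDiffOn ℝ ∞ (fderiv ℝ (metricInChart I g x₀)) (extChartAt I x₀).target :=
    hs.fderiv_of_isOpen hO (by simp)
  have h2 : ContDiffOn ℝ ∞ (fun y => (fderiv ℝ (metricInChart I g x₀) y).flip)
      (extChartAt I x₀).target :=
    (ContinuousLinearMap.flipₗᵢ ℝ F F (F →L[ℝ] ℝ)).contDiff.comp_contDiffOn h1
  have h3 : ContDiffOn ℝ ∞ (fun y =>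
      (ContinuousLinearMap.flipₗᵢ ℝ F F ℝ).toContinuousLinearEquiv.toContinuousLinearMap ∘L
        (fderiv ℝ (metricInChart I g x₀) y).flip) (extChartAt I x₀).target :=
    contDiffOn_const.clm_comp h2
  have h4 : ContDiffOn ℝ ∞ (christoffelFirst I g x₀) (extChartAt I x₀).target :=
    ((h1.add h2).sub h3).const_smul (1 / 2 : ℝ)
  have h5 : ContDiffOn ℝ ∞ (fun y => (metricInChart I g x₀ y).inverse)
      (extChartAt I x₀).target := by
    intro y hy
    have hinv : (metricInChart I g x₀ y).IsInvertible := by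
      refine isInvertible_of_pos fun v hv => ?_
      have hy' : (extChartAt I x₀).symm y ∈ (chartAt H x₀).source := by
        have := (extChartAt I x₀).map_target hy
        rwa [extChartAt_source] at this
      have := metricInChart_pos hg hy' hv
      rwa [(extChartAt I x₀).right_inv hy] at this
    obtain ⟨e, he⟩ := hinv
    have := contDiffAt_map_inverse (𝕜 := ℝ) (n := ∞) e
    rw [he] at this
    exact this.comp_contDiffWithinAt y (hs y hy)
  have h6 : ContDiffOn ℝ ∞ (fun y => ContinuousLinearMap.compL ℝ F (F →L[ℝ] ℝ) F
      (metricInChart I g x₀ y).inverse) (extChartAt I x₀).target :=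
    (ContinuousLinearMap.compL ℝ F (F →L[ℝ] ℝ) F).contDiff.comp_contDiffOn h5
  exact h6.clm_comp h4

/-- A metric with vanishing curvature is locally flat. -/
theorem IsFlat.locallyFlat (hg : IsMetric I g)
    (hs : ∀ x₀ : M, ContDiffOn ℝ ∞ (metricInChart I g x₀) (extChartAt I x₀).target)
    (h : IsFlat I g) : LocallyFlat g := by
  have : CompleteSpace F := FiniteDimensional.complete ℝ F
  intro p
  have hO : IsOpen (extChartAt I p).target := isOpen_extChartAt_target p
  have hBd : ∀ y ∈ (extChartAt I p).target, HasFDerivAt (metricInChart I g p)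
      (fderiv ℝ (metricInChart I g p) y) y := fun y hy =>
    (((hs p).differentiableOn (by simp)).differentiableAt (hO.mem_nhds hy)).hasFDerivAt
  have hDs : ∀ y ∈ (extChartAt I p).target, ∀ h u v, fderiv ℝ (metricInChart I g p) y h u v
      = fderiv ℝ (metricInChart I g p) y h v u := by
    intro y hy h u v
    have h1 := ((hBd y hy).clm_apply (hasFDerivAt_const u y)).clm_apply (hasFDerivAt_const v y)
    have h2 := ((hBd y hy).clm_apply (hasFDerivAt_const v y)).clm_apply (hasFDerivAt_const u y)
    have h3 : (fun y => metricInChart I g p y u v) = fun y => metricInChart I g p y v u :=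
      funext fun y => metricInChart_symm hg p y u v
    rw [h3] at h1
    simpa using congrArg (fun A : F →L[ℝ] ℝ => A h) (h1.unique h2)
  have hfirst : ∀ y u v w, christoffelFirst I g p y u v w
      = (1 / 2 : ℝ) * (fderiv ℝ (metricInChart I g p) y u v w
        + fderiv ℝ (metricInChart I g p) y v u w
        - fderiv ℝ (metricInChart I g p) y w u v) := fun _ _ _ _ => rfl
  have hinv : ∀ y ∈ (extChartAt I p).target, (metricInChart I g p y).IsInvertible := by
    intro y hy
    refine isInvertible_of_pos fun v hv => ?_
    have hy' : (extChartAt I p).symm y ∈ (chartAt H p).source := by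
      have := (extChartAt I p).map_target hy
      rwa [extChartAt_source] at this
    have := metricInChart_pos hg hy' hv
    rwa [(extChartAt I p).right_inv hy] at this
  have hΓ : ∀ y u v, christoffel I g p y u v
      = (metricInChart I g p y).inverse (christoffelFirst I g p y u v) := fun _ _ _ => rfl
  have hBΓ : ∀ y ∈ (extChartAt I p).target, ∀ u v w,
      metricInChart I g p y (christoffel I g p y u v) w = christoffelFirst I g p y u v w := by
    intro y hy u v w
    rw [hΓ, apply_inverse_apply (hinv y hy)]
  obtain ⟨O, f, θ, h1, h2, h3, h4, h5⟩ := exists_flat_coordinates hO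
    ((hs p).differentiableOn (by simp)) (contDiffOn_christoffel hg (hs p))
    (fun y hy u v => by
      rw [hΓ, hΓ]
      congr 1
      ext w
      rw [hfirst, hfirst, hDs y hy w u v]
      ring)
    (fun y hy k u v => by
      rw [hBΓ y hy, metricInChart_symm hg p y u, hBΓ y hy, hfirst, hfirst,
        hDs y hy k v u, hDs y hy u k v, hDs y hy v k u]
      ring)
    (fun y hy u v w => h p y hy u v w) (mem_extChartAt_target p)
  exact flatAt_of_coordinates h1 h3 h4 h5 h2

end LocallyFlat

/-! ### Flat Riemannian metrics -/

section RiemannianMetric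

open Filter Topology Set

variable {n : ℕ} {Q : Type*} [TopologicalSpace Q] [ChartedSpace (Eu n) Q]
  [IsManifold (𝓡 n) ∞ Q] (σ : SmoothMetric n Q)

theorem isMetric_inner : IsMetric (𝓡 n) σ.inner :=
  ⟨fun p u v => σ.symm p u v, fun p v hv => σ.pos p v hv⟩

/-- The coefficients of a smooth Riemannian metric are smooth; Mathlib states smoothness of the
metric as that of a section of a bundle of bilinear maps. -/
theorem contDiffOn_metricInChart (x₀ : Q) :
    ContDiffOn ℝ ∞ (metricInChart (𝓡 n) σ.inner x₀) (extChartAt (𝓡 n) x₀).target := by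
  have hO : IsOpen (extChartAt (𝓡 n) x₀).target := isOpen_extChartAt_target x₀
  intro y hy
  refine ContDiffAt.contDiffWithinAt ?_
  have hsrc : ∀ y ∈ (extChartAt (𝓡 n) x₀).target,
      (extChartAt (𝓡 n) x₀).symm y ∈ (chartAt (Eu n) x₀).source := fun y hy => by
    have := (extChartAt (𝓡 n) x₀).map_target hy
    rwa [extChartAt_source] at this
  have hbase : ∀ q ∈ (chartAt (Eu n) x₀).source,
      q ∈ (trivializationAt (Eu n) (TangentSpace (𝓡 n) : Q → Type _) x₀).baseSet := fun q hq => by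
    simpa using hq
  have h1 := (Trivialization.contMDiffAt_section_iff
    (trivializationAt (Eu n →L[ℝ] Eu n →L[ℝ] ℝ)
      (fun q : Q => TangentSpace (𝓡 n) q →L[ℝ] TangentSpace (𝓡 n) q →L[ℝ] ℝ) x₀)
    (x₀ := (extChartAt (𝓡 n) x₀).symm y) (IB := 𝓡 n) (n := ∞) (s := σ.inner)
    (by simpa using hsrc y hy)).1
    (σ.contMDiff _)
  have h2 := (h1.comp y ((contMDiffOn_extChartAt_symm (n := ∞) x₀).contMDiffAt
    (hO.mem_nhds hy))).contDiffAt
  refine h2.congr_of_eventuallyEq ?_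
  filter_upwards [hO.mem_nhds hy] with w hw
  ext u v
  have hw' := hsrc w hw
  have h3 := inCoordinates_apply_eq₂ (𝕜 := ℝ) (F₁ := Eu n) (F₂ := Eu n) (F₃ := ℝ)
    (E₁ := fun q : Q => TangentSpace (𝓡 n) q) (E₂ := fun q : Q => TangentSpace (𝓡 n) q)
    (E₃ := Trivial Q ℝ) (x₀ := x₀) (x := (extChartAt (𝓡 n) x₀).symm w)
    (ϕ := σ.inner ((extChartAt (𝓡 n) x₀).symm w)) (v := u) (w := v)
    (hbase _ hw') (hbase _ hw') (by simp)
  have h4 : ∀ u : Eu n, (trivializationAt (Eu n) (TangentSpace (𝓡 n) : Q → Type _) x₀).symm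
      ((extChartAt (𝓡 n) x₀).symm w) u = tangentCoordChange (𝓡 n) x₀
        ((extChartAt (𝓡 n) x₀).symm w) ((extChartAt (𝓡 n) x₀).symm w) u := fun u => by
    exact (Trivialization.symmL_apply (R := ℝ) _ (hbase _ hw') u).symm.trans
      (congrArg (fun A : Eu n →L[ℝ] Eu n => A u)
        (TangentBundle.symmL_trivializationAt_eq_core (I := 𝓡 n) hw'))
  have h5 : ∀ c : ℝ, (trivializationAt ℝ (Trivial Q ℝ) x₀).linearMapAt ℝ
      ((extChartAt (𝓡 n) x₀).symm w) c = c := fun c => by simp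
  refine Eq.trans ?_ (h3.trans (h5 _)).symm
  rw [h4, h4]
  rfl

theorem locallyFlat_of_isFlat (h : IsFlat (𝓡 n) σ.inner) : LocallyFlat (I := 𝓡 n) σ.inner :=
  h.locallyFlat (isMetric_inner σ) (contDiffOn_metricInChart σ)

end RiemannianMetric

/-! ### The cotangent bundle and its lifted metric -/

section TotalSpaceHausdorff

/-- The total space of a fiber bundle with Hausdorff base and Hausdorff fiber is Hausdorff. -/
theorem t2Space_totalSpace {B F : Type*} (E : B → Type*) [TopologicalSpace B] [TopologicalSpace F]
    [TopologicalSpace (TotalSpace F E)] [∀ b, TopologicalSpace (E b)] [FiberBundle F E]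
    [T2Space B] [T2Space F] : T2Space (TotalSpace F E) := by
  rw [t2Space_iff]
  intro m m' hne
  by_cases hb : m.1 = m'.1
  · let e := trivializationAt F E m.1
    have hm : m ∈ e.source := e.mem_source.2 (mem_baseSet_trivializationAt F E m.1)
    have hm' : m' ∈ e.source :=
      e.mem_source.2 (by rw [← show m.1 = m'.1 from hb]; exact mem_baseSet_trivializationAt F E m.1)
    obtain ⟨u, v, hu, hv, hmu, hmv, huv⟩ := t2_separation (e.injOn.ne hm hm' hne)
    exact ⟨_, _, e.isOpen_inter_preimage hu, e.isOpen_inter_preimage hv, ⟨hm, hmu⟩, ⟨hm', hmv⟩,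
      ((huv.preimage e).mono Set.inter_subset_right Set.inter_subset_right)⟩
  · obtain ⟨u, v, hu, hv, hmu, hmv, huv⟩ := t2_separation hb
    have hc := FiberBundle.continuous_proj F E
    exact ⟨_, _, hu.preimage hc, hv.preimage hc, hmu, hmv, huv.preimage _⟩

end TotalSpaceHausdorff

section Cotangent

open Filter Topology Set

variable {n : ℕ} {Q : Type*} [TopologicalSpace Q] [ChartedSpace (Eu n) Q]
  [IsManifold (𝓡 n) ∞ Q] (σ : SmoothMetric n Q)

instance [T2Space Q] : T2Space (Cotangent n Q) := t2Space_totalSpace _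

/-- The point of `T*Q` over `q` with momentum `p`, in the components of the preferred chart. -/
def cotMk (q : Q) (p : Eu n →L[ℝ] ℝ) : Cotangent n Q := ⟨q, p⟩

/-- The momentum of a point of `T*Q`, in the components of the preferred chart. -/
def momentum (m : Cotangent n Q) : Eu n →L[ℝ] ℝ := m.2

/-- In the chart of `T*Q` over a chart of `Q`, the fibre coordinates of a covector are its
components in that chart of `Q`. -/
theorem extChartAt_cotangent {m m' : Cotangent n Q} (h : m'.1 ∈ (chartAt (Eu n) m.1).source) :
    extChartAt (cotModel n) m m' = (extChartAt (𝓡 n) m.1 m'.1,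
      momentum m' ∘L tangentCoordChange (𝓡 n) m.1 m'.1 m'.1) := by
  rw [FiberBundle.extChartAt]
  refine Prod.ext rfl ?_
  ext u
  have h4 : (trivializationAt (Eu n) (TangentSpace (𝓡 n) : Q → Type _) m.1).symmL ℝ m'.1
      = tangentCoordChange (𝓡 n) m.1 m'.1 m'.1 :=
    TangentBundle.symmL_trivializationAt_eq_core (I := 𝓡 n) h
  have h5 : ∀ c : ℝ, (trivializationAt ℝ (Trivial Q ℝ) m.1).continuousLinearMapAt ℝ m'.1 c = c :=
    fun c => by simp
  refine (h5 _).trans ?_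
  exact congrArg (fun A : Eu n →L[ℝ] Eu n => momentum m' (A u)) h4

theorem musicalFlat_isInvertible (q : Q) : (musicalFlat σ q).IsInvertible :=
  isInvertible_of_pos fun v hv => σ.pos q v hv

theorem musicalSharp_musicalFlat (q : Q) (v : Eu n) : musicalSharp σ q (musicalFlat σ q v) = v :=
  inverse_apply_apply (musicalFlat_isInvertible σ q) v

theorem musicalFlat_musicalSharp (q : Q) (p : Eu n →L[ℝ] ℝ) :
    musicalFlat σ q (musicalSharp σ q p) = p :=
  apply_inverse_apply (musicalFlat_isInvertible σ q) p

theorem covariantVelocity_apply (m : Cotangent n Q) (V : Eu n × (Eu n →L[ℝ] ℝ)) :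
    covariantVelocity σ m V = V.2 - momentumChristoffel σ m V.1 := rfl

theorem formAt_liftedMetric (m : Cotangent n Q) (V W : Eu n × (Eu n →L[ℝ] ℝ)) :
    formAt (cotModel n) (liftedMetric σ) m V W = musicalFlat σ m.1 V.1 W.1
      + musicalFlat σ m.1 (musicalSharp σ m.1 (covariantVelocity σ m V))
        (musicalSharp σ m.1 (covariantVelocity σ m W)) := rfl

theorem isMetric_liftedMetric : IsMetric (cotModel n) (liftedMetric σ) := by
  refine ⟨fun m V W => ?_, fun m V hV => ?_⟩
  · rw [formAt_liftedMetric, formAt_liftedMetric]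
    exact congrArg₂ (· + ·) (σ.symm _ _ _) (σ.symm _ _ _)
  · rw [formAt_liftedMetric]
    have hnn : ∀ v : Eu n, 0 ≤ musicalFlat σ m.1 v v := fun v => by
      by_cases hv : v = 0
      · simp [hv]
      · exact (σ.pos m.1 v hv).le
    by_cases h1 : V.1 = 0
    · refine add_pos_of_nonneg_of_pos (hnn _) (σ.pos _ _ fun h0 => hV ?_)
      have h2 := congrArg (musicalFlat σ m.1) h0
      have h3 := (musicalFlat_musicalSharp σ m.1 _).symm.trans h2
      rw [covariantVelocity_apply, h1] at h3
      refine Prod.ext h1 ?_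
      have h4 : musicalFlat σ m.1 0 = 0 := map_zero _
      have h5 := h3.trans h4
      rwa [map_zero, sub_zero] at h5
    · exact add_pos_of_pos_of_nonneg (σ.pos _ _ h1) (hnn _)

theorem covariantVelocity_ofHorizVert (m : Cotangent n Q) (a c : Eu n) :
    covariantVelocity σ m (ofHorizVert σ m a c) = musicalFlat σ m.1 c :=
  add_sub_cancel_right _ _

theorem almostComplex_ofHorizVert (m : Cotangent n Q) (a c : Eu n) :
    almostComplex σ m (ofHorizVert σ m a c) = ofHorizVert σ m (-c) a := by
  unfold almostComplex
  rw [covariantVelocity_ofHorizVert, musicalSharp_musicalFlat]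
  rfl

/-- The lift to cotangent bundles of a local diffeomorphism `E : ℝⁿ → Q`: a covector at `x` is
transported to `E x` by the inverse of the derivative of `E` at `x`. -/
def cotLift (E : Eu n → Q) (y : Eu n × (Eu n →L[ℝ] ℝ)) : Cotangent n Q :=
  cotMk (E y.1) (y.2 ∘L (chartVel (𝓡 n) E y.1).inverse)

/-- The bilinear form `E^*σ` at `x`. -/
def pullForm (E : Eu n → Q) (x : Eu n) : Eu n →L[ℝ] Eu n →L[ℝ] ℝ :=
  (formAt (𝓡 n) σ.inner (E x)).bilinearComp (chartVel (𝓡 n) E x) (chartVel (𝓡 n) E x)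

variable {σ} {E : Eu n → Q}

theorem chartVel_isInvertible {x : Eu n} (h : FlatAt (I := 𝓡 n) σ.inner E x) :
    (chartVel (𝓡 n) E x).IsInvertible := isInvertible_of_injective h.injective

theorem pullForm_isInvertible {x : Eu n} (h : FlatAt (I := 𝓡 n) σ.inner E x) :
    (pullForm σ E x).IsInvertible :=
  isInvertible_of_pos fun _ hv => (isMetric_inner σ).pos _ _ fun h0 =>
    hv (h.injective (h0.trans (map_zero _).symm))

/-- In the chart of `T*Q` over a chart `κ` of `Q`, the lift of `E` is
`(x, w) ↦ (κ(E x), w ∘ ((κ ∘ E)'(x))⁻¹)`. -/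
theorem extChartAt_cotLift {m : Cotangent n Q} {y : Eu n × (Eu n →L[ℝ] ℝ)}
    (h : FlatAt (I := 𝓡 n) σ.inner E y.1) (hm : E y.1 ∈ (chartAt (Eu n) m.1).source) :
    extChartAt (cotModel n) m (cotLift E y) = (extChartAt (𝓡 n) m.1 (E y.1),
      y.2 ∘L (fderiv ℝ (fun z => extChartAt (𝓡 n) m.1 (E z)) y.1).inverse) := by
  rw [extChartAt_cotangent hm]
  refine Prod.ext rfl ?_
  have hinv := isInvertible_of_injective (h.injective_chart hm)
  ext u
  have h1 := fderiv_chart_change h.smooth.self_of_nhds hm (mem_chart_source (Eu n) (E y.1))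
    ((fderiv ℝ (fun z => extChartAt (𝓡 n) m.1 (E z)) y.1).inverse u)
  rw [apply_inverse_apply hinv] at h1
  change y.2 ((chartVel (𝓡 n) E y.1).inverse
    (tangentCoordChange (𝓡 n) m.1 (E y.1) (E y.1) u)) = y.2 _
  rw [h1]
  exact congrArg y.2 (inverse_apply_apply (chartVel_isInvertible h) _)

theorem contDiffAt_inverse_fderiv {κ : Eu n → Eu n} {x : Eu n} (hκ : ContDiffAt ℝ ∞ κ x)
    (hinv : (fderiv ℝ κ x).IsInvertible) : ContDiffAt ℝ ∞ (fun y => (fderiv ℝ κ y).inverse) x := by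
  obtain ⟨e, he⟩ := hinv
  have h := contDiffAt_map_inverse (𝕜 := ℝ) (n := ∞) e
  rw [he] at h
  exact h.comp x (hκ.fderiv_right (by simp))

theorem contDiffAt_cotLift_chart {q : Q} {y : Eu n × (Eu n →L[ℝ] ℝ)}
    (h : FlatAt (I := 𝓡 n) σ.inner E y.1) (hm : E y.1 ∈ (chartAt (Eu n) q).source) :
    ContDiffAt ℝ ∞ (fun y : Eu n × (Eu n →L[ℝ] ℝ) =>
      y.2 ∘L (fderiv ℝ (fun z => extChartAt (𝓡 n) q (E z)) y.1).inverse) y := by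
  have h1 := contDiffAt_inverse_fderiv (contDiffAt_extChartAt_comp h.smooth.self_of_nhds hm)
    (isInvertible_of_injective (h.injective_chart hm))
  exact contDiffAt_snd.clm_comp (h1.comp y contDiffAt_fst)

theorem contMDiffAt_cotLift (h : ∀ x, FlatAt (I := 𝓡 n) σ.inner E x)
    (y : Eu n × (Eu n →L[ℝ] ℝ)) :
    ContMDiffAt 𝓘(ℝ, Eu n × (Eu n →L[ℝ] ℝ)) (cotModel n) ∞ (cotLift E) y := by
  have hs : E y.1 ∈ (chartAt (Eu n) (E y.1)).source := mem_chart_source _ _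
  have h1 : ContMDiffAt 𝓘(ℝ, Eu n × (Eu n →L[ℝ] ℝ)) (𝓡 n) ∞
      (fun y : Eu n × (Eu n →L[ℝ] ℝ) => E y.1) y :=
    ContMDiffAt.comp y (h y.1).smooth.self_of_nhds contDiffAt_fst.contMDiffAt
  rw [contMDiffAt_totalSpace]
  refine ⟨h1, ((contDiffAt_cotLift_chart (h y.1) hs).congr_of_eventuallyEq ?_).contMDiffAt⟩
  filter_upwards [h1.continuousAt.eventually
    ((chartAt (Eu n) (E y.1)).open_source.mem_nhds hs)] with z hz
  have h2 := congrArg Prod.snd (extChartAt_cotLift (m := cotLift E y) (h z.1) hz)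
  rw [FiberBundle.extChartAt] at h2
  exact h2

/-- The derivative of the lift of `E`. The second component arises by differentiating
`J(x, w)(κ'(x) v) = w v`, where `J(x, w) = w ∘ κ'(x)⁻¹` and `κ` is `E` in a chart; the term with
`κ''` is a Christoffel symbol. -/
theorem chartVel_cotLift (h : ∀ x, FlatAt (I := 𝓡 n) σ.inner E x) (x : Eu n) (w : Eu n →L[ℝ] ℝ)
    (a : Eu n) (c : Eu n →L[ℝ] ℝ) :
    chartVel (cotModel n) (cotLift E) (x, w) (a, c) = (chartVel (𝓡 n) E x a,
      c ∘L (chartVel (𝓡 n) E x).inverse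
        + momentumChristoffel σ (cotLift E (x, w)) (chartVel (𝓡 n) E x a)) := by
  have hs : E x ∈ (chartAt (Eu n) (E x)).source := mem_chart_source _ _
  set κ : Eu n → Eu n := fun z => extChartAt (𝓡 n) (E x) (E z) with hκdef
  have hκ : ContDiffAt ℝ ∞ κ x := contDiffAt_extChartAt_comp (h x).smooth.self_of_nhds hs
  have hvel : chartVel (𝓡 n) E x = fderiv ℝ κ x := rfl
  have hsrc : ∀ᶠ z in 𝓝 x, E z ∈ (chartAt (Eu n) (E x)).source :=
    (h x).continuousAt.eventually ((chartAt (Eu n) (E x)).open_source.mem_nhds hs)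
  have hfst : Tendsto (fun z : Eu n × (Eu n →L[ℝ] ℝ) => z.1) (𝓝 (x, w)) (𝓝 x) :=
    continuousAt_fst
  let J : Eu n × (Eu n →L[ℝ] ℝ) → (Eu n →L[ℝ] ℝ) := fun z => z.2 ∘L (fderiv ℝ κ z.1).inverse
  have hJ : DifferentiableAt ℝ J (x, w) :=
    (contDiffAt_cotLift_chart (y := (x, w)) (h x) hs).differentiableAt (by simp)
  have hκ' : DifferentiableAt ℝ (fderiv ℝ κ) x :=
    ((hκ.of_le (m := 2) ENat.LEInfty.out).fderiv_right (m := 1) (by norm_num)).differentiableAt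
      (by simp)
  have hinv : (fderiv ℝ κ x).IsInvertible := isInvertible_of_injective ((h x).injective_chart hs)
  have h1 : (fun z => extChartAt (cotModel n) (cotLift E (x, w)) (cotLift E z))
      =ᶠ[𝓝 (x, w)] fun z => (κ z.1, J z) := by
    filter_upwards [hfst.eventually hsrc] with z hz
    exact extChartAt_cotLift (m := cotLift E (x, w)) (h z.1) hz
  have h2 : HasFDerivAt (fun z : Eu n × (Eu n →L[ℝ] ℝ) => (κ z.1, J z))
      ((fderiv ℝ κ x ∘L ContinuousLinearMap.fst ℝ (Eu n) (Eu n →L[ℝ] ℝ)).prod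
        (fderiv ℝ J (x, w))) (x, w) :=
    (((hκ.differentiableAt (by simp)).hasFDerivAt).comp (x, w)
      (f := fun z : Eu n × (Eu n →L[ℝ] ℝ) => z.1) hasFDerivAt_fst).prodMk hJ.hasFDerivAt
  have h3 : chartVel (cotModel n) (cotLift E) (x, w) (a, c)
      = (fderiv ℝ κ x a, fderiv ℝ J (x, w) (a, c)) := by
    have e : chartVel (cotModel n) (cotLift E) (x, w) = _ := h1.fderiv_eq.trans h2.fderiv
    rw [e]
    rfl
  rw [h3]
  refine Prod.ext rfl ?_
  ext u
  obtain ⟨v, rfl⟩ : ∃ v, fderiv ℝ κ x v = u := ⟨_, apply_inverse_apply hinv u⟩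
  have h4 : (fun z => J z (fderiv ℝ κ z.1 v)) =ᶠ[𝓝 (x, w)] fun z => z.2 v := by
    filter_upwards [hfst.eventually hsrc] with z hz
    exact congrArg z.2 (inverse_apply_apply
      (isInvertible_of_injective ((h z.1).injective_chart hz)) v)
  have h5 : HasFDerivAt (fun z : Eu n × (Eu n →L[ℝ] ℝ) => fderiv ℝ κ z.1)
      (fderiv ℝ (fderiv ℝ κ) x ∘L ContinuousLinearMap.fst ℝ (Eu n) (Eu n →L[ℝ] ℝ)) (x, w) :=
    hκ'.hasFDerivAt.comp (x, w) (f := fun z : Eu n × (Eu n →L[ℝ] ℝ) => z.1) hasFDerivAt_fst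
  have h6 := hJ.hasFDerivAt.clm_apply (h5.clm_apply (hasFDerivAt_const v (x, w)))
  have h7 : HasFDerivAt (fun z : Eu n × (Eu n →L[ℝ] ℝ) => z.2 v) _ (x, w) :=
    hasFDerivAt_snd.clm_apply (hasFDerivAt_const v (x, w))
  have h8 := congrArg (fun A : Eu n × (Eu n →L[ℝ] ℝ) →L[ℝ] ℝ => A (a, c))
    (h6.unique (h7.congr_of_eventuallyEq h4))
  have h9 := (h x).christoffel_eq (isMetric_inner σ) hs a v
  have h10 : J (x, w) (fderiv ℝ (fderiv ℝ κ) x a v) + fderiv ℝ J (x, w) (a, c) (fderiv ℝ κ x v)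
      = c v := by simpa using h8
  have h11 : momentumChristoffel σ (cotLift E (x, w)) (fderiv ℝ κ x a) (fderiv ℝ κ x v)
      = J (x, w) (-(fderiv ℝ (fderiv ℝ κ) x a v)) := congrArg (J (x, w)) h9
  change fderiv ℝ J (x, w) (a, c) (fderiv ℝ κ x v) = c ((fderiv ℝ κ x).inverse (fderiv ℝ κ x v))
    + momentumChristoffel σ (cotLift E (x, w)) (fderiv ℝ κ x a) (fderiv ℝ κ x v)
  rw [inverse_apply_apply hinv, h11, map_neg, ← h10]
  ring

/-- In terms of the horizontal and vertical components, the derivative of the lift of `E` is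
complex linear: it applies the derivative of `E` to both components. -/
theorem chartVel_cotLift_pullForm (h : ∀ x, FlatAt (I := 𝓡 n) σ.inner E x) (x : Eu n)
    (w : Eu n →L[ℝ] ℝ) (a s : Eu n) :
    chartVel (cotModel n) (cotLift E) (x, w) (a, pullForm σ E x s)
      = ofHorizVert σ (cotLift E (x, w)) (chartVel (𝓡 n) E x a) (chartVel (𝓡 n) E x s) := by
  rw [chartVel_cotLift h]
  have : pullForm σ E x s ∘L (chartVel (𝓡 n) E x).inverse
      = musicalFlat σ (E x) (chartVel (𝓡 n) E x s) := by
    ext u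
    exact congrArg (musicalFlat σ (E x) (chartVel (𝓡 n) E x s))
      (apply_inverse_apply (chartVel_isInvertible (h x)) u)
  rw [this]
  rfl

theorem formAt_liftedMetric_ofHorizVert (m : Cotangent n Q) (a c a' c' : Eu n) :
    formAt (cotModel n) (liftedMetric σ) m (ofHorizVert σ m a c) (ofHorizVert σ m a' c')
      = musicalFlat σ m.1 a a' + musicalFlat σ m.1 c c' := by
  refine (formAt_liftedMetric σ m _ _).trans ?_
  rw [covariantVelocity_ofHorizVert, covariantVelocity_ofHorizVert, musicalSharp_musicalFlat,
    musicalSharp_musicalFlat]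
  rfl

/-- The form `E^*σ` is locally constant, hence constant because `ℝⁿ` is connected. -/
theorem pullForm_constant (h : ∀ x, FlatAt (I := 𝓡 n) σ.inner E x) (x y : Eu n) :
    pullForm σ E x = pullForm σ E y := by
  have : IsLocallyConstant (pullForm σ E) := (IsLocallyConstant.iff_eventually_eq _).2 fun x => by
    filter_upwards [(h x).constant] with y hy
    ext u v
    exact hy u v
  exact this.apply_eq_of_preconnectedSpace x y

/-- The lift of a local isometry is a local isometry for the lifted metric and the flat metric
`E^*σ ⊕ (E^*σ)⁻¹` on `ℝⁿ × (ℝⁿ)*`. -/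
theorem flatAt_cotLift (h : ∀ x, FlatAt (I := 𝓡 n) σ.inner E x) (y : Eu n × (Eu n →L[ℝ] ℝ)) :
    FlatAt (I := cotModel n) (liftedMetric σ) (cotLift E) y := by
  refine ⟨.of_forall fun y => contMDiffAt_cotLift h y, .of_forall fun z U V => ?_, ?_⟩
  · have key : ∀ (z : Eu n × (Eu n →L[ℝ] ℝ)) (U V : Eu n × (Eu n →L[ℝ] ℝ)),
        formAt (cotModel n) (liftedMetric σ) (cotLift E z) (chartVel (cotModel n) (cotLift E) z U)
          (chartVel (cotModel n) (cotLift E) z V) = pullForm σ E 0 U.1 V.1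
            + pullForm σ E 0 ((pullForm σ E 0).inverse U.2) ((pullForm σ E 0).inverse V.2) := by
      rintro ⟨x, w⟩ ⟨a, c⟩ ⟨a', c'⟩
      obtain ⟨s, rfl⟩ : ∃ s, pullForm σ E x s = c :=
        ⟨_, apply_inverse_apply (pullForm_isInvertible (h x)) c⟩
      obtain ⟨s', rfl⟩ : ∃ s, pullForm σ E x s = c' :=
        ⟨_, apply_inverse_apply (pullForm_isInvertible (h x)) c'⟩
      rw [chartVel_cotLift_pullForm h, chartVel_cotLift_pullForm h,
        formAt_liftedMetric_ofHorizVert, pullForm_constant h 0 x]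
      dsimp only
      rw [inverse_apply_apply (pullForm_isInvertible (h x)),
        inverse_apply_apply (pullForm_isInvertible (h x))]
      rfl
    rw [key, key]
  · obtain ⟨x, w⟩ := y
    rw [injective_iff_map_eq_zero]
    rintro ⟨a, c⟩ hac
    rw [chartVel_cotLift h] at hac
    have ha : a = 0 := (h x).injective ((congrArg Prod.fst hac).trans (map_zero _).symm)
    have hc := congrArg Prod.snd hac
    subst ha
    refine Prod.ext rfl ?_
    ext v
    have := congrArg (fun A : Eu n →L[ℝ] ℝ => A (chartVel (𝓡 n) E x v)) hc
    have e1 : (chartVel (𝓡 n) E x).inverse (chartVel (𝓡 n) E x v) = v :=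
      inverse_apply_apply (chartVel_isInvertible (h x)) v
    simpa [e1] using this

end Cotangent

/-! ### The exponential map of the lifted metric -/

section LiftedExponential

open Filter Topology Set

variable {F : Type*} [NormedAddCommGroup F] [NormedSpace ℝ F] [FiniteDimensional ℝ F]
  {H : Type*} [TopologicalSpace H] {I : ModelWithCorners ℝ F H} [I.Boundaryless]
  {M : Type*} [TopologicalSpace M] [ChartedSpace H M] [IsManifold I ∞ M]
  {g : ∀ x : M, TangentSpace I x →L[ℝ] TangentSpace I x →L[ℝ] ℝ}

/-- A map that is flat everywhere carries lines to geodesics that are defined for all times. -/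
theorem isGeodesicFrom_line (hg : IsMetric I g) {ψ : F → M} (h : ∀ y, FlatAt g ψ y) {x : M} {z : F}
    (hz : ψ z = x) (v : F) :
    IsGeodesicFrom I g x v fun s => ψ (z + s • (chartVel I ψ z).inverse v) := by
  subst hz
  have e0 : z + (0 : ℝ) • (chartVel I ψ z).inverse v = z := by rw [zero_smul, add_zero]
  refine ⟨isGeodesic_iff.2 fun t => FlatAt.geodAt_line hg (h _), congrArg ψ e0, ?_⟩
  have h1 := FlatAt.hasDerivAt_chart_line (x₀ := ψ z) (p := z) (a := (chartVel I ψ z).inverse v)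
    (t := 0) (h _) (by rw [e0]; exact mem_chart_source H _)
  rw [e0] at h1
  have h2 : chartVel I ψ z ((chartVel I ψ z).inverse v) = v :=
    apply_inverse_apply (isInvertible_of_injective (h z).injective) v
  exact h1.congr_deriv h2

variable {n : ℕ} {Q : Type*} [TopologicalSpace Q] [ChartedSpace (Eu n) Q]
  [IsManifold (𝓡 n) ∞ Q] {σ : SmoothMetric n Q}

/-- The lift to cotangent bundles of the exponential map of `Q` at `π(m)`. -/
def cotDev (σ : SmoothMetric n Q) (m : Cotangent n Q) : Eu n × (Eu n →L[ℝ] ℝ) → Cotangent n Q :=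
  cotLift (modelExp σ.inner m.1)

variable [T2Space Q]

theorem flatAt_modelExp_inner (hflat : IsFlat (𝓡 n) σ.inner)
    (hcomp : GeodesicallyComplete (𝓡 n) σ.inner) (q : Q) (x : Eu n) :
    FlatAt (I := 𝓡 n) σ.inner (modelExp σ.inner q) x :=
  flatAt_modelExp (isMetric_inner σ) (locallyFlat_of_isFlat σ hflat) hcomp q x

theorem flatAt_cotDev (hflat : IsFlat (𝓡 n) σ.inner)
    (hcomp : GeodesicallyComplete (𝓡 n) σ.inner) (m : Cotangent n Q)
    (y : Eu n × (Eu n →L[ℝ] ℝ)) : FlatAt (I := cotModel n) (liftedMetric σ) (cotDev σ m) y :=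
  flatAt_cotLift (flatAt_modelExp_inner hflat hcomp m.1) y

theorem cotDev_zero (hflat : IsFlat (𝓡 n) σ.inner)
    (hcomp : GeodesicallyComplete (𝓡 n) σ.inner) (m : Cotangent n Q) :
    cotDev σ m (0, momentum m) = m := by
  obtain ⟨-, h1, h2⟩ := flatAt_modelExp_zero (isMetric_inner σ) (locallyFlat_of_isFlat σ hflat)
    hcomp m.1
  change cotMk (modelExp σ.inner m.1 0)
    (momentum m ∘L (chartVel (𝓡 n) (modelExp σ.inner m.1) 0).inverse) = m
  rw [h1, h2, ContinuousLinearMap.inverse_id]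
  rfl

theorem locallyFlat_liftedMetric (hflat : IsFlat (𝓡 n) σ.inner)
    (hcomp : GeodesicallyComplete (𝓡 n) σ.inner) :
    LocallyFlat (I := cotModel n) (liftedMetric σ) := fun m =>
  ⟨cotDev σ m, (0, momentum m), flatAt_cotDev hflat hcomp m _, cotDev_zero hflat hcomp m⟩

theorem geodesicallyComplete_liftedMetric (hflat : IsFlat (𝓡 n) σ.inner)
    (hcomp : GeodesicallyComplete (𝓡 n) σ.inner) :
    GeodesicallyComplete (cotModel n) (liftedMetric σ) := fun m V =>
  ⟨_, isGeodesicFrom_line (isMetric_liftedMetric σ) (flatAt_cotDev hflat hcomp m)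
    (cotDev_zero hflat hcomp m) V⟩

theorem pullForm_modelExp (hflat : IsFlat (𝓡 n) σ.inner)
    (hcomp : GeodesicallyComplete (𝓡 n) σ.inner) (q : Q) (x : Eu n) :
    pullForm σ (modelExp σ.inner q) x = musicalFlat σ q := by
  rw [pullForm_constant (flatAt_modelExp_inner hflat hcomp q) x 0]
  obtain ⟨-, h1, h2⟩ := flatAt_modelExp_zero (isMetric_inner σ) (locallyFlat_of_isFlat σ hflat)
    hcomp q
  unfold pullForm
  rw [h1, h2]
  rfl

/-- The exponential map of the lifted metric, in horizontal and vertical components. -/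
theorem phaseExp_ofHorizVert (hflat : IsFlat (𝓡 n) σ.inner)
    (hcomp : GeodesicallyComplete (𝓡 n) σ.inner) (m : Cotangent n Q) (a c : Eu n) :
    phaseExp σ m (ofHorizVert σ m a c) = cotDev σ m (a, momentum m + musicalFlat σ m.1 c) := by
  have h1 := isGeodesicFrom_line (isMetric_liftedMetric σ) (flatAt_cotDev hflat hcomp m)
    (cotDev_zero hflat hcomp m) (ofHorizVert σ m a c)
  have h2 := expMap_eq (isMetric_liftedMetric σ) (locallyFlat_liftedMetric hflat hcomp) h1
  refine h2.trans (congrArg (cotDev σ m) ?_)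
  obtain ⟨-, -, h3⟩ := flatAt_modelExp_zero (isMetric_inner σ) (locallyFlat_of_isFlat σ hflat)
    hcomp m.1
  have h4 := chartVel_cotLift_pullForm (flatAt_modelExp_inner hflat hcomp m.1) 0 (momentum m) a c
  rw [pullForm_modelExp hflat hcomp, h3] at h4
  have h5 : chartVel (cotModel n) (cotDev σ m) (0, momentum m) (a, musicalFlat σ m.1 c)
      = ofHorizVert σ m a c := h4.trans
    (congrArg (fun m => (ofHorizVert σ m a c : Eu n × (Eu n →L[ℝ] ℝ))) (cotDev_zero hflat hcomp m))
  have h6 : (chartVel (cotModel n) (cotDev σ m) (0, momentum m)).inverse (ofHorizVert σ m a c)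
      = (a, musicalFlat σ m.1 c) := by
    have e : (ofHorizVert σ m a c : Eu n × (Eu n →L[ℝ] ℝ)) = _ := h5.symm
    rw [e]
    exact inverse_apply_apply
      (isInvertible_of_injective (flatAt_cotDev hflat hcomp m _).injective) _
  change (0, momentum m) + (1 : ℝ) • (chartVel (cotModel n) (cotDev σ m) (0, momentum m)).inverse
    (ofHorizVert σ m a c) = _
  rw [h6]
  simp

end LiftedExponential

/-! ### Complex coordinates -/

section ComplexCoordinates

variable {n : ℕ} {V : Type*} [NormedAddCommGroup V] [NormedSpace ℝ V]
  (b : Module.Basis (Fin n) ℝ V)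

/-- The real part `∑ Re(z^i) b_i` of the complex vector `∑ z^i b_i`. -/
def reVec : (Fin n → ℂ) →L[ℝ] V :=
  ∑ i, (Complex.reCLM ∘L
    ContinuousLinearMap.proj (R := ℝ) (φ := fun _ : Fin n => ℂ) i).smulRight (b i)

/-- The imaginary part `∑ Im(z^i) b_i` of the complex vector `∑ z^i b_i`. -/
def imVec : (Fin n → ℂ) →L[ℝ] V :=
  ∑ i, (Complex.imCLM ∘L
    ContinuousLinearMap.proj (R := ℝ) (φ := fun _ : Fin n => ℂ) i).smulRight (b i)

theorem reVec_apply (z : Fin n → ℂ) : reVec b z = ∑ i, (z i).re • b i := by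
  simp [reVec]

theorem imVec_apply (z : Fin n → ℂ) : imVec b z = ∑ i, (z i).im • b i := by
  simp [imVec]

theorem reVec_I_smul (z : Fin n → ℂ) : reVec b (Complex.I • z) = -imVec b z := by
  simp [reVec_apply, imVec_apply]

theorem imVec_I_smul (z : Fin n → ℂ) : imVec b (Complex.I • z) = reVec b z := by
  simp [reVec_apply, imVec_apply]

/-- The complex coordinates of `a + i c`. -/
def complexCoords [FiniteDimensional ℝ V] : V × V →L[ℝ] (Fin n → ℂ) :=
  ContinuousLinearMap.pi fun i =>
    Complex.ofRealCLM ∘L LinearMap.toContinuousLinearMap (b.coord i) ∘L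
        ContinuousLinearMap.fst ℝ V V +
      Complex.I • (Complex.ofRealCLM ∘L LinearMap.toContinuousLinearMap (b.coord i) ∘L
        ContinuousLinearMap.snd ℝ V V)

variable [FiniteDimensional ℝ V]

theorem complexCoords_apply (a c : V) (i : Fin n) :
    complexCoords b (a, c) i = b.repr a i + Complex.I * b.repr c i := rfl

theorem reVec_complexCoords (a c : V) : reVec b (complexCoords b (a, c)) = a := by
  simp [reVec_apply, complexCoords_apply, b.sum_repr]

theorem imVec_complexCoords (a c : V) : imVec b (complexCoords b (a, c)) = c := by
  simp [imVec_apply, complexCoords_apply, b.sum_repr]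

end ComplexCoordinates

/-! ### Holomorphic functions and their pull-backs -/

section Holomorphic

open Filter Topology Set

theorem hasMFDerivAt_chartVel {F : Type*} [NormedAddCommGroup F] [NormedSpace ℝ F]
    {F' : Type*} [NormedAddCommGroup F'] [NormedSpace ℝ F']
    {H : Type*} [TopologicalSpace H] {I : ModelWithCorners ℝ F H}
    {M : Type*} [TopologicalSpace M] [ChartedSpace H M] {ψ : F' → M} {y : F'}
    (h : MDifferentiableAt 𝓘(ℝ, F') I ψ y) :
    HasMFDerivAt 𝓘(ℝ, F') I ψ y (chartVel I ψ y : F' →L[ℝ] F) := by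
  have h1 := h.differentiableWithinAt_writtenInExtChartAt
  have h2 : DifferentiableAt ℝ (fun z => extChartAt I (ψ y) (ψ z)) y := by
    simpa only [writtenInExtChartAt, chartAt_self_eq, mfld_simps, differentiableWithinAt_univ,
      Function.comp_def] using h1
  refine ⟨h.continuousAt, ?_⟩
  have h3 : HasFDerivAt (fun z => extChartAt I (ψ y) (ψ z)) (chartVel I ψ y) y :=
    h2.hasFDerivAt
  change HasFDerivWithinAt (writtenInExtChartAt 𝓘(ℝ, F') I y ψ) (chartVel I ψ y)
    (range 𝓘(ℝ, F')) (extChartAt 𝓘(ℝ, F') y y)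
  simpa only [writtenInExtChartAt, chartAt_self_eq, mfld_simps, hasFDerivWithinAt_univ,
    Function.comp_def] using h3

/-- `ofHorizVert` exhausts the tangent space. -/
theorem exists_ofHorizVert {n : ℕ} {Q : Type*} [TopologicalSpace Q] [ChartedSpace (Eu n) Q]
    [IsManifold (𝓡 n) ∞ Q] (σ : SmoothMetric n Q) (m : Cotangent n Q)
    (V : TangentSpace (cotModel n) m) : ∃ a c : Eu n, ofHorizVert σ m a c = V := by
  refine ⟨(V : Eu n × (Eu n →L[ℝ] ℝ)).1, musicalSharp σ m.1 (covariantVelocity σ m V), ?_⟩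
  have h : musicalFlat σ m.1 (musicalSharp σ m.1 (covariantVelocity σ m V))
      = covariantVelocity σ m V := musicalFlat_musicalSharp σ m.1 _
  refine Prod.ext rfl ?_
  change musicalFlat σ m.1 (musicalSharp σ m.1 (covariantVelocity σ m V)) + _ = _
  rw [h]
  exact sub_add_cancel _ _

variable {n : ℕ} {Q : Type*} [TopologicalSpace Q] [ChartedSpace (Eu n) Q]
  [IsManifold (𝓡 n) ∞ Q] {σ : SmoothMetric n Q} [T2Space Q]

/-- In complex coordinates, the exponential map of the lifted metric is the lift of the exponential
map of `Q`, composed with a real affine isomorphism. -/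
theorem pullback_eq (hflat : IsFlat (𝓡 n) σ.inner)
    (hcomp : GeodesicallyComplete (𝓡 n) σ.inner) (m : Cotangent n Q)
    (b : Module.Basis (Fin n) ℝ (Eu n)) (φ : Cotangent n Q → ℂ) (z : Fin n → ℂ) :
    pullback σ m b φ z
      = φ (cotDev σ m (reVec b z, momentum m + musicalFlat σ m.1 (imVec b z))) := by
  refine congrArg φ (Eq.trans ?_ (phaseExp_ofHorizVert hflat hcomp m (reVec b z) (imVec b z)))
  rw [reVec_apply, imVec_apply]
  rfl

/-- The real derivative of the pull-back of `φ`: the derivative of the exponential map takes the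
complex vector `∑ ζ^i b_i` to its image under the derivative of the exponential map of `Q`, applied
to real and imaginary part. -/
theorem exists_hasFDerivAt_pullback (hflat : IsFlat (𝓡 n) σ.inner)
    (hcomp : GeodesicallyComplete (𝓡 n) σ.inner) (m : Cotangent n Q)
    (b : Module.Basis (Fin n) ℝ (Eu n)) (φ : Cotangent n Q → ℂ) (z : Fin n → ℂ)
    {m' : Cotangent n Q}
    (hm' : cotDev σ m (reVec b z, momentum m + musicalFlat σ m.1 (imVec b z)) = m')
    (hφ : MDifferentiableAt (cotModel n) 𝓘(ℝ, ℂ) φ m') :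
    ∃ L : (Fin n → ℂ) →L[ℝ] ℂ, HasFDerivAt (pullback σ m b φ) L z ∧
      ∀ ζ, L ζ = differential φ m' (ofHorizVert σ m'
        (chartVel (𝓡 n) (modelExp σ.inner m.1) (reVec b z) (reVec b ζ))
        (chartVel (𝓡 n) (modelExp σ.inner m.1) (reVec b z) (imVec b ζ))) := by
  subst hm'
  set y := (reVec b z, momentum m + musicalFlat σ m.1 (imVec b z)) with hy
  have h1 := hasMFDerivAt_chartVel
    ((flatAt_cotDev hflat hcomp m y).smooth.self_of_nhds.mdifferentiableAt (by simp))
  have h2 := (HasMFDerivAt.comp y hφ.hasMFDerivAt h1).hasFDerivAt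
  have h3 : HasFDerivAt (fun z => (reVec b z, momentum m + musicalFlat σ m.1 (imVec b z)))
      ((reVec b).prod (musicalFlat σ m.1 ∘L imVec b)) z :=
    (reVec b).hasFDerivAt.prodMk ((musicalFlat σ m.1 ∘L imVec b).hasFDerivAt.const_add _)
  refine ⟨_, (HasFDerivAt.comp z h2 h3).congr_of_eventuallyEq (.of_forall fun z => ?_), fun ζ => ?_⟩
  · exact pullback_eq hflat hcomp m b φ z
  · have h4 := chartVel_cotLift_pullForm (flatAt_modelExp_inner hflat hcomp m.1) (reVec b z)
      (momentum m + musicalFlat σ m.1 (imVec b z)) (reVec b ζ) (imVec b ζ)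
    rw [pullForm_modelExp hflat hcomp] at h4
    exact congrArg (differential φ (cotDev σ m y)) h4

/-- The pull-back of a holomorphic function is entire. -/
theorem IsHolomorphic.differentiable_pullback (hflat : IsFlat (𝓡 n) σ.inner)
    (hcomp : GeodesicallyComplete (𝓡 n) σ.inner) (m : Cotangent n Q)
    (b : Module.Basis (Fin n) ℝ (Eu n)) {φ : Cotangent n Q → ℂ} (hφ : IsHolomorphic σ φ) :
    Differentiable ℂ (pullback σ m b φ) := by
  intro z
  obtain ⟨L, hL, h⟩ := exists_hasFDerivAt_pullback hflat hcomp m b φ z rfl (hφ.1 _)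
  have hI : ∀ ζ, L (Complex.I • ζ) = Complex.I * L ζ := fun ζ => by
    rw [h, h, ← hφ.2, almostComplex_ofHorizVert, reVec_I_smul, imVec_I_smul, map_neg]
  have hC : ∀ (c : ℂ) ζ, L (c • ζ) = c * L ζ := fun c ζ => by
    have e : c • ζ = c.re • ζ + c.im • (Complex.I • ζ) := by
      ext i
      simp only [Pi.smul_apply, Pi.add_apply, smul_eq_mul, Complex.real_smul]
      conv_lhs => rw [← Complex.re_add_im c]
      ring
    rw [e, map_add, map_smul, map_smul, hI, Complex.real_smul, Complex.real_smul]
    conv_rhs => rw [← Complex.re_add_im c]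
    ring
  refine (differentiableAt_iff_restrictScalars ℝ hL.differentiableAt).2 ⟨⟨⟨L, ?_⟩, L.cont⟩, ?_⟩
  · exact hC
  · rw [hL.fderiv]
    rfl

/-- If the exponential map is surjective, then a function on `T*Q` with entire pull-back is
holomorphic: the exponential map has smooth local inverses, and its derivative is complex linear. -/
theorem isHolomorphic_of_differentiable_pullback (hflat : IsFlat (𝓡 n) σ.inner)
    (hcomp : GeodesicallyComplete (𝓡 n) σ.inner) (m : Cotangent n Q)
    (b : Module.Basis (Fin n) ℝ (Eu n)) (hsurj : Function.Surjective (phaseExp σ m))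
    {φ : Cotangent n Q → ℂ} (hφ : Differentiable ℂ (pullback σ m b φ)) : IsHolomorphic σ φ := by
  -- in the coordinates `(x, w)` of the developing map, `φ` is the entire function in other
  -- linear coordinates
  have hdev : ∀ y, φ (cotDev σ m y) = pullback σ m b φ
      (complexCoords b (y.1, musicalSharp σ m.1 (y.2 - momentum m))) := fun y => by
    rw [pullback_eq hflat hcomp, reVec_complexCoords, imVec_complexCoords,
      musicalFlat_musicalSharp, add_sub_cancel]
  have hdiff : Differentiable ℝ fun y => φ (cotDev σ m y) := by
    have : Differentiable ℝ fun y : Eu n × (Eu n →L[ℝ] ℝ) =>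
        complexCoords b (y.1, musicalSharp σ m.1 (y.2 - momentum m)) :=
      (complexCoords b).differentiable.comp (differentiable_fst.prodMk
        ((musicalSharp σ m.1).differentiable.comp (differentiable_snd.sub_const _)))
    rw [funext hdev]
    exact (hφ.restrictScalars ℝ).comp this
  have hex : ∀ m' : Cotangent n Q, ∃ z,
      cotDev σ m (reVec b z, momentum m + musicalFlat σ m.1 (imVec b z)) = m' := fun m' => by
    obtain ⟨V, rfl⟩ := hsurj m'
    obtain ⟨a, c, rfl⟩ := exists_ofHorizVert σ m V
    refine ⟨complexCoords b (a, c), ?_⟩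
    rw [phaseExp_ofHorizVert hflat hcomp, reVec_complexCoords, imVec_complexCoords]
  have hmd : MDifferentiable (cotModel n) 𝓘(ℝ, ℂ) φ := by
    intro m'
    obtain ⟨z, rfl⟩ := hex m'
    set y := (reVec b z, momentum m + musicalFlat σ m.1 (imVec b z))
    set m' := cotDev σ m y with hm'
    have hF := flatAt_cotDev hflat hcomp m y
    obtain ⟨χ, h1, h2, -, h3⟩ := hF.exists_chart_inverse (mem_chart_source _ m')
    have h4 : MDifferentiableAt (cotModel n) 𝓘(ℝ, Eu n × (Eu n →L[ℝ] ℝ))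
        (fun p => χ (extChartAt (cotModel n) m' p)) m' :=
      MDifferentiableAt.comp m' (h1.differentiableAt (by simp)).mdifferentiableAt
        ((contMDiffAt_extChartAt (n := ∞)).mdifferentiableAt (by simp))
    have h5 : MDifferentiableAt (cotModel n) 𝓘(ℝ, ℂ)
        (fun p => φ (cotDev σ m (χ (extChartAt (cotModel n) m' p)))) m' :=
      MDifferentiableAt.comp m' (g := fun y => φ (cotDev σ m y)) (hdiff _).mdifferentiableAt h4
    refine h5.congr_of_eventuallyEq ?_
    have hc : ContinuousAt (fun p => cotDev σ m (χ (extChartAt (cotModel n) m' p))) m' := by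
      refine ContinuousAt.comp (g := cotDev σ m) ?_ h4.continuousAt
      rw [hm', h2]
      exact hF.continuousAt
    have hv : cotDev σ m (χ (extChartAt (cotModel n) m' m')) = m' := by rw [hm', h2]
    have h6 := hc.eventually ((chartAt (ModelProd (Eu n) (Eu n →L[ℝ] ℝ)) m').open_source.mem_nhds
      (show cotDev σ m (χ (extChartAt (cotModel n) m' m')) ∈ _ by
        rw [hv]; exact mem_chart_source _ m'))
    filter_upwards [h6, (continuousAt_extChartAt m').eventually h3,
      (chartAt (ModelProd (Eu n) (Eu n →L[ℝ] ℝ)) m').open_source.mem_nhds (mem_chart_source _ m')]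
      with p hp hp' hp''
    refine congrArg φ ((extChartAt (cotModel n) m').injOn ?_ ?_ hp').symm <;>
      rwa [extChartAt_source]
  refine ⟨hmd, fun m' V => ?_⟩
  obtain ⟨z, hz⟩ := hex m'
  obtain ⟨L, hL, h⟩ := exists_hasFDerivAt_pullback hflat hcomp m b φ z hz (hmd m')
  obtain ⟨a, c, rfl⟩ := exists_ofHorizVert σ m' V
  have hinv := chartVel_isInvertible (flatAt_modelExp_inner hflat hcomp m.1 (reVec b z))
  obtain ⟨u, rfl⟩ : ∃ u, chartVel (𝓡 n) (modelExp σ.inner m.1) (reVec b z) u = a :=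
    ⟨_, apply_inverse_apply hinv a⟩
  obtain ⟨v, rfl⟩ : ∃ u, chartVel (𝓡 n) (modelExp σ.inner m.1) (reVec b z) u = c :=
    ⟨_, apply_inverse_apply hinv c⟩
  have h1 := h (complexCoords b (u, v))
  have h2 := h (Complex.I • complexCoords b (u, v))
  rw [reVec_complexCoords, imVec_complexCoords] at h1
  rw [reVec_I_smul, imVec_I_smul, reVec_complexCoords, imVec_complexCoords, map_neg] at h2
  have h3 : L = (fderiv ℂ (pullback σ m b φ) z).restrictScalars ℝ :=
    hL.unique ((hφ z).hasFDerivAt.restrictScalars ℝ)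
  rw [almostComplex_ofHorizVert, ← h1, ← h2, h3]
  exact map_smul (fderiv ℂ (pullback σ m b φ) z) _ _

end Holomorphic

/-! ### The mean value inequality for entire functions -/

section MeanValue

open Filter Topology Set
open scoped ENNReal NNReal

variable {n : ℕ} {f : (Fin n → ℂ) → ℂ}

theorem measurePreserving_unit_smul (c : Circle) :
    MeasurePreserving (fun ζ : Fin n → ℂ => (c : ℂ) • ζ) := by
  have h : MeasurePreserving (fun w : ℂ => (c : ℂ) * w) :=
    LinearIsometryEquiv.measurePreserving (rotation c)
  exact volume_preserving_pi fun _ => h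

theorem enorm_le_lintegral_circle (hf : Differentiable ℂ f) (z ζ : Fin n → ℂ) :
    ‖f z‖ₑ ≤ ENNReal.ofReal (2 * Real.pi)⁻¹ *
      ∫⁻ θ in Ioc 0 (2 * Real.pi), ‖f (z + circleMap 0 1 θ • ζ)‖ₑ := by
  have hg : Differentiable ℂ fun w : ℂ => f (z + w • ζ) := by fun_prop
  have h1 := DiffContOnCl.circleAverage (c := 0) (R := 1) hg.diffContOnCl
  rw [Real.circleAverage_def, intervalIntegral.integral_of_le Real.two_pi_pos.le] at h1
  have h2 : f z = (2 * Real.pi)⁻¹ • ∫ θ in Ioc 0 (2 * Real.pi), f (z + circleMap 0 1 θ • ζ) := by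
    simpa using h1.symm
  rw [h2, enorm_smul]
  gcongr
  · rw [Real.enorm_eq_ofReal (by positivity)]
  · exact enorm_integral_le_lintegral_enorm _

/-- Sub-mean value property of `|f|` on a polydisc: average over circles, then use that
multiplication by a unit complex number preserves the polydisc and Lebesgue measure. -/
theorem enorm_mul_volume_le (hf : Differentiable ℂ f) (z : Fin n → ℂ) (R : ℝ) :
    ‖f z‖ₑ * volume (Metric.ball (0 : Fin n → ℂ) R)
      ≤ ∫⁻ ζ in Metric.ball (0 : Fin n → ℂ) R, ‖f (z + ζ)‖ₑ := by
  set B := Metric.ball (0 : Fin n → ℂ) R with hB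
  have hrot : ∀ θ, ∫⁻ ζ in B, ‖f (z + circleMap 0 1 θ • ζ)‖ₑ = ∫⁻ ζ in B, ‖f (z + ζ)‖ₑ := by
    intro θ
    have h1 := (measurePreserving_unit_smul (n := n) (Circle.exp θ)).setLIntegral_comp_preimage
      (s := B) Metric.isOpen_ball.measurableSet (f := fun ζ => ‖f (z + ζ)‖ₑ)
      (by have := hf.continuous; exact Continuous.measurable (by fun_prop))
    have h2 : (fun ζ : Fin n → ℂ => (Circle.exp θ : ℂ) • ζ) ⁻¹' B = B := by
      ext ζ
      simp [hB, norm_smul]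
    rw [h2] at h1
    rw [← h1]
    simp [circleMap, Circle.coe_exp]
  calc ‖f z‖ₑ * volume B = ∫⁻ _ in B, ‖f z‖ₑ := by rw [setLIntegral_const]
    _ ≤ ∫⁻ ζ in B, ENNReal.ofReal (2 * Real.pi)⁻¹ *
        ∫⁻ θ in Ioc 0 (2 * Real.pi), ‖f (z + circleMap 0 1 θ • ζ)‖ₑ :=
      lintegral_mono fun ζ => enorm_le_lintegral_circle hf z ζ
    _ = ENNReal.ofReal (2 * Real.pi)⁻¹ *
        ∫⁻ ζ in B, ∫⁻ θ in Ioc 0 (2 * Real.pi), ‖f (z + circleMap 0 1 θ • ζ)‖ₑ :=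
      lintegral_const_mul' _ _ ENNReal.ofReal_ne_top
    _ = ENNReal.ofReal (2 * Real.pi)⁻¹ *
        ∫⁻ θ in Ioc 0 (2 * Real.pi), ∫⁻ ζ in B, ‖f (z + circleMap 0 1 θ • ζ)‖ₑ := by
      rw [lintegral_lintegral_swap]
      have := hf.continuous
      exact (Continuous.measurable (by fun_prop)).aemeasurable
    _ = ∫⁻ ζ in B, ‖f (z + ζ)‖ₑ := by
      simp_rw [hrot]
      rw [setLIntegral_const, Real.volume_Ioc, sub_zero, mul_comm _ (ENNReal.ofReal _), ← mul_assoc,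
        ← ENNReal.ofReal_mul (by positivity), inv_mul_cancel₀ (by positivity), ENNReal.ofReal_one,
        one_mul]

end MeanValue

/-! ### Entire functions and the Gaussian measure -/

section Gaussian

open Filter Topology Set
open scoped ENNReal NNReal

variable {n : ℕ} (S : Matrix (Fin n) (Fin n) ℝ)

theorem continuous_absSq : Continuous (absSq S) := by
  unfold absSq
  fun_prop

theorem measurable_gaussianDensity :
    Measurable fun z => ENNReal.ofReal (Real.exp (-absSq S z)) := by
  have := (continuous_absSq S).measurable
  fun_prop

theorem volume_absolutelyContinuous_gaussian :
    (volume : Measure (Fin n → ℂ)) ≪ gaussian S :=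
  withDensity_absolutelyContinuous' (measurable_gaussianDensity S).aemeasurable
    (.of_forall fun _ => (ENNReal.ofReal_pos.2 (Real.exp_pos _)).ne')

instance : (gaussian S).IsOpenPosMeasure :=
  (volume_absolutelyContinuous_gaussian S).isOpenPosMeasure

theorem integral_gaussian (g : (Fin n → ℂ) → ℂ) :
    ∫ z, g z ∂gaussian S = ∫ z, g z * (Real.exp (-absSq S z) : ℂ) := by
  rw [gaussian, integral_withDensity_eq_integral_toReal_smul (measurable_gaussianDensity S)
    (.of_forall fun _ => ENNReal.ofReal_lt_top)]
  refine integral_congr_ae (.of_forall fun z => ?_)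
  dsimp only
  rw [ENNReal.toReal_ofReal (Real.exp_pos _).le, Complex.real_smul, mul_comm]

/-- On a bounded set, Lebesgue measure is bounded by a multiple of the Gaussian measure. -/
theorem exists_volume_restrict_le (R : ℝ) : ∃ C : ℝ≥0∞, C ≠ ⊤ ∧
    (volume : Measure (Fin n → ℂ)).restrict (Metric.ball 0 R) ≤ C • gaussian S := by
  obtain ⟨K, hK⟩ := (isCompact_closedBall (0 : Fin n → ℂ) R).bddAbove_image
    (continuous_absSq S).continuousOn
  refine ⟨ENNReal.ofReal (Real.exp K), ENNReal.ofReal_ne_top, Measure.le_iff.2 fun s hs => ?_⟩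
  rw [Measure.smul_apply, smul_eq_mul, gaussian, withDensity_apply _ hs,
    ← lintegral_const_mul' _ _ ENNReal.ofReal_ne_top, Measure.restrict_apply hs]
  calc volume (s ∩ Metric.ball 0 R) = ∫⁻ _ in s ∩ Metric.ball (0 : Fin n → ℂ) R, 1 := by simp
    _ ≤ ∫⁻ z in s ∩ Metric.ball (0 : Fin n → ℂ) R, ENNReal.ofReal (Real.exp K) *
        ENNReal.ofReal (Real.exp (-absSq S z)) := by
      refine setLIntegral_mono' (hs.inter Metric.isOpen_ball.measurableSet) fun z hz => ?_
      rw [← ENNReal.ofReal_mul (Real.exp_pos _).le, ← Real.exp_add, ENNReal.one_le_ofReal,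
        Real.one_le_exp_iff]
      have := hK (mem_image_of_mem _ (Metric.ball_subset_closedBall hz.2))
      linarith
    _ ≤ _ := lintegral_mono_set inter_subset_left

/-- Evaluation of entire functions is locally uniformly bounded in the Gaussian `L²`-norm. -/
theorem exists_enorm_le_eLpNorm (R : ℝ) : ∃ C : ℝ≥0∞, C ≠ ⊤ ∧ ∀ f : (Fin n → ℂ) → ℂ,
    Differentiable ℂ f → ∀ z ∈ Metric.ball (0 : Fin n → ℂ) R,
      ‖f z‖ₑ ≤ C * eLpNorm f 2 (gaussian S) := by
  -- unit polydiscs around points of the ball of radius `R` lie in the ball of radius `R + 1`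
  obtain ⟨C, hC, hle⟩ := exists_volume_restrict_le S (R + 1)
  set B₁ := Metric.ball (0 : Fin n → ℂ) 1 with hB₁
  set B := Metric.ball (0 : Fin n → ℂ) (R + 1) with hB
  have hv0 : volume B₁ ≠ 0 := (Metric.measure_ball_pos _ _ one_pos).ne'
  have hv : volume B₁ ≠ ⊤ := measure_ball_lt_top.ne
  have hvB : volume B ≠ ⊤ := measure_ball_lt_top.ne
  refine ⟨(volume B₁)⁻¹ * (C ^ (1 / 2 : ℝ) * volume B ^ (1 / 2 : ℝ)),
    ENNReal.mul_ne_top (ENNReal.inv_ne_top.2 hv0) (ENNReal.mul_ne_top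
      (ENNReal.rpow_ne_top_of_nonneg (by norm_num) hC)
      (ENNReal.rpow_ne_top_of_nonneg (by norm_num) hvB)), fun f hf z hz => ?_⟩
  have h1 : ‖f z‖ₑ * volume B₁ ≤ ∫⁻ ζ in B, ‖f ζ‖ₑ := by
    refine (enorm_mul_volume_le hf z 1).trans ?_
    have h2 := (measurePreserving_add_left volume z).setLIntegral_comp_preimage
      (s := Metric.ball z 1) Metric.isOpen_ball.measurableSet (f := fun ζ => ‖f ζ‖ₑ)
      (by have := hf.continuous; exact Continuous.measurable (by fun_prop))
    have h3 : (fun ζ => z + ζ) ⁻¹' Metric.ball z 1 = B₁ := by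
      ext ζ
      simp [hB₁, dist_eq_norm]
    rw [h3] at h2
    rw [h2]
    refine lintegral_mono_set (Metric.ball_subset_ball' ?_)
    have : dist z 0 < R := hz
    linarith
  have h2 : ∫⁻ ζ in B, ‖f ζ‖ₑ
      ≤ C ^ (1 / 2 : ℝ) * eLpNorm f 2 (gaussian S) * volume B ^ (1 / 2 : ℝ) := by
    rw [← eLpNorm_one_eq_lintegral_enorm]
    refine (eLpNorm_le_eLpNorm_mul_rpow_measure_univ (q := 2) (by norm_num)
      hf.continuous.aestronglyMeasurable).trans ?_
    have e : (1 / (1 : ℝ≥0∞).toReal - 1 / (2 : ℝ≥0∞).toReal) = (1 / 2 : ℝ) := by norm_num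
    rw [e, Measure.restrict_apply_univ]
    gcongr
    refine (eLpNorm_mono_measure f hle).trans ?_
    rw [eLpNorm_smul_measure_of_ne_top (by norm_num)]
    simp
  calc ‖f z‖ₑ = (volume B₁)⁻¹ * (‖f z‖ₑ * volume B₁) := by
        rw [mul_comm ‖f z‖ₑ, ← mul_assoc, ENNReal.inv_mul_cancel hv0 hv, one_mul]
    _ ≤ (volume B₁)⁻¹ * (C ^ (1 / 2 : ℝ) * eLpNorm f 2 (gaussian S) * volume B ^ (1 / 2 : ℝ)) := by
        exact mul_le_mul' le_rfl (h1.trans h2)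
    _ = _ := by ring

end Gaussian

/-! ### Limits of entire functions -/

section EntireLimit

open Filter Topology Set

variable {n : ℕ}

/-- Cauchy's estimate on complex lines. -/
theorem norm_fderiv_le_of_forall_ball {g : (Fin n → ℂ) → ℂ} (hg : Differentiable ℂ g) {R C : ℝ}
    (hC : ∀ w ∈ Metric.ball (0 : Fin n → ℂ) (R + 1), ‖g w‖ ≤ C) {z : Fin n → ℂ}
    (hz : z ∈ Metric.ball (0 : Fin n → ℂ) R) : ‖fderiv ℂ g z‖ ≤ C := by
  have hz' : ‖z‖ < R := by simpa using hz
  have hC0 : 0 ≤ C := (norm_nonneg _).trans (hC z (Metric.ball_subset_ball (by linarith) hz))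
  refine ContinuousLinearMap.opNorm_le_bound _ hC0 fun v => ?_
  by_cases hv : v = 0
  · simp [hv]
  have hv' : 0 < ‖v‖ := norm_pos_iff.2 hv
  have h1 : HasDerivAt (fun t : ℂ => z + t • v) v 0 := by
    simpa using ((hasDerivAt_id (0 : ℂ)).smul_const v).const_add z
  have h2 : HasDerivAt (fun t : ℂ => g (z + t • v)) (fderiv ℂ g z v) 0 := by
    refine HasFDerivAt.comp_hasDerivAt (0 : ℂ) (f := fun t : ℂ => z + t • v) ?_ h1
    rw [zero_smul, add_zero]
    exact (hg z).hasFDerivAt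
  have hd : Differentiable ℂ fun t : ℂ => g (z + t • v) := by fun_prop
  have h3 := Complex.norm_deriv_le_of_forall_mem_sphere_norm_le (c := 0) (inv_pos.2 hv')
    hd.diffContOnCl (C := C) fun t ht => hC _ ?_
  · rwa [h2.deriv, div_inv_eq_mul] at h3
  · have ht' : ‖t‖ = ‖v‖⁻¹ := by simpa using ht
    have h4 : ‖z + t • v‖ ≤ ‖z‖ + 1 := (norm_add_le _ _).trans_eq (by
      rw [norm_smul, ht', inv_mul_cancel₀ hv'.ne'])
    rw [mem_ball_zero_iff]
    linarith

/-- A locally uniform limit of entire functions on `ℂⁿ` is entire: by Cauchy's estimate, the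
derivatives converge locally uniformly as well. -/
theorem exists_entire_limit {f : ℕ → (Fin n → ℂ) → ℂ} (hf : ∀ k, Differentiable ℂ (f k))
    (hc : ∀ R, UniformCauchySeqOn f atTop (Metric.ball 0 R)) :
    ∃ h : (Fin n → ℂ) → ℂ, Differentiable ℂ h ∧ ∀ z, Tendsto (fun k => f k z) atTop (𝓝 (h z)) := by
  have hmem : ∀ z : Fin n → ℂ, z ∈ Metric.ball (0 : Fin n → ℂ) (‖z‖ + 1) := fun z => by simp
  have hc' : ∀ R, UniformCauchySeqOn (fun k => fderiv ℂ (f k)) atTop (Metric.ball 0 R) := by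
    intro R
    rw [Metric.uniformCauchySeqOn_iff]
    intro ε hε
    obtain ⟨N, hN⟩ := Metric.uniformCauchySeqOn_iff.1 (hc (R + 1)) (ε / 2) (half_pos hε)
    refine ⟨N, fun k hk l hl z hz => ?_⟩
    rw [dist_eq_norm, ← fderiv_sub (hf k z) (hf l z)]
    refine (norm_fderiv_le_of_forall_ball ((hf k).sub (hf l)) (fun w hw => ?_) hz).trans_lt
      (half_lt_self hε)
    exact (dist_eq_norm (f k w) (f l w)).symm.trans_le (hN k hk l hl w hw).le
  choose h hh using fun z => cauchySeq_tendsto_of_complete ((hc (‖z‖ + 1)).cauchySeq (hmem z))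
  choose h' hh' using fun z => cauchySeq_tendsto_of_complete ((hc' (‖z‖ + 1)).cauchySeq (hmem z))
  refine ⟨h, fun z => ?_, hh⟩
  exact (hasFDerivAt_of_tendstoUniformlyOn Metric.isOpen_ball
    ((hc' (‖z‖ + 1)).tendstoUniformlyOn_of_tendsto fun w _ => hh' w)
    (fun k w _ => (hf k w).hasFDerivAt) (fun w _ => hh w) (hmem z)).differentiableAt

/-- A limit in `L²(ℂⁿ, e^{-|z|²})` of entire functions is represented by an entire function, which
is also their pointwise limit. -/
theorem exists_entire_limit_of_tendsto_toLp (S : Matrix (Fin n) (Fin n) ℝ)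
    {f : ℕ → (Fin n → ℂ) → ℂ} (hf : ∀ k, Differentiable ℂ (f k))
    (hm : ∀ k, MemLp (f k) 2 (gaussian S)) {F : Lp ℂ 2 (gaussian S)}
    (hF : Tendsto (fun k => (hm k).toLp (f k)) atTop (𝓝 F)) :
    ∃ h : (Fin n → ℂ) → ℂ, Differentiable ℂ h ∧ F =ᵐ[gaussian S] h ∧
      ∀ z, Tendsto (fun k => f k z) atTop (𝓝 (h z)) := by
  obtain ⟨h, hh, hlim⟩ := exists_entire_limit hf fun R => by
    obtain ⟨C, hC, hle⟩ := exists_enorm_le_eLpNorm S R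
    rw [Metric.uniformCauchySeqOn_iff]
    intro ε hε
    -- `C + 1` instead of `C`, which may be zero
    have hε' : 0 < ENNReal.ofReal ε / (C + 1) :=
      ENNReal.div_pos (ENNReal.ofReal_pos.2 hε).ne' (by finiteness)
    obtain ⟨N, hN⟩ := EMetric.cauchySeq_iff.1 hF.cauchySeq _ hε'
    refine ⟨N, fun k hk l hl z hz => ?_⟩
    have h1 := hN k hk l hl
    rw [Lp.edist_toLp_toLp] at h1
    rw [← edist_lt_ofReal, edist_eq_enorm_sub]
    calc ‖f k z - f l z‖ₑ ≤ C * eLpNorm (f k - f l) 2 (gaussian S) :=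
          hle _ ((hf k).sub (hf l)) z hz
      _ ≤ (C + 1) * eLpNorm (f k - f l) 2 (gaussian S) := by gcongr; exact le_self_add
      _ < ENNReal.ofReal ε := by
        rw [mul_comm]
        exact (ENNReal.lt_div_iff_mul_lt (by simp) (by simp [hC])).1 h1
  refine ⟨h, hh, ?_, hlim⟩
  obtain ⟨ns, hns, hae⟩ := (tendstoInMeasure_of_tendsto_Lp hF).exists_seq_tendsto_ae
  filter_upwards [hae, ae_all_iff.2 fun k => (hm k).coeFn_toLp] with z h1 h2
  refine tendsto_nhds_unique h1 (((hlim z).comp hns.tendsto_atTop).congr fun k => ?_)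
  exact (h2 (ns k)).symm

end EntireLimit

/-! ### The Hilbert space of square integrable holomorphic functions -/

section AbstractHilbert

open Filter Topology Set

/-- An injective linear map with closed range into a Hilbert space induces a Hilbert space structure
on its source. -/
theorem exists_core_of_injective {V H : Type*} [AddCommGroup V] [Module ℂ V]
    [NormedAddCommGroup H] [InnerProductSpace ℂ H] [CompleteSpace H] (P : V →ₗ[ℂ] H)
    (hP : Function.Injective P) (hcl : IsClosed (range P)) (W : Submodule ℂ H)
    (hW : ∀ v, P v ∈ W) :
    ∃ c : InnerProductSpace.Core ℂ V, (∀ v w, c.inner v w = inner ℂ (P v) (P w)) ∧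
      letI : NormedAddCommGroup V := c.toNormedAddCommGroup
      letI : InnerProductSpace ℂ V := InnerProductSpace.ofCore c.toCore
      CompleteSpace V ∧ ∃ T : V →ₗᵢ[ℂ] W, (∀ v, (T v : H) = P v) ∧ IsClosed (range T) := by
  let c : InnerProductSpace.Core ℂ V :=
    { inner := fun v w => inner ℂ (P v) (P w)
      conj_inner_symm := fun v w => inner_conj_symm _ _
      re_inner_nonneg := fun v => inner_self_nonneg
      add_left := fun u v w => by
        change inner ℂ (P (u + v)) (P w) = inner ℂ (P u) (P w) + inner ℂ (P v) (P w)
        rw [map_add, inner_add_left]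
      smul_left := fun u v r => by
        change inner ℂ (P (r • u)) (P v) = _ * inner ℂ (P u) (P v)
        rw [map_smul, inner_smul_left]
      definite := fun v hv => hP (by rw [inner_self_eq_zero.1 hv, map_zero]) }
  refine ⟨c, fun v w => rfl, ?_⟩
  let : NormedAddCommGroup V := c.toNormedAddCommGroup
  let : InnerProductSpace ℂ V := InnerProductSpace.ofCore c.toCore
  have hnorm : ∀ v : V, ‖P v‖ = ‖v‖ := fun v => norm_eq_sqrt_re_inner (𝕜 := ℂ) (P v)
  let T : V →ₗᵢ[ℂ] W := ⟨P.codRestrict W hW, hnorm⟩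
  have hT : ∀ v, (T v : H) = P v := fun v => rfl
  let T' : V →ₗᵢ[ℂ] H := ⟨P, hnorm⟩
  refine ⟨?_, T, hT, ?_⟩
  · exact (completeSpace_iff_isComplete_range T'.isometry.isUniformInducing).2 hcl.isComplete
  · have : range T = Subtype.val ⁻¹' range P := by
      ext w
      constructor
      · rintro ⟨v, rfl⟩
        exact ⟨v, rfl⟩
      · rintro ⟨v, hv⟩
        exact ⟨v, Subtype.ext hv⟩
    rw [this]
    exact hcl.preimage continuous_subtype_val

end AbstractHilbert

section Pullback

open Filter Topology Set

variable {n : ℕ} {Q : Type*} [TopologicalSpace Q] [ChartedSpace (Eu n) Q]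
  [IsManifold (𝓡 n) ∞ Q] (σ : SmoothMetric n Q) (m : Cotangent n Q)
  (b : Module.Basis (Fin n) ℝ (TangentSpace (𝓡 n) m.1))

/-- The map `φ ↦ φ ∘ exp_m` into `L²(ℂⁿ, e^{-|z|²})`. -/
def pullbackLp : BargmannSpace σ m b →ₗ[ℂ] Lp ℂ 2 (gaussian (gram σ m.1 b)) where
  toFun φ := φ.2.2.toLp (pullback σ m b φ)
  map_add' φ ψ := MemLp.toLp_add φ.2.2 ψ.2.2
  map_smul' c φ := MemLp.toLp_const_smul c φ.2.2

variable {σ m b}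

theorem coeFn_pullbackLp (φ : BargmannSpace σ m b) :
    pullbackLp σ m b φ =ᵐ[gaussian (gram σ m.1 b)] pullback σ m b φ := φ.2.2.coeFn_toLp

theorem exists_ofComplexCoords (hsurj : Function.Surjective (phaseExp σ m)) (p : Cotangent n Q) :
    ∃ z, phaseExp σ m (ofComplexCoords σ m b z) = p := by
  obtain ⟨V, rfl⟩ := hsurj p
  obtain ⟨a, c, rfl⟩ := exists_ofHorizVert σ m V
  let b' : Module.Basis (Fin n) ℝ (Eu n) := b
  refine ⟨complexCoords b' (a, c), ?_⟩
  have h1 := (reVec_apply b' _).symm.trans (reVec_complexCoords b' a c)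
  have h2 := (imVec_apply b' _).symm.trans (imVec_complexCoords b' a c)
  exact congrArg (phaseExp σ m) (congrArg₂ (ofHorizVert σ m) h1 h2)

theorem inner_pullbackLp (φ ψ : BargmannSpace σ m b) :
    inner ℂ (pullbackLp σ m b φ) (pullbackLp σ m b ψ) = ∫ z : Fin n → ℂ,
      (starRingEnd ℂ) (pullback σ m b φ z) * pullback σ m b ψ z *
        (Real.exp (-absSq (gram σ m.1 b) z) : ℂ) := by
  rw [L2.inner_def, ← integral_gaussian]
  refine integral_congr_ae ?_
  filter_upwards [coeFn_pullbackLp φ, coeFn_pullbackLp ψ] with z h1 h2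
  rw [h1, h2, RCLike.inner_apply, mul_comm]

variable [T2Space Q]

/-- An entire function vanishing almost everywhere is zero, and `exp_m` is surjective. -/
theorem pullbackLp_injective (hflat : IsFlat (𝓡 n) σ.inner)
    (hcomp : GeodesicallyComplete (𝓡 n) σ.inner) (hsurj : Function.Surjective (phaseExp σ m)) :
    Function.Injective (pullbackLp σ m b) := by
  intro φ ψ h
  have h1 : ∀ φ : BargmannSpace σ m b, Continuous (pullback σ m b φ) := fun φ =>
    (φ.2.1.differentiable_pullback hflat hcomp m b).continuous
  have h2 : pullback σ m b φ =ᵐ[gaussian (gram σ m.1 b)] pullback σ m b ψ :=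
    (coeFn_pullbackLp φ).symm.trans (by rw [h]; exact coeFn_pullbackLp ψ)
  have h3 := ((h1 φ).ae_eq_iff_eq _ (h1 ψ)).1 h2
  refine Subtype.ext (funext fun p => ?_)
  obtain ⟨z, rfl⟩ := exists_ofComplexCoords (b := b) hsurj p
  exact congrFun h3 z

/-- The range is closed: a limit of pull-backs `φ_k ∘ exp_m` is an entire function `h`, and as a
pointwise limit it is constant on the fibers of `exp_m`, so it is itself a pull-back. -/
theorem isClosed_range_pullbackLp (hflat : IsFlat (𝓡 n) σ.inner)
    (hcomp : GeodesicallyComplete (𝓡 n) σ.inner) (hsurj : Function.Surjective (phaseExp σ m)) :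
    IsClosed (range (pullbackLp σ m b)) := by
  refine isClosed_of_closure_subset fun F hF => ?_
  obtain ⟨u, hu, hlim⟩ := mem_closure_iff_seq_limit.1 hF
  choose φ hφ using hu
  obtain ⟨h, hh, hFh, hpt⟩ := exists_entire_limit_of_tendsto_toLp (gram σ m.1 b)
    (f := fun k => pullback σ m b (φ k))
    (fun k => (φ k).2.1.differentiable_pullback hflat hcomp m b) (fun k => (φ k).2.2) (F := F)
    (hlim.congr fun k => (hφ k).symm)
  choose s hs using exists_ofComplexCoords (b := b) hsurj
  have hpull : pullback σ m b (fun p => h (s p)) = h := by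
    funext z
    refine tendsto_nhds_unique ((hpt _).congr fun k => ?_) (hpt z)
    exact congrArg (φ k) (hs _)
  have hmem : (fun p => h (s p)) ∈ squareIntegrableHolomorphic σ m b := by
    refine ⟨isHolomorphic_of_differentiable_pullback hflat hcomp m b hsurj ?_, ?_⟩
    · rw [hpull]
      exact hh
    · rw [hpull]
      exact (memLp_congr_ae hFh).1 (Lp.memLp F)
  refine ⟨⟨_, hmem⟩, Lp.ext ((coeFn_pullbackLp _).trans ?_)⟩
  exact (Filter.EventuallyEq.of_eq hpull).trans hFh.symm

theorem pullbackLp_mem_segalBargmann (hflat : IsFlat (𝓡 n) σ.inner)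
    (hcomp : GeodesicallyComplete (𝓡 n) σ.inner) (φ : BargmannSpace σ m b) :
    pullbackLp σ m b φ ∈ SegalBargmann (gram σ m.1 b) :=
  ⟨_, φ.2.1.differentiable_pullback hflat hcomp m b, coeFn_pullbackLp φ⟩

end Pullback

end FlatPhase

end

theorem mainTheorem1 (n : ℕ) (Q : Type*) [TopologicalSpace Q]
    [ChartedSpace (EuclideanSpace ℝ (Fin n)) Q] [IsManifold (𝓡 n) ∞ Q]
    [T2Space Q] [ConnectedSpace Q]
    (σ : FlatPhase.SmoothMetric n Q)
    (hflat : FlatPhase.IsFlat (𝓡 n) σ.inner)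
    (hcomplete : FlatPhase.GeodesicallyComplete (𝓡 n) σ.inner) :
    FlatPhase.GeodesicallyComplete (FlatPhase.cotModel n) (FlatPhase.liftedMetric σ) ∧
    ∀ (m : FlatPhase.Cotangent n Q) (b : Module.Basis (Fin n) ℝ (TangentSpace (𝓡 n) m.1)),
    Function.Surjective (FlatPhase.phaseExp σ m) →
    ∃ c : InnerProductSpace.Core ℂ (FlatPhase.BargmannSpace σ m b),
      (∀ φ ψ : FlatPhase.BargmannSpace σ m b, c.inner φ ψ =
        ∫ z : Fin n → ℂ,
          (starRingEnd ℂ) (φ (FlatPhase.phaseExp σ m (FlatPhase.ofComplexCoords σ m b z))) *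
            ψ (FlatPhase.phaseExp σ m (FlatPhase.ofComplexCoords σ m b z)) *
            (Real.exp (-FlatPhase.absSq (FlatPhase.gram σ m.1 b) z) : ℂ)) ∧
      letI : NormedAddCommGroup (FlatPhase.BargmannSpace σ m b) := c.toNormedAddCommGroup
      letI : InnerProductSpace ℂ (FlatPhase.BargmannSpace σ m b) :=
        InnerProductSpace.ofCore c.toCore
      CompleteSpace (FlatPhase.BargmannSpace σ m b) ∧
      ∃ T : FlatPhase.BargmannSpace σ m b →ₗᵢ[ℂ]
          FlatPhase.SegalBargmann (FlatPhase.gram σ m.1 b),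
        (∀ φ : FlatPhase.BargmannSpace σ m b,
          (T φ : Lp ℂ 2 (FlatPhase.gaussian (FlatPhase.gram σ m.1 b)))
            =ᵐ[FlatPhase.gaussian (FlatPhase.gram σ m.1 b)]
              fun z => φ (FlatPhase.phaseExp σ m (FlatPhase.ofComplexCoords σ m b z))) ∧
        IsClosed (Set.range T) := by
  refine ⟨FlatPhase.geodesicallyComplete_liftedMetric hflat hcomplete, fun m b hsurj => ?_⟩
  obtain ⟨c, hc, hcompl, T, hT, hclosed⟩ := FlatPhase.exists_core_of_injective
    (FlatPhase.pullbackLp σ m b) (FlatPhase.pullbackLp_injective hflat hcomplete hsurj)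
    (FlatPhase.isClosed_range_pullbackLp hflat hcomplete hsurj)
    (FlatPhase.SegalBargmann (FlatPhase.gram σ m.1 b))
    (FlatPhase.pullbackLp_mem_segalBargmann hflat hcomplete)
  exact ⟨c, fun φ ψ => (hc φ ψ).trans (FlatPhase.inner_pullbackLp φ ψ), hcompl, T,
    fun φ => (hT φ).symm ▸ FlatPhase.coeFn_pullbackLp φ, hclosed⟩
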